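/- **Setting.** Let $\Gamma\subset\mathbb R^2$ be a compact convex set whose boundary is a smooth closed curve (parametrized one-to-one on $\mathbb R/L\mathbb Z$ by a smooth unit-speed map), and let $\rho(x_{\rm h})={\bf d}(x_{\rm h},\Gamma)$ be the Euclidean distance to $\Gamma$. Let $\rho_0,H,\beta,\varepsilon_0>0$. Let $\phi$ be a smooth function on $[\rho_0,\infty[$, bounded as well as all its derivatives, with $\phi([\rho_0,\infty[)\subset[0,H]$ and $\phi^{-1}(0)=\{\rho_0\}$. Set $$\mathcal O=\mathbb R^2\setminus\rho^{-1}([0,\rho_0]),\qquad \Omega_\phi=\{(x_{\rm h},z)\in\mathcal O\times\mathbb R:\ -\phi(\rho(x_{\rm h}))<z<0\},$$ and assume that $\{x_{\rm h}\in\mathcal O:\phi'(\rho(x_{\rm h}))=0\}$ is Lebesgue negligible in $\mathbb R^2$. Let $\mathcal V_\sigma$ be the space of divergence free vector fields on $\Omega_\phi$ with components in $H^1_0(\Omega_\phi)$, with the $H^1$ topology. Write $\mathbb R^+=[0,\infty[$, $e_{\rm z}=(0,0,1)$ and $(v^1,v^2)^\perp=(-v^2,v^1)$, and $$\lambda_\phi(r)=\frac{\sqrt{2\beta}}{\phi(r)}\,\frac{1+\sqrt[4]{1+\phi'(r)^2}}2,\qquad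 d_\phi(x_{\rm h},z)=\min\{-z,\phi(\rho(x_{\rm h}))+z\},$$ $$\|F\|_{L^\infty_{\rm h}L^2_{\rm v}}=\sup_{x_{\rm h}\in\mathcal O}\Bigl(\int_{-\phi(\rho(x_{\rm h}))}^0|F(x_{\rm h},z)|^2\,dz\Bigr)^{1/2}.$$ **Proposition 2.2.** There is a constant $C$, depending only on $\Omega_\phi$, $\beta$ and $\varepsilon_0$, such that the following holds. Let $u_0^\theta$ be a smooth function on $[\rho_0,\infty[$ such that the field $u_0(x_{\rm h},z)=u_0^\theta(\rho(x_{\rm h}))\,(\nabla_{\rm h}^\perp\rho(x_{\rm h}),0)$ and all its derivatives belong to $L^2(\mathcal O)$ and such that $u_0^\theta/\phi$ is bounded on $]\rho_0,\infty[$. Set $\overline u(t,x_{\rm h},z)=u_0^\theta(\rho(x_{\rm h}))\,e^{-t\lambda_\phi(\rho(x_{\rm h}))}\,(\nabla_{\rm h}^\perp\rho(x_{\rm h}),0)$. Then there are families, indexed by $0<\varepsilon\le\varepsilon_0$, of vector fields $U_{{\rm app},\varepsilon}\in C^1(\mathbb R^+;\mathcal V_\sigma)$, functions $p_\varepsilon\in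 L^2_{\rm loc}(\mathbb R^+;L^2(\Omega_\phi))$, vector fields $E_\varepsilon\in L^1(\mathbb R^+;L^2(\Omega_\phi))$ and vector fields $U_{{\rm BL},\varepsilon}$, continuous on $\mathbb R^+\times\Omega_\phi$, such that: 1. for every $0<\varepsilon\le\varepsilon_0$, in the sense of distributions, $$\partial_tU_{{\rm app},\varepsilon}-\varepsilon\beta\Delta U_{{\rm app},\varepsilon}+\frac1\varepsilon e_{\rm z}\wedge U_{{\rm app},\varepsilon}=-\frac1\varepsilon\nabla p_\varepsilon+E_\varepsilon\quad\text{in }\mathbb R^+\times\Omega_\phi,$$ and $\lim_{\varepsilon\to0}\|E_\varepsilon\|_{L^1(\mathbb R^+;L^2(\Omega_\phi))}=0$, $\ \lim_{\varepsilon\to0}\|U_{{\rm app},\varepsilon}(0)-u_0\|_{L^2(\Omega_\phi)}=0$; 2. $\lim_{\varepsilon\to0}\|U_{{\rm app},\varepsilon}-\overline u\|_{L^\infty(\mathbb R^+;L^2(\Omega_\phi))}=0$; 3. the family $\bigl(\nabla(U_{{\rm app},\varepsilon}-U_{{\rm BL},\varepsilon})\bigr)_{0<\varepsilon\le\varepsilon_0}$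 is bounded in $L^1(\mathbb R^+;L^\infty(\Omega_\phi))$; 4. for every $0<\varepsilon\le\varepsilon_0$, $$\bigl\|\sqrt{d_\phi}\,U_{{\rm BL},\varepsilon}\bigr\|_{L^\infty(\mathbb R^+;L^\infty_{\rm h}L^2_{\rm v}(\Omega_\phi))}\le C\varepsilon\|u_0\|_{L^\infty(\Omega_\phi)}+C\varepsilon^2\|u_0\|_{W^{1,\infty}(\Omega_\phi)}.$$ -/

import Mathlib

open MeasureTheory Filter Topology Set
open scoped ContDiff ENNReal NNReal

noncomputable section

namespace Ekman

/-- Horizontal plane, with its Euclidean norm. -/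
abbrev E2 : Type := EuclideanSpace ℝ (Fin 2)

/-- Physical space, with its Euclidean norm; the coordinate of index 2 is the vertical one. -/
abbrev E3 : Type := EuclideanSpace ℝ (Fin 3)

/-- Horizontal part `x_h` of a point `x = (x_h, z)`. -/
def hor (x : E3) : E2 := !₂[x 0, x 1]

/-- The point `(y, z)` of `ℝ² × ℝ`. -/
def pt (y : E2) (z : ℝ) : E3 := !₂[y 0, y 1, z]

/-- `v^⊥ = (-v², v¹)`. -/
def perp (v : E2) : E2 := !₂[-v 1, v 0]

/-- The Coriolis term `e_z ∧ v = (-v², v¹, 0)`. -/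
def ezWedge (v : E3) : E3 := !₂[-v 1, v 0, 0]

/-- `Γ` is a compact convex set whose boundary is a smooth closed curve, i.e. is parametrized
one to one by a smooth unit speed map on `ℝ / Lℤ`. -/
structure IsIsland (Γ : Set E2) : Prop where
  compact : IsCompact Γ
  convex : Convex ℝ Γ
  boundary : ∃ (L : ℝ) (γ : ℝ → E2), 0 < L ∧ ContDiff ℝ ∞ γ ∧ Function.Periodic γ L ∧
    InjOn γ (Ico 0 L) ∧ (∀ s, ‖deriv γ s‖ = 1) ∧ range γ = frontier Γ

/-- `ρ(y)`, the Euclidean distance from `y` to `Γ`. -/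
def rho (Γ : Set E2) (y : E2) : ℝ := Metric.infDist y Γ

/-- The surface `𝒪 = ℝ² ∖ ρ⁻¹([0, ρ₀])` of the ocean. -/
def surface (Γ : Set E2) (ρ₀ : ℝ) : Set E2 := (rho Γ ⁻¹' Icc 0 ρ₀)ᶜ

/-- The ocean `Ω_φ = {(y, z) : y ∈ 𝒪, -φ(ρ(y)) < z < 0}`. -/
def ocean (Γ : Set E2) (ρ₀ : ℝ) (φ : ℝ → ℝ) : Set E3 :=
  {x | hor x ∈ surface Γ ρ₀ ∧ -φ (rho Γ (hor x)) < x 2 ∧ x 2 < 0}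

/-- Assumptions on the depth profile `φ`, a function on `[ρ₀, ∞[` (its values to the left of
`ρ₀` play no role). -/
structure IsDepth (Γ : Set E2) (ρ₀ H : ℝ) (φ : ℝ → ℝ) : Prop where
  smooth : ContDiffOn ℝ ∞ φ (Ici ρ₀)
  bounded : ∀ k : ℕ, ∃ M : ℝ, ∀ r ∈ Ici ρ₀, |iteratedDerivWithin k φ (Ici ρ₀) r| ≤ M
  range : ∀ r ∈ Ici ρ₀, φ r ∈ Icc 0 H
  zero : ∀ r ∈ Ici ρ₀, (φ r = 0 ↔ r = ρ₀)
  nowhereFlat : volume {y ∈ surface Γ ρ₀ | deriv φ (rho Γ y) = 0} = 0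

/-- The horizontal field `f(ρ) ∇_h^⊥ ρ` on the plane. -/
def azimuthalH (Γ : Set E2) (f : ℝ → ℝ) (y : E2) : E2 :=
  f (rho Γ y) • perp (gradient (rho Γ) y)

/-- The same field as a three-component field which does not depend on `z`. -/
def azimuthal (Γ : Set E2) (f : ℝ → ℝ) (x : E3) : E3 := pt (azimuthalH Γ f (hor x)) 0

/-- Assumptions on the azimuthal profile `u₀^θ` of the initial datum
`u₀ = u₀^θ(ρ) ∇_h^⊥ ρ`. -/
structure IsWellPrepared (Γ : Set E2) (ρ₀ : ℝ) (φ : ℝ → ℝ) (u₀θ : ℝ → ℝ) : Prop where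
  smooth : ContDiffOn ℝ ∞ u₀θ (Ici ρ₀)
  sobolev : ∀ k : ℕ,
    MemLp (iteratedFDeriv ℝ k (azimuthalH Γ u₀θ)) 2 (volume.restrict (surface Γ ρ₀))
  bounded : ∃ M : ℝ, ∀ r ∈ Ioi ρ₀, |u₀θ r / φ r| ≤ M

/-- The modulated Ekman pumping coefficient `λ_φ(r)`. -/
def pumping (β : ℝ) (φ : ℝ → ℝ) (r : ℝ) : ℝ :=
  √(2 * β) / φ r * ((1 + (1 + deriv φ r ^ 2) ^ (1 / 4 : ℝ)) / 2)

/-- The limit profile `ū(t, x) = u₀^θ(ρ) exp(-t λ_φ(ρ)) ∇_h^⊥ ρ`. -/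
def limitField (Γ : Set E2) (β : ℝ) (φ u₀θ : ℝ → ℝ) (t : ℝ) : E3 → E3 :=
  azimuthal Γ fun r => u₀θ r * Real.exp (-t * pumping β φ r)

/-- Partial derivative `∂_j`. -/
def partialD {F : Type*} [NormedAddCommGroup F] [NormedSpace ℝ F] (j : Fin 3) (ψ : E3 → F)
    (x : E3) : F := fderiv ℝ ψ x (EuclideanSpace.single j 1)

/-- `ψ ∈ C_c^∞(Ω; F)`. -/
structure IsTest {F : Type*} [NormedAddCommGroup F] [NormedSpace ℝ F] (Ω : Set E3)
    (ψ : E3 → F) : Prop where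
  smooth : ContDiff ℝ ∞ ψ
  compact : HasCompactSupport ψ
  support : tsupport ψ ⊆ Ω

/-- `L²(Ω; ℝ³)`. -/
abbrev L2 (Ω : Set E3) : Type := Lp E3 2 (volume.restrict Ω)

/-- Pairs `(u, (∂₁u, ∂₂u, ∂₃u))` with entries in `L²(Ω; ℝ³)`; the norm is equivalent to the
`H¹` norm of `u`. -/
abbrev Pairs (Ω : Set E3) : Type := L2 Ω × (Fin 3 → L2 Ω)

/-- `H¹₀(Ω; ℝ³)`, the closure in `H¹` of the test fields; an element is recorded together with its
weak partial derivatives. The set whose span is taken is already a linear subspace. -/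
def H10 (Ω : Set E3) : Submodule ℝ (Pairs Ω) :=
  (Submodule.span ℝ {w : Pairs Ω | ∃ ψ : E3 → E3, IsTest Ω ψ ∧
    w.1 =ᵐ[volume.restrict Ω] ψ ∧
    ∀ j, w.2 j =ᵐ[volume.restrict Ω] partialD j ψ}).topologicalClosure

/-- `𝒱_σ`, the divergence free fields of `H¹₀(Ω; ℝ³)`, as a normed space with the `H¹` topology. -/
def Vσ (Ω : Set E3) : Submodule ℝ (Pairs Ω) where
  carrier := {w | w ∈ H10 Ω ∧ ∀ᵐ x ∂(volume.restrict Ω), ∑ j : Fin 3, (w.2 j : E3 → E3) x j = 0}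
  zero_mem' := by
    refine ⟨zero_mem _, ?_⟩
    filter_upwards [Lp.coeFn_zero E3 2 (volume.restrict Ω)] with x hx
    have h0 : ∀ j : Fin 3, ((0 : Pairs Ω).2 j : E3 → E3) x = 0 := fun _ => hx
    simp only [h0, PiLp.zero_apply, Finset.sum_const_zero]
  add_mem' := by
    rintro v w ⟨hv, hv'⟩ ⟨hw, hw'⟩
    refine ⟨add_mem hv hw, ?_⟩
    have h : ∀ᵐ x ∂(volume.restrict Ω), ∀ j : Fin 3,
        ((v + w).2 j : E3 → E3) x = (v.2 j : E3 → E3) x + (w.2 j : E3 → E3) x :=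
      ae_all_iff.2 fun j => Lp.coeFn_add (v.2 j) (w.2 j)
    filter_upwards [hv', hw', h] with x h1 h2 h3
    simp only [h3, PiLp.add_apply, Finset.sum_add_distrib, h1, h2, add_zero]
  smul_mem' := by
    rintro c v ⟨hv, hv'⟩
    refine ⟨Submodule.smul_mem _ c hv, ?_⟩
    have h : ∀ᵐ x ∂(volume.restrict Ω), ∀ j : Fin 3,
        ((c • v).2 j : E3 → E3) x = c • (v.2 j : E3 → E3) x :=
      ae_all_iff.2 fun j => Lp.coeFn_smul c (v.2 j)
    filter_upwards [hv', h] with x h1 h3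
    simp only [h3, PiLp.smul_apply, smul_eq_mul, ← Finset.mul_sum, h1, mul_zero]

/-- The field underlying an element of `𝒱_σ`. -/
def velocity {Ω : Set E3} (w : Vσ Ω) : L2 Ω := w.1.1

/-- The weak partial derivative `∂_j` of an element of `𝒱_σ`. -/
def grad {Ω : Set E3} (w : Vσ Ω) (j : Fin 3) : L2 Ω := w.1.2 j

/-- Lebesgue measure on `ℝ⁺ = [0, ∞[`; `L^q(ℝ⁺; X)` is `MemLp · q timeMeasure`. -/
abbrev timeMeasure : Measure ℝ := volume.restrict (Ici 0)

/-- `∂_t U - εβ ΔU + ε⁻¹ e_z ∧ U = -ε⁻¹ ∇p + E` in `ℝ⁺ × Ω`: for almost every time, the equation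
holds in the sense of distributions on `Ω`. -/
def SolvesStokesCoriolis (Ω : Set E3) (β ε : ℝ) (U : ℝ → Vσ Ω)
    (p : ℝ → Lp ℝ 2 (volume.restrict Ω)) (E : ℝ → L2 Ω) : Prop :=
  ∀ᵐ t ∂timeMeasure, ∀ ψ : E3 → E3, IsTest Ω ψ →
    (∫ x in Ω, inner ℝ (velocity (derivWithin U (Ici 0) t) x) (ψ x))
      + ε * β * (∑ j : Fin 3, ∫ x in Ω, inner ℝ (grad (U t) j x) (partialD j ψ x))
      + 1 / ε * (∫ x in Ω, inner ℝ (ezWedge (velocity (U t) x)) (ψ x))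
    = 1 / ε * (∫ x in Ω, p t x * ∑ j : Fin 3, partialD j ψ x j)
      + ∫ x in Ω, inner ℝ (E t x) (ψ x)

/-- `∂_j f = g` in the sense of distributions on `Ω`. -/
def HasWeakPartial (Ω : Set E3) (j : Fin 3) (f g : E3 → E3) : Prop :=
  LocallyIntegrableOn f Ω ∧ LocallyIntegrableOn g Ω ∧
    ∀ ψ : E3 → ℝ, IsTest Ω ψ →
      ∫ x in Ω, partialD j ψ x • f x = -∫ x in Ω, ψ x • g x

/-- `d_φ(y, z) = min {-z, φ(ρ(y)) + z}`. -/
def dφ (Γ : Set E2) (φ : ℝ → ℝ) (x : E3) : ℝ := min (-x 2) (φ (rho Γ (hor x)) + x 2)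

/-- The norm of `L^∞_h L²_v(Ω_φ)`. -/
def hvNorm (Γ : Set E2) (ρ₀ : ℝ) (φ : ℝ → ℝ) (F : E3 → E3) : ℝ≥0∞ :=
  ⨆ y ∈ surface Γ ρ₀,
    (∫⁻ z in Ioo (-φ (rho Γ y)) 0, ‖F (pt y z)‖ₑ ^ 2) ^ (1 / 2 : ℝ)

/-- The norm of `L^∞(Ω)`. -/
def supNorm (Ω : Set E3) (u : E3 → E3) : ℝ≥0∞ := eLpNorm u ∞ (volume.restrict Ω)

/-- The norm of `W^{1,∞}(Ω)`, for a field which is smooth in the open set `Ω`. -/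
def W1Norm (Ω : Set E3) (u : E3 → E3) : ℝ≥0∞ :=
  supNorm Ω u + eLpNorm (fderiv ℝ u) ∞ (volume.restrict Ω)

end Ekman

end

open Ekman

/-! The depth vanishes at the coast and the ocean is unbounded, so the profile `u₀θ` is first
multiplied by two radial cutoffs of parameter `δ`. For fixed `δ` an explicit expansion in `ε` solves
the system up to an error which tends to `0` with `ε`. The two bounds which must survive `δ → 0`
(the gradient of the interior part and the weighted size of the layers) have constants that do not
see `δ`, up to terms of size `C_δ ε`. At the end `δ` is chosen as a function of `ε`
(`exists_diagonal`).

Fixed `δ` (structure `Basin`). Let `ν = ∇ρ`, `τ = ∇^⊥ρ` and `A = exp (-tΛ) f(ρ)`. The interior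
velocity starts with `V0 = A τ`: since `A` depends on `ρ` only, `e_z ∧ V0 = -A ν` is a gradient and
is balanced by the pressure. At the next order `e_z ∧ V1 = -∂_t V0` forces the horizontal part of
`V1` to be `Λ A ν`, which is `∂_z X` for a potential `X` parallel to `ν` and affine in `z`. The
field `wfld X = ∂_z X - (div X) e_z` is divergence free for every `X`, which supplies the vertical
part. The constant in `X` and the rate `Λ` are fixed by the two layers: with `μ = (1 + φ'²)^{1/4}`,
they need `X = (√(2β)/2) A ν` at the surface and `X = -(√(2β) μ/2) A ν` at the bottom. The
difference of these values divided by `φ` is the pumping coefficient.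

Each layer is an azimuthal field with profile `exp (-s) cos s`, `s = S/ε`, plus `ε` times `wfld` of
a potential carried by both Ekman profiles (`Basin.LF_eq`). Azimuthal fields with axisymmetric
amplitude and `wfld`s are both divergence free, so the sum is exactly solenoidal (`Basin.divg_F`).
The profiles take the values `1` and `0` at `s = 0`, so the layers cancel `V0 + ε V1` exactly at the
surface and at the bottom (`Basin.F_top`, `Basin.F_bot`). No corrector is needed, and the field lies
in `𝒱_σ` (`Basin.pair_mem_H10`).

The terms of order `ε⁻¹` in the residual of a layer vanish on the boundary only (`Basin.ekman_top`,
`Basin.ekman_bot`, with a layer pressure over the sloping bottom). Inside they are `O(S/ε)`, which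
the exponential absorbs. Hence the residual is bounded by `exp (-ct)` times `ε` plus boundary layer
exponentials (`Basin.E_bound`), and this tends to `0` in `L¹(ℝ⁺; L²)`.

Uniformity in `δ`. In `∇V0` the dangerous term is `t λ' f exp (-tλ)`: here `λ' = O(φ⁻²)`, `f = O(φ)`
and `λ ≥ √(2β)/φ`, so it is of the form `s exp (-s)` (`Basin.norm_partialD_V0_le`,
`OceanData.exists_bound_gradient`). The derivative of the truncated profile is controlled through
`|u₀θ| = O(φ) = O(ρ - ρ₀)` and a bound of `u₀θ'`, obtained from the Sobolev assumption along normal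
rays (`exists_bound_deriv_profile`). For the layers, the amplitudes on the boundary involve `sup
|u₀θ|` alone, and all that depends on derivatives of the truncated data carries a factor `ε`
(`Basin.LF_bound`).

All this requires the distance to the island to be smooth outside of it: by convexity the nearest
boundary point is a nondegenerate critical point, and the implicit function theorem applies
(`IsIsland.contDiffAt_rho`). -/

noncomputable section

namespace Ekman

/-! ### Differential calculus in Cartesian coordinates -/

section Calculus

variable {V W : Type*} [NormedAddCommGroup V] [NormedSpace ℝ V] [NormedAddCommGroup W]
  [NormedSpace ℝ W]

/-- The `j`-th vector of the canonical basis. -/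
abbrev bas (j : Fin 3) : E3 := EuclideanSpace.single j 1

/-- The Laplacian. -/
def lap (g : E3 → V) (x : E3) : V := ∑ j : Fin 3, partialD j (partialD j g) x

/-- The divergence. -/
def divg (Y : E3 → E3) (x : E3) : ℝ := ∑ j : Fin 3, partialD j Y x j

theorem contDiff_partialD {g : E3 → V} (hg : ContDiff ℝ ∞ g) (j : Fin 3) :
    ContDiff ℝ ∞ (partialD j g) := by
  unfold partialD
  exact (hg.fderiv_right (m := ∞) (by simp)).clm_apply contDiff_const

theorem contDiff_diff {E : Type*} [NormedAddCommGroup E] [NormedSpace ℝ E] {g : E → V}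
    (hg : ContDiff ℝ ∞ g) : Differentiable ℝ g := hg.differentiable (by simp)

theorem partialD_add {a b : E3 → V} (ha : ContDiff ℝ ∞ a) (hb : ContDiff ℝ ∞ b) (j : Fin 3)
    (x : E3) : partialD j (fun x => a x + b x) x = partialD j a x + partialD j b x := by
  unfold partialD
  rw [fderiv_fun_add (contDiff_diff ha x) (contDiff_diff hb x)]; rfl

theorem partialD_sub {a b : E3 → V} (ha : ContDiff ℝ ∞ a) (hb : ContDiff ℝ ∞ b) (j : Fin 3)
    (x : E3) : partialD j (fun x => a x - b x) x = partialD j a x - partialD j b x := by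
  unfold partialD
  rw [fderiv_fun_sub (contDiff_diff ha x) (contDiff_diff hb x)]; rfl

theorem partialD_smul {c : E3 → ℝ} {a : E3 → V} (hc : ContDiff ℝ ∞ c) (ha : ContDiff ℝ ∞ a)
    (j : Fin 3) (x : E3) :
    partialD j (fun x => c x • a x) x = partialD j c x • a x + c x • partialD j a x := by
  unfold partialD
  rw [fderiv_fun_smul (contDiff_diff hc x) (contDiff_diff ha x)]
  simp [add_comm]

theorem partialD_mul {c a : E3 → ℝ} (hc : ContDiff ℝ ∞ c) (ha : ContDiff ℝ ∞ a)
    (j : Fin 3) (x : E3) :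
    partialD j (fun x => c x * a x) x = partialD j c x * a x + c x * partialD j a x :=
  partialD_smul hc ha j x

theorem partialD_const (v : V) (j : Fin 3) (x : E3) : partialD j (fun _ => v) x = 0 := by
  simp [partialD]

theorem partialD_const_smul (c : ℝ) {a : E3 → V} (ha : ContDiff ℝ ∞ a) (j : Fin 3) (x : E3) :
    partialD j (fun x => c • a x) x = c • partialD j a x := by
  rw [partialD_smul contDiff_const ha, partialD_const]; simp

theorem partialD_neg (a : E3 → V) (j : Fin 3) (x : E3) :
    partialD j (fun x => - a x) x = - partialD j a x := by
  unfold partialD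
  rw [fderiv_fun_neg]; rfl

theorem partialD_clm (T : V →L[ℝ] W) {a : E3 → V} (ha : ContDiff ℝ ∞ a) (j : Fin 3) (x : E3) :
    partialD j (fun x => T (a x)) x = T (partialD j a x) := by
  unfold partialD
  have := (T.hasFDerivAt.comp x (contDiff_diff ha x).hasFDerivAt).fderiv
  simp only [Function.comp_def] at this
  rw [this]; rfl

theorem partialD_comp {k : ℝ → ℝ} {S : E3 → ℝ} (hS : ContDiff ℝ ∞ S) {k' : ℝ} (j : Fin 3)
    (x : E3) (hk : HasDerivAt k k' (S x)) :
    partialD j (fun x => k (S x)) x = k' * partialD j S x := by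
  unfold partialD
  have := (hk.comp_hasFDerivAt x (contDiff_diff hS x).hasFDerivAt).fderiv
  simp only [Function.comp_def] at this
  rw [this]; rfl

theorem partialD_comm {a : E3 → V} (ha : ContDiff ℝ ∞ a) (i j : Fin 3) (x : E3) :
    partialD i (partialD j a) x = partialD j (partialD i a) x := by
  have key : ∀ i j : Fin 3, partialD i (partialD j a) x
      = fderiv ℝ (fderiv ℝ a) x (bas i) (bas j) := by
    intro i j
    have h1 : DifferentiableAt ℝ (fderiv ℝ a) x :=
      contDiff_diff (ha.fderiv_right (m := ∞) (by simp)) x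
    have : partialD i (partialD j a) x
      = fderiv ℝ (fun y => fderiv ℝ a y (bas j)) x (bas i) := rfl
    rw [this, fderiv_clm_apply h1 (differentiableAt_const _)]
    simp
  rw [key, key]
  have hsym : IsSymmSndFDerivAt ℝ a x :=
    (contDiff_infty.1 ha 2).contDiffAt.isSymmSndFDerivAt (by simp)
  exact hsym.eq _ _

theorem partialD_congr_of_eventuallyEq {a b : E3 → V} {x : E3} (h : a =ᶠ[𝓝 x] b) (j : Fin 3) :
    partialD j a x = partialD j b x := by
  unfold partialD
  rw [h.fderiv_eq]

/-- The vertical coordinate and the horizontal part, as continuous linear maps. -/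
def crd (j : Fin 3) : E3 →L[ℝ] ℝ := EuclideanSpace.proj j

@[simp] theorem crd_apply (j : Fin 3) (x : E3) : crd j x = x j := rfl

theorem contDiff_crd (j : Fin 3) : ContDiff ℝ ∞ (fun x : E3 => x j) := (crd j).contDiff

theorem partialD_crd (i j : Fin 3) (x : E3) :
    partialD i (fun x : E3 => x j) x = if i = j then 1 else 0 := by
  have : partialD i (fun x : E3 => x j) x = fderiv ℝ (crd j) x (bas i) := rfl
  rw [this, ContinuousLinearMap.fderiv]
  simp [eq_comm]

/-- Construct a continuous linear map into `E3` from its coordinates. -/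
def mk3 (a b c : V →L[ℝ] ℝ) : V →L[ℝ] E3 :=
  a.smulRight (bas 0) + b.smulRight (bas 1) + c.smulRight (bas 2)

theorem mk3_apply (a b c : V →L[ℝ] ℝ) (v : V) : mk3 a b c v = !₂[a v, b v, c v] := by
  ext i; fin_cases i <;> simp [mk3]

/-- `v ↦ e_z ∧ v` as a continuous linear map. -/
def ezL : E3 →L[ℝ] E3 := mk3 (-crd 1) (crd 0) 0

theorem ezL_apply (v : E3) : ezL v = ezWedge v := by
  rw [ezL, mk3_apply]; rfl

/-- `hor` as a continuous linear map. -/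
def horL : E3 →L[ℝ] E2 :=
  (crd 0).smulRight (EuclideanSpace.single 0 1) + (crd 1).smulRight (EuclideanSpace.single 1 1)

theorem horL_apply (x : E3) : horL x = hor x := by
  ext i; fin_cases i <;> simp [horL, hor]

theorem contDiff_hor : ContDiff ℝ ∞ hor := by
  have : hor = horL := by ext1 x; exact (horL_apply x).symm
  rw [this]; exact horL.contDiff

theorem continuous_hor : Continuous hor := contDiff_hor.continuous

@[simp] theorem hor_pt (y : E2) (z : ℝ) : hor (pt y z) = y := by
  ext i; fin_cases i <;> simp [hor, pt]

@[simp] theorem pt_two (y : E2) (z : ℝ) : pt y z 2 = z := by simp [pt]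

@[simp] theorem pt_hor (x : E3) : pt (hor x) (x 2) = x := by
  ext i; fin_cases i <;> simp [hor, pt]

theorem hasDerivAt_pt (y : E2) (z : ℝ) : HasDerivAt (pt y) (bas 2) z := by
  have h : pt y = fun s : ℝ => pt y 0 + s • bas 2 := by
    funext s; ext i; fin_cases i <;> simp [pt]
  rw [h]
  simpa using ((hasDerivAt_id z).smul_const (bas 2)).const_add (pt y 0)

theorem hasDerivAt_vertical {g : E3 → V} (hg : ContDiff ℝ ∞ g) (y : E2) (z : ℝ) :
    HasDerivAt (fun s => g (pt y s)) (partialD 2 g (pt y z)) z :=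
  ((contDiff_diff hg (pt y z)).hasFDerivAt).comp_hasDerivAt z (hasDerivAt_pt y z)

/-- `∂_z Y - (div Y) e_z`: the curl of `e_z ∧ Y` up to sign, for a horizontal field `Y`. -/
def wfld (Y : E3 → E3) (x : E3) : E3 := partialD 2 Y x - divg Y x • bas 2

/-- The bilinear form `s₂ v - (v · s) e_z` which appears in the Leibniz rule for `wfld`. -/
def wsym (s v : E3) : E3 := s 2 • v - (∑ j : Fin 3, v j * s j) • bas 2

/-- The gradient of a function on `E3`, in coordinates. -/
def grd (S : E3 → ℝ) (x : E3) : E3 := !₂[partialD 0 S x, partialD 1 S x, partialD 2 S x]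

@[simp] theorem grd_apply (S : E3 → ℝ) (x : E3) (j : Fin 3) : grd S x j = partialD j S x := by
  fin_cases j <;> simp [grd]

theorem contDiff_divg {Y : E3 → E3} (hY : ContDiff ℝ ∞ Y) : ContDiff ℝ ∞ (divg Y) := by
  unfold divg
  exact ContDiff.sum fun j _ => (crd j).contDiff.comp (contDiff_partialD hY j)

theorem contDiff_wfld {Y : E3 → E3} (hY : ContDiff ℝ ∞ Y) : ContDiff ℝ ∞ (wfld Y) :=
  (contDiff_partialD hY 2).sub ((contDiff_divg hY).smul contDiff_const)

theorem partialD_apply {Y : E3 → E3} (hY : ContDiff ℝ ∞ Y) (i j : Fin 3) (x : E3) :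
    partialD i (fun x => Y x j) x = partialD i Y x j :=
  partialD_clm (crd j) hY i x

theorem partialD_divg {Y : E3 → E3} (hY : ContDiff ℝ ∞ Y) (i : Fin 3) (x : E3) :
    partialD i (divg Y) x = divg (partialD i Y) x := by
  have h : ∀ j, ContDiff ℝ ∞ (fun x => partialD j Y x j) := fun j =>
    (crd j).contDiff.comp (contDiff_partialD hY j)
  have : divg Y = fun x => (partialD 0 Y x 0 + partialD 1 Y x 1) + partialD 2 Y x 2 := by
    funext x; simp [divg, Fin.sum_univ_three]
  rw [this, partialD_add ((h 0).add (h 1)) (h 2), partialD_add (h 0) (h 1)]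
  simp only [partialD_apply (contDiff_partialD hY _), divg, Fin.sum_univ_three,
    partialD_comm hY i]

/-- Both terms of `wfld` contribute `∂_z (div Y)`, with opposite signs. Any choice of potential thus
gives an admissible velocity, cutoffs included. -/
theorem divg_wfld {Y : E3 → E3} (hY : ContDiff ℝ ∞ Y) (x : E3) : divg (wfld Y) x = 0 := by
  have h2 : ∀ j : Fin 3, partialD j (wfld Y) x
      = partialD j (partialD 2 Y) x - partialD j (divg Y) x • bas 2 := by
    intro j
    have h4 : ContDiff ℝ ∞ (fun x => divg Y x • bas 2) := (contDiff_divg hY).smul contDiff_const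
    unfold wfld
    rw [partialD_sub (contDiff_partialD hY 2) h4,
      partialD_smul (contDiff_divg hY) contDiff_const, partialD_const]
    simp
  have h3 : divg (wfld Y) x = divg (partialD 2 Y) x - partialD 2 (divg Y) x := by
    simp [divg, h2, Fin.sum_univ_three]
  rw [h3, partialD_divg hY, sub_self]

theorem wfld_neg (a : E3 → E3) (x : E3) : wfld (fun x => - a x) x = - wfld a x := by
  ext i
  simp only [wfld, divg, partialD_neg, Fin.sum_univ_three]
  simp
  split_ifs <;> ring

theorem lap_add {a b : E3 → V} (ha : ContDiff ℝ ∞ a) (hb : ContDiff ℝ ∞ b)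
    (x : E3) : lap (fun x => a x + b x) x = lap a x + lap b x := by
  have : ∀ j, partialD j (fun x => a x + b x) = fun x => partialD j a x + partialD j b x :=
    fun j => funext fun x => partialD_add ha hb j x
  simp only [lap, this, partialD_add (contDiff_partialD ha _) (contDiff_partialD hb _),
    Finset.sum_add_distrib]

theorem lap_const_smul (c : ℝ) {a : E3 → V} (ha : ContDiff ℝ ∞ a)
    (x : E3) : lap (fun x => c • a x) x = c • lap a x := by
  have : ∀ j, partialD j (fun x => c • a x) = fun x => c • partialD j a x :=
    fun j => funext fun x => partialD_const_smul c ha j x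
  simp only [lap, this, partialD_const_smul c (contDiff_partialD ha _), Finset.smul_sum]

theorem contDiff_lap {a : E3 → V} (ha : ContDiff ℝ ∞ a) : ContDiff ℝ ∞ (lap a) := by
  unfold lap
  exact ContDiff.sum fun j _ => contDiff_partialD (contDiff_partialD ha j) j

end Calculus

/-! ### Exponentially decaying coefficients -/

section Decaying

variable {V W : Type*} [NormedAddCommGroup V] [NormedSpace ℝ V] [NormedAddCommGroup W]
  [NormedSpace ℝ W]

/-- Finite sums of functions `t ^ i * exp (-t Λ(x)) • G(x)` with `G` smooth and vanishing at the
points whose horizontal part is not in `K`. -/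
inductive Dec (Λ : E3 → ℝ) (K : Set E2) {V : Type*} [NormedAddCommGroup V] [NormedSpace ℝ V] :
    (ℝ → E3 → V) → Prop
  | mono (i : ℕ) (G : E3 → V) (hG : ContDiff ℝ ∞ G) (hK : ∀ x, hor x ∉ K → G x = 0) :
      Dec Λ K fun t x => (t ^ i * Real.exp (-t * Λ x)) • G x
  | add {f g : ℝ → E3 → V} (hf : Dec Λ K f) (hg : Dec Λ K g) : Dec Λ K fun t x => f t x + g t x

variable {Λ : E3 → ℝ} {K : Set E2} {f g : ℝ → E3 → V}

theorem Dec.eq_zero (h : Dec Λ K f) (t : ℝ) {x : E3} (hx : hor x ∉ K) : f t x = 0 := by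
  induction h with
  | mono i G hG hK => simp [hK x hx]
  | add _ _ h1 h2 => simp [h1, h2]

theorem Dec.contDiff (hΛ : ContDiff ℝ ∞ Λ) (h : Dec Λ K f) :
    ContDiff ℝ ∞ (fun q : ℝ × E3 => f q.1 q.2) := by
  induction h with
  | mono i G hG hK => fun_prop
  | add _ _ h1 h2 => exact h1.add h2

theorem contDiff_slice {E F : Type*} [NormedAddCommGroup E] [NormedSpace ℝ E]
    [NormedAddCommGroup F] [NormedSpace ℝ F] {f : F → E → V}
    (h : ContDiff ℝ ∞ (fun q : F × E => f q.1 q.2)) (t : F) : ContDiff ℝ ∞ (f t) :=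
  h.comp (contDiff_const.prodMk contDiff_id)

theorem Dec.smooth (hΛ : ContDiff ℝ ∞ Λ) (h : Dec Λ K f) (t : ℝ) : ContDiff ℝ ∞ (f t) :=
  contDiff_slice (h.contDiff hΛ) t

theorem Dec.differentiableAt_time (hΛ : ContDiff ℝ ∞ Λ) (h : Dec Λ K f) (t : ℝ) (x : E3) :
    DifferentiableAt ℝ (fun s => f s x) t := by
  have : ContDiff ℝ ∞ (fun s => f s x) :=
    (h.contDiff hΛ).comp (contDiff_id.prodMk contDiff_const)
  exact contDiff_diff this t

theorem Dec.clm (h : Dec Λ K f) (T : V →L[ℝ] W) : Dec Λ K fun t x => T (f t x) := by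
  induction h with
  | mono i G hG hK =>
    simp only [map_smul]
    exact .mono i _ (T.contDiff.comp hG) fun x hx => by simp [hK x hx]
  | add _ _ h1 h2 => simpa only [map_add] using h1.add h2

theorem Dec.smul (h : Dec Λ K f) {a : E3 → ℝ} (ha : ContDiff ℝ ∞ a) :
    Dec Λ K fun t x => a x • f t x := by
  induction h with
  | mono i G hG hK =>
    simp only [smul_comm (a _)]
    exact .mono i _ (ha.smul hG) fun x hx => by simp [hK x hx]
  | add _ _ h1 h2 => simpa only [smul_add] using h1.add h2

theorem Dec.const_smul (h : Dec Λ K f) (c : ℝ) : Dec Λ K fun t x => c • f t x :=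
  h.smul contDiff_const

theorem Dec.smul_vec {f : ℝ → E3 → ℝ} (h : Dec Λ K f) {v : E3 → V} (hv : ContDiff ℝ ∞ v) :
    Dec Λ K fun t x => f t x • v x := by
  induction h with
  | mono i G hG hK =>
    simp only [smul_assoc]
    exact .mono i _ (hG.smul hv) fun x hx => by simp [hK x hx]
  | add _ _ h1 h2 => simpa only [add_smul] using h1.add h2

theorem Dec.neg (h : Dec Λ K f) : Dec Λ K fun t x => - f t x := by
  simpa only [neg_smul, one_smul] using h.const_smul (-1)

theorem Dec.sub (h : Dec Λ K f) (h' : Dec Λ K g) : Dec Λ K fun t x => f t x - g t x := by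
  simpa only [sub_eq_add_neg] using h.add h'.neg

theorem Dec.zero : Dec Λ K fun (_ : ℝ) (_ : E3) => (0 : V) := by
  simpa only [smul_zero] using
    Dec.mono (Λ := Λ) (K := K) 0 (fun _ => (0 : V)) contDiff_const (fun _ _ => rfl)

theorem Dec.sum {ι : Type*} {F : ι → ℝ → E3 → V} (s : Finset ι) (h : ∀ i ∈ s, Dec Λ K (F i)) :
    Dec Λ K fun t x => ∑ i ∈ s, F i t x := by
  classical
  induction s using Finset.induction_on with
  | empty => simpa using Dec.zero
  | insert a s ha ih =>
    simp only [Finset.sum_insert ha]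
    exact (h a (by simp)).add (ih fun i hi => h i (by simp [hi]))

theorem partialD_eq_zero_of_hor (hK : IsClosed K) {G : E3 → V}
    (hG : ∀ x, hor x ∉ K → G x = 0) (j : Fin 3) {x : E3} (hx : hor x ∉ K) :
    partialD j G x = 0 := by
  have : G =ᶠ[𝓝 x] fun _ => 0 := by
    filter_upwards [(hK.isOpen_compl.preimage continuous_hor).mem_nhds hx] with y hy using hG y hy
  rw [partialD_congr_of_eventuallyEq this, partialD_const]

/-- A space derivative which falls on the exponential brings down `-t ∂_j Λ`; this is why powers of
`t` are part of the class. -/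
theorem Dec.partialD (hΛ : ContDiff ℝ ∞ Λ) (hK : IsClosed K) (h : Dec Λ K f) (j : Fin 3) :
    Dec Λ K fun t x => partialD j (f t) x := by
  induction h with
  | mono i G hG hK' =>
    have key : ∀ t x, Ekman.partialD j (fun x => (t ^ i * Real.exp (-t * Λ x)) • G x) x
        = (t ^ (i + 1) * Real.exp (-t * Λ x)) • ((- Ekman.partialD j Λ x) • G x)
          + (t ^ i * Real.exp (-t * Λ x)) • Ekman.partialD j G x := by
      intro t x
      have h1 : ContDiff ℝ ∞ (fun x => t ^ i * Real.exp (-t * Λ x)) := by fun_prop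
      rw [partialD_smul h1 hG]
      have h2 : HasDerivAt (fun s => t ^ i * Real.exp (-t * s))
          (t ^ i * (Real.exp (-t * Λ x) * -t)) (Λ x) := by
        have := ((hasDerivAt_id (Λ x)).const_mul (-t)).exp.const_mul (t ^ i)
        simpa using this
      rw [partialD_comp hΛ j x h2, smul_smul]
      congr 2
      ring
    simp only [key]
    refine .add (.mono (i + 1) _ ?_ fun x hx => by simp [hK' x hx])
      (.mono i _ (contDiff_partialD hG j) fun x hx => partialD_eq_zero_of_hor hK hK' j hx)
    exact (contDiff_partialD hΛ j).neg.smul hG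
  | add hf hg h1 h2 =>
    simp only [partialD_add (hf.smooth hΛ _) (hg.smooth hΛ _)]
    exact h1.add h2

theorem Dec.time (hΛ : ContDiff ℝ ∞ Λ) (h : Dec Λ K f) :
    Dec Λ K fun t x => deriv (fun s => f s x) t := by
  induction h with
  | mono i G hG hK' =>
    -- For `i = 0` the truncated exponent `i - 1` is harmless, because the coefficient `i` vanishes.
    have key : ∀ t x, deriv (fun s : ℝ => (s ^ i * Real.exp (-s * Λ x)) • G x) t
        = (t ^ (i - 1) * Real.exp (-t * Λ x)) • ((i : ℝ) • G x)
          + (t ^ i * Real.exp (-t * Λ x)) • ((- Λ x) • G x) := by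
      intro t x
      have h1 : HasDerivAt (fun s : ℝ => Real.exp (-s * Λ x)) (Real.exp (-t * Λ x) * (-Λ x)) t := by
        simpa using ((hasDerivAt_id t).neg.mul_const (Λ x)).exp
      rw [(((hasDerivAt_pow i t).fun_mul h1).smul_const (G x)).deriv, smul_smul, smul_smul, ← add_smul]
      congr 1
      ring
    simp only [key]
    exact .add (.mono _ _ (contDiff_const.smul hG) fun x hx => by simp [hK' x hx])
      (.mono i _ (hΛ.neg.smul hG) fun x hx => by simp [hK' x hx])
  | add hf hg h1 h2 =>
    simp only [deriv_fun_add (hf.differentiableAt_time hΛ _ _) (hg.differentiableAt_time hΛ _ _)]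
    exact h1.add h2

/-- Half of the decay rate `2c` absorbs the powers of `t`, through `(ct)^i / i! ≤ exp (ct)`; the
other half remains. -/
theorem Dec.bound {c : ℝ} (hc : 0 < c) {D : Set E3} (hD : IsCompact D)
    (hΛc : ∀ x ∈ D, 2 * c ≤ Λ x) (h : Dec Λ K f) :
    ∃ C, 0 ≤ C ∧ ∀ t, 0 ≤ t → ∀ x ∈ D, ‖f t x‖ ≤ C * Real.exp (-c * t) := by
  induction h with
  | mono i G hG hK =>
    obtain ⟨B, hB⟩ := hD.exists_bound_of_continuousOn hG.continuous.continuousOn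
    refine ⟨(i.factorial / c ^ i) * |B|, by positivity, fun t ht x hx => ?_⟩
    have h1 : t ^ i ≤ i.factorial / c ^ i * Real.exp (c * t) := by
      have := Real.pow_div_factorial_le_exp (c * t) (by positivity) i
      rw [div_le_iff₀ (by positivity), mul_pow] at this
      rw [div_mul_eq_mul_div, le_div_iff₀ (by positivity)]
      linarith
    have h2 : Real.exp (-t * Λ x) ≤ Real.exp (-(c * t)) * Real.exp (-c * t) := by
      rw [← Real.exp_add]
      apply Real.exp_le_exp.2
      nlinarith [hΛc x hx]
    have h3 : ‖G x‖ ≤ |B| := (hB x hx).trans (le_abs_self B)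
    rw [norm_smul, Real.norm_of_nonneg (by positivity)]
    calc t ^ i * Real.exp (-t * Λ x) * ‖G x‖
        ≤ (i.factorial / c ^ i * Real.exp (c * t)) * (Real.exp (-(c * t)) * Real.exp (-c * t))
            * |B| := by gcongr
      _ = i.factorial / c ^ i * |B| * Real.exp (-c * t)
            * (Real.exp (c * t) * Real.exp (-(c * t))) := by ring
      _ = _ := by rw [← Real.exp_add]; simp
  | add _ _ h1 h2 =>
    obtain ⟨C1, h10, h1⟩ := h1
    obtain ⟨C2, h20, h2⟩ := h2
    refine ⟨C1 + C2, by positivity, fun t ht x hx => ?_⟩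
    rw [add_mul]
    exact norm_add_le_of_le (h1 t ht x hx) (h2 t ht x hx)

/-- Mean value inequality on a vertical segment. It compares an amplitude inside a layer with its
value at the boundary, where the Ekman equations hold. -/
theorem Dec.vertical_bound (hΛ : ContDiff ℝ ∞ Λ) (hK : IsClosed K) {c : ℝ} (hc : 0 < c)
    {D : Set E3} (hD : IsCompact D) (hΛc : ∀ x ∈ D, 2 * c ≤ Λ x) (h : Dec Λ K f) :
    ∃ C, 0 ≤ C ∧ ∀ t, 0 ≤ t → ∀ (x : E3) (z : ℝ), (∀ s ∈ uIcc z (x 2), pt (hor x) s ∈ D) →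
      ‖f t x - f t (pt (hor x) z)‖ ≤ C * Real.exp (-c * t) * |x 2 - z| := by
  obtain ⟨C, hC, hb⟩ := (h.partialD hΛ hK 2).bound hc hD hΛc
  refine ⟨C, hC, fun t ht x z hs => ?_⟩
  have := (convex_uIcc z (x 2)).norm_image_sub_le_of_norm_hasDerivWithin_le
    (f := fun s => f t (pt (hor x) s)) (f' := fun s => Ekman.partialD 2 (f t) (pt (hor x) s))
    (C := C * Real.exp (-c * t))
    (fun s _ => (hasDerivAt_vertical (h.smooth hΛ t) (hor x) s).hasDerivWithinAt)
    (fun s hs' => hb t ht _ (hs s hs')) left_mem_uIcc right_mem_uIcc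
  simpa using this

theorem Dec.lap (hΛ : ContDiff ℝ ∞ Λ) (hK : IsClosed K) (h : Dec Λ K f) :
    Dec Λ K fun t x => lap (f t) x :=
  Dec.sum _ fun j _ => (h.partialD hΛ hK j).partialD hΛ hK j

theorem Dec.wfld {f : ℝ → E3 → E3} (hΛ : ContDiff ℝ ∞ Λ) (hK : IsClosed K) (h : Dec Λ K f) :
    Dec Λ K fun t x => wfld (f t) x :=
  (h.partialD hΛ hK 2).sub
    ((Dec.sum _ fun j _ => (h.partialD hΛ hK j).clm (crd j)).smul_vec contDiff_const)

/-- `v ↦ wsym s v` as a continuous linear map. -/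
def wsymL (s : E3) : E3 →L[ℝ] E3 :=
  s 2 • ContinuousLinearMap.id ℝ E3 - (∑ j : Fin 3, s j • crd j).smulRight (bas 2)

theorem wsymL_apply (s v : E3) : wsymL s v = wsym s v := by
  simp [wsymL, wsym, mul_comm, Fin.sum_univ_three]

theorem Dec.wsym {f : ℝ → E3 → E3} (h : Dec Λ K f) {s : E3 → E3} (hs : ContDiff ℝ ∞ s) :
    Dec Λ K fun t x => wsym (s x) (f t x) := by
  have hj : ∀ j : Fin 3, ContDiff ℝ ∞ fun x => s x j := fun j => (crd j).contDiff.comp hs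
  refine (h.smul (hj 2)).sub (Dec.smul_vec ?_ contDiff_const)
  have := Dec.sum (Finset.univ : Finset (Fin 3)) (F := fun j t x => s x j • f t x j)
    fun j _ => (h.clm (crd j)).smul (hj j)
  simpa only [smul_eq_mul, mul_comm] using this

theorem contDiff_grd {S : E3 → ℝ} (hS : ContDiff ℝ ∞ S) : ContDiff ℝ ∞ (grd S) := by
  rw [contDiff_euclidean]
  intro j
  simpa using contDiff_partialD hS j

end Decaying

/-! ### Boundary layers -/

section Layers

variable {V W : Type*} [NormedAddCommGroup V] [NormedSpace ℝ V] [NormedAddCommGroup W]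
  [NormedSpace ℝ W]

/-- The Ekman profile `exp (-s) cos s`. -/
def kc (s : ℝ) : ℝ := Real.exp (-s) * Real.cos s

/-- The Ekman profile `exp (-s) sin s`. -/
def ks (s : ℝ) : ℝ := Real.exp (-s) * Real.sin s

theorem contDiff_kc : ContDiff ℝ ∞ kc := by unfold kc; fun_prop

theorem contDiff_ks : ContDiff ℝ ∞ ks := by unfold ks; fun_prop

theorem hasDerivAt_kc (s : ℝ) : HasDerivAt kc (-kc s - ks s) s := by
  have := ((hasDerivAt_id s).neg.exp).fun_mul (Real.hasDerivAt_cos s)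
  refine this.congr_deriv ?_
  simp [kc, ks]; ring

theorem hasDerivAt_ks (s : ℝ) : HasDerivAt ks (kc s - ks s) s := by
  have := ((hasDerivAt_id s).neg.exp).fun_mul (Real.hasDerivAt_sin s)
  refine this.congr_deriv ?_
  simp [kc, ks]; ring

theorem abs_kc_le (s : ℝ) : |kc s| ≤ Real.exp (-s) := by
  rw [kc, abs_mul, Real.abs_exp]
  exact mul_le_of_le_one_right (Real.exp_nonneg _) (Real.abs_cos_le_one s)

theorem abs_ks_le (s : ℝ) : |ks s| ≤ Real.exp (-s) := by
  rw [ks, abs_mul, Real.abs_exp]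
  exact mul_le_of_le_one_right (Real.exp_nonneg _) (Real.abs_sin_le_one s)

/-- The layer of width `ε` in the variable `S`, with amplitudes `a` and `b`. -/
def lay (S : E3 → ℝ) (ε : ℝ) (a b : E3 → V) (x : E3) : V :=
  kc (ε⁻¹ * S x) • a x + ks (ε⁻¹ * S x) • b x

/-- `|∇S|²`. -/
def nsq (S : E3 → ℝ) (x : E3) : ℝ := ∑ j : Fin 3, partialD j S x ^ 2

/-- `∇S · ∇g`. -/
def dirD (S : E3 → ℝ) (g : E3 → V) (x : E3) : V := ∑ j : Fin 3, partialD j S x • partialD j g x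

variable {S : E3 → ℝ} {ε : ℝ} {a b : E3 → V}

theorem contDiff_nsq (hS : ContDiff ℝ ∞ S) : ContDiff ℝ ∞ (nsq S) := by
  unfold nsq
  exact ContDiff.sum fun j _ => (contDiff_partialD hS j).pow 2

theorem contDiff_lay (hS : ContDiff ℝ ∞ S) (ha : ContDiff ℝ ∞ a) (hb : ContDiff ℝ ∞ b) :
    ContDiff ℝ ∞ (lay S ε a b) :=
  ((contDiff_kc.comp (contDiff_const.mul hS)).smul ha).add
    ((contDiff_ks.comp (contDiff_const.mul hS)).smul hb)

theorem lay_add (a b a' b' : E3 → V) (x : E3) :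
    lay S ε (fun x => a x + a' x) (fun x => b x + b' x) x = lay S ε a b x + lay S ε a' b' x := by
  simp only [lay, smul_add]; abel

theorem lay_clm (T : V →L[ℝ] W) (a b : E3 → V) (x : E3) :
    T (lay S ε a b x) = lay S ε (fun x => T (a x)) (fun x => T (b x)) x := by
  simp [lay]

theorem norm_lay_le (a b : E3 → V) (x : E3) :
    ‖lay S ε a b x‖ ≤ Real.exp (-(ε⁻¹ * S x)) * (‖a x‖ + ‖b x‖) := by
  rw [mul_add]
  refine norm_add_le_of_le ?_ ?_ <;> rw [norm_smul]
  · exact mul_le_mul_of_nonneg_right (abs_kc_le _) (norm_nonneg _)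
  · exact mul_le_mul_of_nonneg_right (abs_ks_le _) (norm_nonneg _)

/-- Since `kc' = -kc - ks` and `ks' = kc - ks`, layers are stable under differentiation, and all
computations take place on the pair of amplitudes. -/
theorem partialD_lay (hS : ContDiff ℝ ∞ S) (ha : ContDiff ℝ ∞ a) (hb : ContDiff ℝ ∞ b)
    (j : Fin 3) (x : E3) :
    partialD j (lay S ε a b) x
      = lay S ε (fun x => partialD j a x + ε⁻¹ • partialD j S x • (b x - a x))
          (fun x => partialD j b x - ε⁻¹ • partialD j S x • (a x + b x)) x := by
  have hS' : ContDiff ℝ ∞ (fun x => ε⁻¹ * S x) := contDiff_const.mul hS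
  have h1 : ContDiff ℝ ∞ (fun x => kc (ε⁻¹ * S x)) := contDiff_kc.comp hS'
  have h2 : ContDiff ℝ ∞ (fun x => ks (ε⁻¹ * S x)) := contDiff_ks.comp hS'
  have h4 : ContDiff ℝ ∞ (fun x => kc (ε⁻¹ * S x) • a x) := h1.smul ha
  have h5 : ContDiff ℝ ∞ (fun x => ks (ε⁻¹ * S x) • b x) := h2.smul hb
  have h3 : partialD j (fun x => ε⁻¹ * S x) x = ε⁻¹ * partialD j S x :=
    partialD_const_smul ε⁻¹ hS j x
  have : lay S ε a b = fun x => kc (ε⁻¹ * S x) • a x + ks (ε⁻¹ * S x) • b x := rfl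
  rw [this, partialD_add h4 h5, partialD_smul h1 ha, partialD_smul h2 hb, partialD_comp hS' j x (hasDerivAt_kc _), partialD_comp hS' j x (hasDerivAt_ks _), h3]
  simp only [lay]
  module

/-- The most singular terms come from `kc'' = 2 ks` and `ks'' = -2 kc`: the viscosity rotates the
pair of amplitudes, which is what the Coriolis term can balance. -/
theorem lap_lay (hS : ContDiff ℝ ∞ S) (ha : ContDiff ℝ ∞ a) (hb : ContDiff ℝ ∞ b) (x : E3) :
    lap (lay S ε a b) x
      = lay S ε
          (fun x => lap a x + ε⁻¹ • (lap S x • (b x - a x) + (2 : ℝ) • (dirD S b x - dirD S a x))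
            - ε⁻¹ ^ 2 • (2 * nsq S x) • b x)
          (fun x => lap b x - ε⁻¹ • (lap S x • (a x + b x) + (2 : ℝ) • (dirD S a x + dirD S b x))
            + ε⁻¹ ^ 2 • (2 * nsq S x) • a x) x := by
  have hSj := fun j => contDiff_partialD hS j
  have haj := fun j => contDiff_partialD ha j
  have hbj := fun j => contDiff_partialD hb j
  have hba : ContDiff ℝ ∞ (fun x => b x - a x) := hb.sub ha
  have hab : ContDiff ℝ ∞ (fun x => a x + b x) := ha.add hb
  have h1 : ∀ j, ContDiff ℝ ∞ (fun x => partialD j S x • (b x - a x)) :=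
    fun j => (hSj j).smul hba
  have h2 : ∀ j, ContDiff ℝ ∞ (fun x => partialD j S x • (a x + b x)) :=
    fun j => (hSj j).smul hab
  have h1' : ∀ j, ContDiff ℝ ∞ (fun x => ε⁻¹ • partialD j S x • (b x - a x)) :=
    fun j => contDiff_const.smul (h1 j)
  have h2' : ∀ j, ContDiff ℝ ∞ (fun x => ε⁻¹ • partialD j S x • (a x + b x)) :=
    fun j => contDiff_const.smul (h2 j)
  have e1 : ∀ j, partialD j (lay S ε a b)
      = lay S ε (fun x => partialD j a x + ε⁻¹ • partialD j S x • (b x - a x))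
          (fun x => partialD j b x - ε⁻¹ • partialD j S x • (a x + b x)) :=
    fun j => funext fun x => partialD_lay hS ha hb j x
  simp only [lap, e1]
  have e2 : ∀ j, partialD j (lay S ε (fun x => partialD j a x + ε⁻¹ • partialD j S x • (b x - a x))
          (fun x => partialD j b x - ε⁻¹ • partialD j S x • (a x + b x))) x
      = lay S ε
        (fun x => partialD j (partialD j a) x + ε⁻¹ • (partialD j (partialD j S) x • (b x - a x)
            + (2 : ℝ) • (partialD j S x • partialD j b x - partialD j S x • partialD j a x))
            - ε⁻¹ ^ 2 • (2 * partialD j S x ^ 2) • b x)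
        (fun x => partialD j (partialD j b) x - ε⁻¹ • (partialD j (partialD j S) x • (a x + b x)
            + (2 : ℝ) • (partialD j S x • partialD j a x + partialD j S x • partialD j b x))
            + ε⁻¹ ^ 2 • (2 * partialD j S x ^ 2) • a x) x := by
    intro j
    rw [partialD_lay hS ((haj j).add (h1' j)) ((hbj j).sub (h2' j))]
    simp only [lay]
    rw [partialD_add (haj j) (h1' j), partialD_sub (hbj j) (h2' j),
      partialD_const_smul _ (h1 j), partialD_const_smul _ (h2 j),
      partialD_smul (hSj j) hba, partialD_smul (hSj j) hab, partialD_sub hb ha,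
      partialD_add ha hb]
    congr 2 <;> module
  simp only [e2, Fin.sum_univ_three, lay, nsq, dirD]
  module

/-- Leibniz rule for `wfld`. When both amplitudes are equal, the cosine part has no term of order
`ε⁻¹`; this is the case used for the layers. -/
theorem wfld_lay {a b : E3 → E3} (hS : ContDiff ℝ ∞ S) (ha : ContDiff ℝ ∞ a)
    (hb : ContDiff ℝ ∞ b) (x : E3) :
    wfld (lay S ε a b) x
      = lay S ε (fun x => wfld a x + ε⁻¹ • wsym (grd S x) (b x - a x))
          (fun x => wfld b x - ε⁻¹ • wsym (grd S x) (a x + b x)) x := by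
  ext i
  simp only [wfld, wsym, divg, partialD_lay hS ha hb, Fin.sum_univ_three, grd_apply, lay]
  simp
  split_ifs <;> ring

/-- The left-hand side `∂_t u - εβ Δu + ε⁻¹ e_z ∧ u` of the Stokes-Coriolis system. -/
def res (β ε : ℝ) (u : ℝ → E3 → E3) (t : ℝ) (x : E3) : E3 :=
  deriv (fun s => u s x) t - (ε * β) • lap (u t) x + ε⁻¹ • ezL (u t x)

theorem res_add {β : ℝ} {u v : ℝ → E3 → E3} {t : ℝ} (hu : ContDiff ℝ ∞ (u t))
    (hv : ContDiff ℝ ∞ (v t)) {x : E3} (hu' : DifferentiableAt ℝ (fun s => u s x) t)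
    (hv' : DifferentiableAt ℝ (fun s => v s x) t) :
    res β ε (fun t x => u t x + v t x) t x = res β ε u t x + res β ε v t x := by
  simp only [res]
  rw [deriv_fun_add hu' hv', lap_add hu hv, map_add]
  module

theorem res_const_smul {β : ℝ} (c : ℝ) {u : ℝ → E3 → E3} {t : ℝ} (hu : ContDiff ℝ ∞ (u t))
    {x : E3} : res β ε (fun t x => c • u t x) t x = c • res β ε u t x := by
  simp only [res]
  rw [deriv_fun_const_smul_field, lap_const_smul _ hu, map_smul]
  module

/-- A factor `s` costs half of the exponential decay. Applied to `s = S / ε`, it turns a coefficient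
which vanishes on `S = 0` into a gain of `ε`. -/
theorem mul_exp_neg_le {s : ℝ} : s * Real.exp (-s) ≤ 2 * Real.exp (-(s / 2)) := by
  have h1 : s / 2 ≤ Real.exp (s / 2) := by linarith [Real.add_one_le_exp (s / 2)]
  have h2 : Real.exp (s / 2) * Real.exp (-s) = Real.exp (-(s / 2)) := by
    rw [← Real.exp_add]; congr 1; ring
  nlinarith [Real.exp_pos (-s)]

variable {Λ : E3 → ℝ} {K : Set E2}

theorem deriv_lay {a b : ℝ → E3 → V} (hΛ : ContDiff ℝ ∞ Λ) (ha : Dec Λ K a) (hb : Dec Λ K b)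
    (t : ℝ) (x : E3) :
    deriv (fun s => lay S ε (a s) (b s) x) t
      = lay S ε (fun x => deriv (fun s => a s x) t) (fun x => deriv (fun s => b s x) t) x := by
  have h1 := (ha.differentiableAt_time hΛ t x).hasDerivAt.const_smul (kc (ε⁻¹ * S x))
  have h2 := (hb.differentiableAt_time hΛ t x).hasDerivAt.const_smul (ks (ε⁻¹ * S x))
  exact (h1.add h2).deriv

/-- The residual of a layer, sorted by powers of `ε`. -/
theorem exists_res_lay {β : ℝ} {a b : ℝ → E3 → E3} (hS : ContDiff ℝ ∞ S) (hΛ : ContDiff ℝ ∞ Λ)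
    (hK : IsClosed K) (ha : Dec Λ K a) (hb : Dec Λ K b) :
    ∃ A1 A2 B1 B2 : ℝ → E3 → E3, Dec Λ K A1 ∧ Dec Λ K A2 ∧ Dec Λ K B1 ∧ Dec Λ K B2 ∧
      ∀ ε : ℝ, ε ≠ 0 → ∀ t x, res β ε (fun t => lay S ε (a t) (b t)) t x
        = lay S ε
            (fun x => A1 t x - ε • A2 t x
              + ε⁻¹ • ((2 * β * nsq S x) • b t x + ezL (a t x)))
            (fun x => B1 t x - ε • B2 t x
              + ε⁻¹ • (-((2 * β * nsq S x) • a t x) + ezL (b t x))) x := by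
  have hd : ∀ {g : ℝ → E3 → E3}, Dec Λ K g → Dec Λ K fun t x => dirD S (g t) x := fun hg =>
    Dec.sum _ fun j _ => (hg.partialD hΛ hK j).smul (contDiff_partialD hS j)
  refine ⟨fun t x => deriv (fun s => a s x) t
      - β • (lap S x • (b t x - a t x) + (2 : ℝ) • (dirD S (b t) x - dirD S (a t) x)),
    fun t x => β • lap (a t) x,
    fun t x => deriv (fun s => b s x) t
      + β • (lap S x • (a t x + b t x) + (2 : ℝ) • (dirD S (a t) x + dirD S (b t) x)),
    fun t x => β • lap (b t) x, ?_, (ha.lap hΛ hK).const_smul β, ?_, (hb.lap hΛ hK).const_smul β, ?_⟩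
  · exact (ha.time hΛ).sub ((((hb.sub ha).smul (contDiff_lap hS)).add
      (((hd hb).sub (hd ha)).const_smul 2)).const_smul β)
  · exact (hb.time hΛ).add ((((ha.add hb).smul (contDiff_lap hS)).add
      (((hd ha).add (hd hb)).const_smul 2)).const_smul β)
  · intro ε hε t x
    simp only [res]
    rw [deriv_lay hΛ ha hb, lap_lay hS (ha.smooth hΛ t) (hb.smooth hΛ t), lay_clm]
    simp only [lay]
    generalize kc (ε⁻¹ * S x) = p
    generalize ks (ε⁻¹ * S x) = q
    match_scalars <;> field_simp <;> ring

theorem Dec.ezL {a : ℝ → E3 → E3} (ha : Dec Λ K a) : Dec Λ K fun t x => ezL (a t x) := ha.clm _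

theorem Dec.grd {q : ℝ → E3 → ℝ} (hΛ : ContDiff ℝ ∞ Λ) (hK : IsClosed K) (hq : Dec Λ K q) :
    Dec Λ K fun t x => grd (q t) x := by
  have : ∀ t x, Ekman.grd (q t) x = ∑ j : Fin 3, Ekman.partialD j (q t) x • bas j := by
    intro t x
    ext i
    fin_cases i <;> simp [Fin.sum_univ_three]
  simp only [this]
  exact Dec.sum _ fun j _ => (hq.partialD hΛ hK j).smul_vec contDiff_const

/-- The combination `(ks - kc) / 2` is a primitive of `kc`, so the singular part `ε⁻¹ q ∇S` of the
pressure gradient enters the cosine amplitude only. -/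
theorem grd_lay {q : E3 → ℝ} (hS : ContDiff ℝ ∞ S) (hq : ContDiff ℝ ∞ q) (x : E3) :
    grd (lay S ε (fun x => -(1 / 2 : ℝ) • q x) (fun x => (1 / 2 : ℝ) • q x)) x
      = lay S ε (fun x => -(1 / 2 : ℝ) • grd q x + ε⁻¹ • q x • grd S x)
          (fun x => (1 / 2 : ℝ) • grd q x) x := by
  ext j
  have h : ∀ c : ℝ, ContDiff ℝ ∞ fun x => c • q x := fun c => hq.const_smul c
  rw [grd_apply, partialD_lay hS (h _) (h _)]
  simp only [lay, partialD_const_smul _ hq]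
  simp
  ring

/-- A layer with coefficients in `Dec` multiplied by `ε` has a residual of size `exp (-S / ε)`. -/
theorem Dec.res_lay_bound {β c : ℝ} {a b : ℝ → E3 → E3} (hS : ContDiff ℝ ∞ S)
    (hΛ : ContDiff ℝ ∞ Λ) (hK : IsClosed K) (hc : 0 < c) {D : Set E3} (hD : IsCompact D)
    (hΛc : ∀ x ∈ D, 2 * c ≤ Λ x) (hSD : ∀ x ∈ D, 0 ≤ S x) (ha : Dec Λ K a) (hb : Dec Λ K b) :
    ∃ C, 0 ≤ C ∧ ∀ ε, 0 < ε → ε ≤ 1 → ∀ t, 0 ≤ t → ∀ x ∈ D,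
      ‖ε • res β ε (fun t => lay S ε (a t) (b t)) t x‖
        ≤ C * Real.exp (-c * t) * Real.exp (-(ε⁻¹ * S x / 2)) := by
  obtain ⟨A1, A2, B1, B2, hA1, hA2, hB1, hB2, h⟩ := exists_res_lay (β := β) hS hΛ hK ha hb
  have hn : ContDiff ℝ ∞ fun x => 2 * β * nsq S x := contDiff_const.mul (contDiff_nsq hS)
  obtain ⟨C1, h1, hC1⟩ := hA1.bound hc hD hΛc
  obtain ⟨C2, h2, hC2⟩ := hA2.bound hc hD hΛc
  obtain ⟨C3, h3, hC3⟩ := ((hb.smul hn).add ha.ezL).bound hc hD hΛc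
  obtain ⟨C4, h4, hC4⟩ := hB1.bound hc hD hΛc
  obtain ⟨C5, h5, hC5⟩ := hB2.bound hc hD hΛc
  obtain ⟨C6, h6, hC6⟩ := ((ha.smul hn).neg.add hb.ezL).bound hc hD hΛc
  refine ⟨C1 + C2 + C3 + (C4 + C5 + C6), by positivity, fun ε hε hε1 t ht x hx => ?_⟩
  rw [h ε hε.ne', norm_smul, Real.norm_of_nonneg hε.le]
  have key : ∀ (u v w : E3) (c1 c2 c3 e : ℝ), 0 ≤ e → ‖u‖ ≤ c1 * e → ‖v‖ ≤ c2 * e → ‖w‖ ≤ c3 * e →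
      0 ≤ c1 → 0 ≤ c2 → ε * ‖u - ε • v + ε⁻¹ • w‖ ≤ (c1 + c2 + c3) * e := by
    intro u v w c1 c2 c3 e he hu hv hw h1 h2
    have : ‖u - ε • v + ε⁻¹ • w‖ ≤ ‖u‖ + ε * ‖v‖ + ε⁻¹ * ‖w‖ := by
      refine (norm_add_le _ _).trans (add_le_add ((norm_sub_le _ _).trans ?_) ?_)
      · rw [norm_smul, Real.norm_of_nonneg hε.le]
      · rw [norm_smul, Real.norm_of_nonneg (by positivity)]
    calc ε * ‖u - ε • v + ε⁻¹ • w‖ ≤ ε * (‖u‖ + ε * ‖v‖ + ε⁻¹ * ‖w‖) := by gcongr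
      _ = ε * ‖u‖ + ε * ε * ‖v‖ + ‖w‖ := by field_simp
      _ ≤ 1 * ‖u‖ + 1 * 1 * ‖v‖ + ‖w‖ := by gcongr
      _ ≤ _ := by linarith
  have hl := norm_lay_le (S := S) (ε := ε) (fun x => A1 t x - ε • A2 t x
              + ε⁻¹ • ((2 * β * nsq S x) • b t x + Ekman.ezL (a t x)))
            (fun x => B1 t x - ε • B2 t x
              + ε⁻¹ • (-((2 * β * nsq S x) • a t x) + Ekman.ezL (b t x))) x
  have k1 := key _ _ _ _ _ _ _ (Real.exp_nonneg _) (hC1 t ht x hx) (hC2 t ht x hx)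
    (hC3 t ht x hx) h1 h2
  have k2 := key _ _ _ _ _ _ _ (Real.exp_nonneg _) (hC4 t ht x hx) (hC5 t ht x hx)
    (hC6 t ht x hx) h4 h5
  have he : Real.exp (-(ε⁻¹ * S x)) ≤ Real.exp (-(ε⁻¹ * S x / 2)) := by
    apply Real.exp_le_exp.2
    have : 0 ≤ ε⁻¹ * S x := mul_nonneg (by positivity) (hSD x hx)
    linarith
  refine (mul_le_mul_of_nonneg_left hl hε.le).trans ?_
  rw [mul_left_comm, mul_add, mul_comm _ (Real.exp (-(ε⁻¹ * S x / 2)))]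
  refine mul_le_mul he ?_ (by positivity) (Real.exp_nonneg _)
  rw [add_mul]
  exact add_le_add k1 k2

/-- The residual of a layer which satisfies the Ekman equations on the surface `S = 0`. -/
theorem Dec.ekman_bound {β c σ : ℝ} {a b : ℝ → E3 → E3} {q : ℝ → E3 → ℝ} (hS : ContDiff ℝ ∞ S)
    (hΛ : ContDiff ℝ ∞ Λ) (hK : IsClosed K) (hc : 0 < c) {D : Set E3} (hD : IsCompact D)
    (hΛc : ∀ x ∈ D, 2 * c ≤ Λ x) (hSD : ∀ x ∈ D, 0 ≤ S x) (ha : Dec Λ K a) (hb : Dec Λ K b)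
    (hq : Dec Λ K q) (hσ : 0 ≤ σ)
    (hsurf : ∀ x ∈ D, ∃ z, (∀ s ∈ uIcc z (x 2), pt (hor x) s ∈ D) ∧ |x 2 - z| ≤ σ * S x ∧
      ∀ t, ((2 * β * nsq S (pt (hor x) z)) • b t (pt (hor x) z) + Ekman.ezL (a t (pt (hor x) z))
          + q t (pt (hor x) z) • Ekman.grd S (pt (hor x) z) = 0) ∧
        -((2 * β * nsq S (pt (hor x) z)) • a t (pt (hor x) z))
          + Ekman.ezL (b t (pt (hor x) z)) = 0) :
    ∃ C, 0 ≤ C ∧ ∀ ε, 0 < ε → ε ≤ 1 → ∀ t, 0 ≤ t → ∀ x ∈ D,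
      ‖res β ε (fun t => lay S ε (a t) (b t)) t x
        + Ekman.grd (lay S ε (fun x => -(1 / 2 : ℝ) • q t x) (fun x => (1 / 2 : ℝ) • q t x)) x‖
        ≤ C * Real.exp (-c * t) * Real.exp (-(ε⁻¹ * S x / 2)) := by
  obtain ⟨A1, A2, B1, B2, hA1, hA2, hB1, hB2, h⟩ := exists_res_lay (β := β) hS hΛ hK ha hb
  have hn : ContDiff ℝ ∞ fun x => 2 * β * nsq S x := contDiff_const.mul (contDiff_nsq hS)
  obtain ⟨C1, h1, hC1⟩ := (hA1.add ((hq.grd hΛ hK).const_smul (-(1 / 2)))).bound hc hD hΛc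
  obtain ⟨C2, h2, hC2⟩ := hA2.bound hc hD hΛc
  obtain ⟨C3, h3, hC3⟩ := (((hb.smul hn).add ha.ezL).add (hq.smul_vec (contDiff_grd hS))).vertical_bound
    hΛ hK hc hD hΛc
  obtain ⟨C4, h4, hC4⟩ := (hB1.add ((hq.grd hΛ hK).const_smul (1 / 2))).bound hc hD hΛc
  obtain ⟨C5, h5, hC5⟩ := hB2.bound hc hD hΛc
  obtain ⟨C6, h6, hC6⟩ := ((ha.smul hn).neg.add hb.ezL).vertical_bound hΛ hK hc hD hΛc
  refine ⟨C1 + C2 + 2 * σ * C3 + (C4 + C5 + 2 * σ * C6), by positivity,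
    fun ε hε hε1 t ht x hx => ?_⟩
  have hs : 0 ≤ ε⁻¹ * S x := mul_nonneg (by positivity) (hSD x hx)
  obtain ⟨z, hz, hzσ, hzt⟩ := hsurf x hx
  -- The amplitudes of order `ε⁻¹` vanish at the boundary point on the vertical of `x`, so at `x`
  -- they are bounded by a multiple of `|x 2 - z| ≤ σ S x`. The product `ε⁻¹ S exp (-S/ε)` is then
  -- bounded by `hE2`.
  have b3 := hC3 t ht x z hz
  have b6 := hC6 t ht x z hz
  rw [(hzt t).1, sub_zero] at b3
  rw [(hzt t).2, sub_zero] at b6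
  rw [h ε hε.ne', grd_lay hS (hq.smooth hΛ t), ← lay_add]
  set e := Real.exp (-c * t) with he
  have he0 : 0 ≤ e := Real.exp_nonneg _
  set E := Real.exp (-(ε⁻¹ * S x / 2)) with hE
  have hE1 : Real.exp (-(ε⁻¹ * S x)) ≤ E := by
    apply Real.exp_le_exp.2
    linarith
  have hE2 : Real.exp (-(ε⁻¹ * S x)) * (ε⁻¹ * S x) ≤ 2 * E := by
    rw [mul_comm]; exact mul_exp_neg_le
  have key : ∀ (u v w : E3) (c1 c2 c3 : ℝ), ‖u‖ ≤ c1 * e → ‖v‖ ≤ c2 * e →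
      ‖w‖ ≤ c3 * e * |x 2 - z| → 0 ≤ c1 → 0 ≤ c2 → 0 ≤ c3 →
      Real.exp (-(ε⁻¹ * S x)) * ‖u - ε • v + ε⁻¹ • w‖ ≤ (c1 + c2 + 2 * σ * c3) * e * E := by
    intro u v w c1 c2 c3 hu hv hw h1 h2 h3
    have : ‖u - ε • v + ε⁻¹ • w‖ ≤ ‖u‖ + ε * ‖v‖ + ε⁻¹ * ‖w‖ := by
      refine (norm_add_le _ _).trans (add_le_add ((norm_sub_le _ _).trans ?_) ?_)
      · rw [norm_smul, Real.norm_of_nonneg hε.le]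
      · rw [norm_smul, Real.norm_of_nonneg (by positivity)]
    calc Real.exp (-(ε⁻¹ * S x)) * ‖u - ε • v + ε⁻¹ • w‖
        ≤ Real.exp (-(ε⁻¹ * S x)) * (c1 * e + 1 * (c2 * e) + ε⁻¹ * (c3 * e * (σ * S x))) := by
          refine mul_le_mul_of_nonneg_left (this.trans ?_) (Real.exp_nonneg _)
          gcongr
          exact hw.trans (by gcongr)
      _ = Real.exp (-(ε⁻¹ * S x)) * ((c1 + c2) * e)
          + (Real.exp (-(ε⁻¹ * S x)) * (ε⁻¹ * S x)) * (σ * c3 * e) := by ring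
      _ ≤ E * ((c1 + c2) * e) + (2 * E) * (σ * c3 * e) := by gcongr
      _ = _ := by ring
  have k1 := key _ _ _ _ _ _ (hC1 t ht x hx) (hC2 t ht x hx) b3 h1 h2 h3
  have k2 := key _ _ _ _ _ _ (hC4 t ht x hx) (hC5 t ht x hx) b6 h4 h5 h6
  refine (norm_lay_le _ _ _).trans ?_
  rw [mul_add, add_mul, add_mul]
  refine add_le_add (le_of_eq_of_le ?_ k1) (le_of_eq_of_le ?_ k2)
  · congr 2
    module
  · congr 2
    module

end Layers

/-! ### The approximate solution -/

/-- The data from which the approximate solution is built: a smooth extension `φ` of the depth,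
`μ = (1 + φ'²)^{1/4}`, an amplitude `f`, a smooth function `R` which agrees with the distance to
the island near the compact set `K` outside of which `f ∘ R` vanishes, and bounds. -/
structure Basin where
  (β c sM N : ℝ)
  (φ μ f : ℝ → ℝ)
  (R : E2 → ℝ)
  (K : Set E2)
  β_pos : 0 < β
  c_pos : 0 < c
  smooth_φ : ContDiff ℝ ∞ φ
  smooth_μ : ContDiff ℝ ∞ μ
  smooth_f : ContDiff ℝ ∞ f
  smooth_R : ContDiff ℝ ∞ R
  φ_pos : ∀ s, 0 < φ s
  μ_pos : ∀ s, 0 < μ s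
  compact_K : IsCompact K
  supp : ∀ y, y ∉ K → f (R y) = 0
  unit : ∀ x, hor x ∈ K → partialD 0 (R ∘ hor) x ^ 2 + partialD 1 (R ∘ hor) x ^ 2 = 1
  slope : ∀ y ∈ K, μ (R y) ^ 4 = 1 + deriv φ (R y) ^ 2
  rate : ∀ y ∈ K, 2 * c ≤ √(2 * β) / φ (R y) * ((1 + μ (R y)) / 2)
  width : ∀ y ∈ K, √(2 * β) * μ (R y) ^ 3 ≤ sM
  width' : √(2 * β) ≤ sM
  amp : ∀ s, |f s| ≤ N

namespace Basin

variable (B : Basin)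

/-- The distance to the island as a function on `E3`. -/
def r (x : E3) : ℝ := B.R (hor x)

/-- The scale `√(2β)`. -/
def sq : ℝ := √(2 * B.β)

/-- The pumping coefficient. -/
def lam (s : ℝ) : ℝ := B.sq / B.φ s * ((1 + B.μ s) / 2)

/-- The pumping coefficient as a function on `E3`. -/
def Λ (x : E3) : ℝ := B.lam (B.r x)

/-- The unit vector `∇ρ`. -/
def nu (x : E3) : E3 := grd B.r x

/-- The unit vector `∇^⊥ρ`. -/
def tau (x : E3) : E3 := ezL (B.nu x)

/-- The closed part of the ocean over `K`. -/
def D : Set E3 := {x | hor x ∈ B.K ∧ -B.φ (B.r x) ≤ x 2 ∧ x 2 ≤ 0}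

/-- The interior velocity at leading order. -/
def V0 (t : ℝ) (x : E3) : E3 := Real.exp (-t * B.Λ x) • B.f (B.r x) • B.tau x

/-- The potential of the interior velocity at order `ε`. -/
def X (t : ℝ) (x : E3) : E3 :=
  Real.exp (-t * B.Λ x) • (B.f (B.r x) * (B.sq / 2 + B.Λ x * x 2)) • B.nu x

/-- The interior velocity at order `ε`. -/
def V1 (t : ℝ) (x : E3) : E3 := wfld (B.X t) x

/-- The layer variable at the surface. -/
def ST (x : E3) : ℝ := -x 2 / B.sq

/-- The layer variable at the bottom. -/
def SB (x : E3) : ℝ := (x 2 + B.φ (B.r x)) * (B.sq * B.μ (B.r x) ^ 3)⁻¹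

/-- A cutoff which is `1` near the surface and `0` near the bottom. -/
def thT (x : E3) : ℝ := Real.smoothTransition (2 + 3 * (x 2 * (B.φ (B.r x))⁻¹))

/-- A cutoff which is `1` near the bottom and `0` near the surface. -/
def thB (x : E3) : ℝ := 1 - B.thT x

/-- The pressure of the bottom layer. -/
def qB (t : ℝ) (x : E3) : ℝ :=
  Real.exp (-t * B.Λ x) • (-(B.f (B.r x) * deriv B.φ (B.r x) * B.sq * (B.μ (B.r x))⁻¹))

section Amplitudes

variable (S th : E3 → ℝ)

/-- The potential of a layer. -/
def Y (t : ℝ) (x : E3) : E3 := -(th x • B.X t x)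

/-- Amplitude of the cosine profile in a layer. -/
def Gc (t : ℝ) (x : E3) : E3 := -(th x • B.V0 t x)

/-- Amplitude of the sine profile in a layer. -/
def Gs (t : ℝ) (x : E3) : E3 := wsym (grd S x) ((2 * th x) • B.X t x)

/-- Amplitude of the correction of order `ε` in a layer. -/
def G1 (t : ℝ) (x : E3) : E3 := wfld (B.Y th t) x

/-- The velocity in a layer. -/
def LF (ε t : ℝ) (x : E3) : E3 :=
  lay S ε (B.Gc th t) (B.Gs S th t) x + ε • lay S ε (B.G1 th t) (B.G1 th t) x

end Amplitudes

/-- The boundary layers. -/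
def UBL (ε t : ℝ) (x : E3) : E3 := B.LF B.ST B.thT ε t x + B.LF B.SB B.thB ε t x

/-- The interior part of the approximate solution. -/
def Vint (ε t : ℝ) (x : E3) : E3 := B.V0 t x + ε • B.V1 t x

/-- The approximate solution. -/
def F (ε t : ℝ) (x : E3) : E3 := B.Vint ε t x + B.UBL ε t x

/-! #### Regularity -/

theorem sq_pos : 0 < B.sq := Real.sqrt_pos.2 (mul_pos two_pos B.β_pos)

theorem sq_sq : B.sq ^ 2 = 2 * B.β := Real.sq_sqrt (mul_pos two_pos B.β_pos).le

theorem smooth_r : ContDiff ℝ ∞ B.r := B.smooth_R.comp contDiff_hor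

theorem r_pt (y : E2) (z : ℝ) : B.r (pt y z) = B.R y := by simp [r]

theorem partialD_two_r (x : E3) : partialD 2 B.r x = 0 := by
  have h := hasDerivAt_vertical B.smooth_r (hor x) (x 2)
  simp only [r_pt, pt_hor] at h
  exact h.unique (hasDerivAt_const _ _)

theorem smooth_sig_inv : ContDiff ℝ ∞ fun s => (B.sq * B.μ s ^ 3)⁻¹ :=
  (contDiff_const.mul (B.smooth_μ.pow 3)).inv fun s =>
    (mul_pos B.sq_pos (pow_pos (B.μ_pos s) 3)).ne'

theorem smooth_φ_inv : ContDiff ℝ ∞ fun s => (B.φ s)⁻¹ :=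
  B.smooth_φ.inv fun s => (B.φ_pos s).ne'

theorem smooth_lam : ContDiff ℝ ∞ B.lam :=
  (contDiff_const.div B.smooth_φ fun s => (B.φ_pos s).ne').mul
    ((contDiff_const.add B.smooth_μ).div_const 2)

theorem smooth_Λ : ContDiff ℝ ∞ B.Λ := B.smooth_lam.comp B.smooth_r

theorem smooth_nu : ContDiff ℝ ∞ B.nu := contDiff_grd B.smooth_r

theorem smooth_tau : ContDiff ℝ ∞ B.tau := ezL.contDiff.comp B.smooth_nu

theorem smooth_ST : ContDiff ℝ ∞ B.ST := (contDiff_crd 2).neg.div_const _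

theorem smooth_SB : ContDiff ℝ ∞ B.SB :=
  ((contDiff_crd 2).add (B.smooth_φ.comp B.smooth_r)).mul (B.smooth_sig_inv.comp B.smooth_r)

theorem smooth_thT : ContDiff ℝ ∞ B.thT :=
  Real.smoothTransition.contDiff.comp
    (contDiff_const.add (contDiff_const.mul
      ((contDiff_crd 2).mul (B.smooth_φ_inv.comp B.smooth_r))))

theorem smooth_thB : ContDiff ℝ ∞ B.thB := contDiff_const.sub B.smooth_thT

theorem closed_K : IsClosed B.K := B.compact_K.isClosed

theorem exp_smul_dec {V : Type*} [NormedAddCommGroup V] [NormedSpace ℝ V] {G : E3 → V}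
    (hG : ContDiff ℝ ∞ G) (hK : ∀ x, hor x ∉ B.K → G x = 0) :
    Dec B.Λ B.K fun t x => Real.exp (-t * B.Λ x) • G x := by
  simpa using Dec.mono (Λ := B.Λ) 0 G hG hK

theorem f_r_eq_zero {x : E3} (hx : hor x ∉ B.K) : B.f (B.r x) = 0 := B.supp _ hx

theorem dec_V0 : Dec B.Λ B.K B.V0 :=
  B.exp_smul_dec ((B.smooth_f.comp B.smooth_r).smul B.smooth_tau)
    fun x hx => by simp [B.f_r_eq_zero hx]

theorem dec_X : Dec B.Λ B.K B.X := by
  have h : ContDiff ℝ ∞ fun x => B.f (B.r x) * (B.sq / 2 + B.Λ x * x 2) :=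
    (B.smooth_f.comp B.smooth_r).mul (contDiff_const.add (B.smooth_Λ.mul (contDiff_crd 2)))
  exact B.exp_smul_dec (h.smul B.smooth_nu) fun x hx => by simp [B.f_r_eq_zero hx]

theorem dec_V1 : Dec B.Λ B.K B.V1 := B.dec_X.wfld B.smooth_Λ B.closed_K

theorem dec_qB : Dec B.Λ B.K B.qB := by
  refine B.exp_smul_dec ?_ fun x hx => by simp [B.f_r_eq_zero hx]
  have h1 : ContDiff ℝ ∞ (deriv B.φ) := (contDiff_infty_iff_deriv.1 B.smooth_φ).2
  have h2 : ContDiff ℝ ∞ fun s => -(B.f s * deriv B.φ s * B.sq * (B.μ s)⁻¹) :=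
    (((B.smooth_f.mul h1).mul contDiff_const).mul
      (B.smooth_μ.inv fun s => (B.μ_pos s).ne')).neg
  exact h2.comp B.smooth_r

section Amplitudes

variable {S th : E3 → ℝ}

theorem dec_Y (hth : ContDiff ℝ ∞ th) : Dec B.Λ B.K (B.Y th) := (B.dec_X.smul hth).neg

theorem dec_Gc (hth : ContDiff ℝ ∞ th) : Dec B.Λ B.K (B.Gc th) := (B.dec_V0.smul hth).neg

theorem dec_Gs (hS : ContDiff ℝ ∞ S) (hth : ContDiff ℝ ∞ th) : Dec B.Λ B.K (B.Gs S th) :=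
  (B.dec_X.smul (contDiff_const.mul hth)).wsym (contDiff_grd hS)

theorem dec_G1 (hth : ContDiff ℝ ∞ th) : Dec B.Λ B.K (B.G1 th) :=
  (B.dec_Y hth).wfld B.smooth_Λ B.closed_K

theorem contDiff_lay_uncurry {V : Type*} [NormedAddCommGroup V] [NormedSpace ℝ V]
    {a b : ℝ → E3 → V} (ε : ℝ) (hS : ContDiff ℝ ∞ S)
    (ha : Dec B.Λ B.K a) (hb : Dec B.Λ B.K b) :
    ContDiff ℝ ∞ fun q : ℝ × E3 => lay S ε (a q.1) (b q.1) q.2 := by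
  have h : ContDiff ℝ ∞ fun q : ℝ × E3 => ε⁻¹ * S q.2 := contDiff_const.mul (hS.comp contDiff_snd)
  exact ((contDiff_kc.comp h).smul (ha.contDiff B.smooth_Λ)).add
    ((contDiff_ks.comp h).smul (hb.contDiff B.smooth_Λ))

theorem smooth_LF (hS : ContDiff ℝ ∞ S) (hth : ContDiff ℝ ∞ th) (ε : ℝ) :
    ContDiff ℝ ∞ fun q : ℝ × E3 => B.LF S th ε q.1 q.2 :=
  (B.contDiff_lay_uncurry ε hS (B.dec_Gc hth) (B.dec_Gs hS hth)).add
    ((B.contDiff_lay_uncurry ε hS (B.dec_G1 hth) (B.dec_G1 hth)).const_smul ε)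

theorem LF_eq_zero_off (hS : ContDiff ℝ ∞ S) (hth : ContDiff ℝ ∞ th) (ε t : ℝ) {x : E3}
    (hx : hor x ∉ B.K) : B.LF S th ε t x = 0 := by
  simp [LF, lay, (B.dec_Gc hth).eq_zero t hx, (B.dec_Gs hS hth).eq_zero t hx,
    (B.dec_G1 hth).eq_zero t hx]

/-- A layer is the sum of an azimuthal field and of a field which derives from a potential. -/
theorem LF_eq (hS : ContDiff ℝ ∞ S) (hth : ContDiff ℝ ∞ th) {ε : ℝ} (hε : ε ≠ 0) (t : ℝ)
    (x : E3) :
    B.LF S th ε t x = kc (ε⁻¹ * S x) • B.Gc th t x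
      + ε • wfld (lay S ε (B.Y th t) (B.Y th t)) x := by
  have hY := (B.dec_Y hth).smooth B.smooth_Λ t
  rw [wfld_lay hS hY hY]
  have h1 : B.Y th t x - B.Y th t x = 0 := sub_self _
  have h2 : wsym (grd S x) (B.Y th t x + B.Y th t x) = - B.Gs S th t x := by
    simp only [Gs, Y, ← wsymL_apply, ← map_neg]
    congr 1
    module
  simp only [LF, lay, h1, h2, G1]
  simp only [← wsymL_apply, map_zero]
  have h3 : ε * ε⁻¹ = 1 := mul_inv_cancel₀ hε
  generalize kc (ε⁻¹ * S x) = p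
  generalize ks (ε⁻¹ * S x) = q
  match_scalars <;> field_simp

end Amplitudes

theorem smooth_Vint (ε : ℝ) : ContDiff ℝ ∞ fun q : ℝ × E3 => B.Vint ε q.1 q.2 :=
  (B.dec_V0.contDiff B.smooth_Λ).add ((B.dec_V1.contDiff B.smooth_Λ).const_smul ε)

theorem smooth_UBL (ε : ℝ) : ContDiff ℝ ∞ fun q : ℝ × E3 => B.UBL ε q.1 q.2 :=
  (B.smooth_LF B.smooth_ST B.smooth_thT ε).add (B.smooth_LF B.smooth_SB B.smooth_thB ε)

theorem smooth_F (ε : ℝ) : ContDiff ℝ ∞ fun q : ℝ × E3 => B.F ε q.1 q.2 :=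
  (B.smooth_Vint ε).add (B.smooth_UBL ε)

theorem Vint_eq_zero_off (ε t : ℝ) {x : E3} (hx : hor x ∉ B.K) : B.Vint ε t x = 0 := by
  simp [Vint, B.dec_V0.eq_zero t hx, B.dec_V1.eq_zero t hx]

theorem UBL_eq_zero_off (ε t : ℝ) {x : E3} (hx : hor x ∉ B.K) : B.UBL ε t x = 0 := by
  simp [UBL, B.LF_eq_zero_off B.smooth_ST B.smooth_thT ε t hx,
    B.LF_eq_zero_off B.smooth_SB B.smooth_thB ε t hx]

theorem F_eq_zero_off (ε t : ℝ) {x : E3} (hx : hor x ∉ B.K) : B.F ε t x = 0 := by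
  simp [F, B.Vint_eq_zero_off ε t hx, B.UBL_eq_zero_off ε t hx]

/-! #### Incompressibility -/

/-- Smooth functions whose horizontal gradient is parallel to that of `r`. -/
def Axi (h : E3 → ℝ) : Prop :=
  ContDiff ℝ ∞ h ∧ ∀ x, partialD 0 h x * partialD 1 B.r x = partialD 1 h x * partialD 0 B.r x

variable {B}

theorem Axi.comp {h : E3 → ℝ} (hh : B.Axi h) {k : ℝ → ℝ} (hk : ContDiff ℝ ∞ k) :
    B.Axi fun x => k (h x) := by
  refine ⟨hk.comp hh.1, fun x => ?_⟩
  have h1 := (contDiff_diff hk (h x)).hasDerivAt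
  rw [partialD_comp hh.1 0 x h1, partialD_comp hh.1 1 x h1, mul_assoc, hh.2 x, mul_assoc]

theorem Axi.mul {h g : E3 → ℝ} (hh : B.Axi h) (hg : B.Axi g) : B.Axi fun x => h x * g x := by
  refine ⟨hh.1.mul hg.1, fun x => ?_⟩
  rw [partialD_mul hh.1 hg.1, partialD_mul hh.1 hg.1]
  linear_combination g x * hh.2 x + h x * hg.2 x

theorem Axi.add {h g : E3 → ℝ} (hh : B.Axi h) (hg : B.Axi g) : B.Axi fun x => h x + g x := by
  refine ⟨hh.1.add hg.1, fun x => ?_⟩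
  rw [partialD_add hh.1 hg.1, partialD_add hh.1 hg.1]
  linear_combination hh.2 x + hg.2 x

variable (B)

theorem axi_const (c : ℝ) : B.Axi fun _ => c :=
  ⟨contDiff_const, fun x => by simp [partialD_const]⟩

theorem axi_r : B.Axi B.r := ⟨B.smooth_r, fun _ => mul_comm _ _⟩

theorem axi_z : B.Axi fun x => x 2 := ⟨contDiff_crd 2, fun x => by simp [partialD_crd]⟩

theorem axi_Λ : B.Axi B.Λ := B.axi_r.comp B.smooth_lam

theorem axi_ST : B.Axi B.ST := B.axi_z.comp (k := fun z => -z / B.sq) (by fun_prop)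

theorem axi_SB : B.Axi B.SB :=
  (B.axi_z.add (B.axi_r.comp B.smooth_φ)).mul (B.axi_r.comp B.smooth_sig_inv)

theorem axi_thT : B.Axi B.thT :=
  (((B.axi_const 2).add ((B.axi_const 3).mul (B.axi_z.mul (B.axi_r.comp B.smooth_φ_inv))))).comp
    Real.smoothTransition.contDiff

theorem axi_thB : B.Axi B.thB :=
  B.axi_thT.comp (k := fun s => 1 - s) (by fun_prop)

theorem axi_exp (t : ℝ) : B.Axi fun x => Real.exp (-t * B.Λ x) * B.f (B.r x) :=
  (B.axi_Λ.comp (k := fun s => Real.exp (-t * s)) (by fun_prop)).mul (B.axi_r.comp B.smooth_f)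

/-- In `div (h τ) = ∇h · τ + h div τ` the first term vanishes because the horizontal gradient of `h`
is parallel to that of `r`, the second because the mixed derivatives of `r` agree. -/
theorem divg_smul_tau {h : E3 → ℝ} (hh : B.Axi h) (x : E3) :
    divg (fun x => h x • B.tau x) x = 0 := by
  have h1 : ∀ j, partialD j (fun x => h x • B.tau x) x
      = partialD j h x • B.tau x + h x • ezL (partialD j B.nu x) := by
    intro j
    rw [partialD_smul hh.1 B.smooth_tau]
    congr 2
    exact partialD_clm ezL B.smooth_nu j x
  have h2 : ∀ i j, partialD i B.nu x j = partialD i (partialD j B.r) x := by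
    intro i j
    rw [← partialD_apply B.smooth_nu]
    congr 1
    funext y
    simp [nu]
  simp only [divg, Fin.sum_univ_three, h1]
  simp [tau, ezL_apply, ezWedge, h2, nu]
  rw [partialD_comm B.smooth_r 0 1]
  linear_combination - hh.2 x

theorem divg_add {a b : E3 → E3} (ha : ContDiff ℝ ∞ a) (hb : ContDiff ℝ ∞ b) (x : E3) :
    divg (fun x => a x + b x) x = divg a x + divg b x := by
  simp [divg, partialD_add ha hb, Finset.sum_add_distrib]

theorem divg_const_smul (c : ℝ) {a : E3 → E3} (ha : ContDiff ℝ ∞ a) (x : E3) :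
    divg (fun x => c • a x) x = c * divg a x := by
  simp [divg, partialD_const_smul c ha, Finset.mul_sum]

/-- By `LF_eq`, a layer is an axisymmetric multiple of `tau` plus a multiple of a `wfld`. -/
theorem divg_LF {S th : E3 → ℝ} (hS : B.Axi S) (hth : B.Axi th) {ε : ℝ} (hε : ε ≠ 0) (t : ℝ)
    (x : E3) : divg (B.LF S th ε t) x = 0 := by
  have hY := (B.dec_Y hth.1).smooth B.smooth_Λ t
  have hL : ContDiff ℝ ∞ (lay S ε (B.Y th t) (B.Y th t)) := contDiff_lay hS.1 hY hY
  have hh : B.Axi fun x => kc (ε⁻¹ * S x) * (-1 * (th x * (Real.exp (-t * B.Λ x) * B.f (B.r x)))) :=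
    (hS.comp (k := fun s => kc (ε⁻¹ * s)) (contDiff_kc.comp (contDiff_const.mul contDiff_id))).mul
      ((B.axi_const _).mul (hth.mul (B.axi_exp t)))
  have : B.LF S th ε t = fun x =>
      (kc (ε⁻¹ * S x) * (-1 * (th x * (Real.exp (-t * B.Λ x) * B.f (B.r x))))) • B.tau x
      + ε • wfld (lay S ε (B.Y th t) (B.Y th t)) x := by
    funext x
    rw [B.LF_eq hS.1 hth.1 hε, Gc, V0]
    module
  have hw : ContDiff ℝ ∞ fun x => ε • wfld (lay S ε (B.Y th t) (B.Y th t)) x :=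
    (contDiff_wfld hL).const_smul ε
  have hh' : ContDiff ℝ ∞ fun x =>
      (kc (ε⁻¹ * S x) * (-1 * (th x * (Real.exp (-t * B.Λ x) * B.f (B.r x))))) • B.tau x :=
    hh.1.smul B.smooth_tau
  rw [this, divg_add hh' hw, B.divg_smul_tau hh,
    divg_const_smul _ (contDiff_wfld hL), divg_wfld hL]
  simp

theorem divg_F {ε : ℝ} (hε : ε ≠ 0) (t : ℝ) (x : E3) : divg (B.F ε t) x = 0 := by
  have h0 := B.dec_V0.smooth B.smooth_Λ t
  have h1 := B.dec_V1.smooth B.smooth_Λ t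
  have hT := contDiff_slice (B.smooth_LF B.smooth_ST B.smooth_thT ε) t
  have hB := contDiff_slice (B.smooth_LF B.smooth_SB B.smooth_thB ε) t
  have e0 : divg (B.V0 t) x = 0 := by
    have := B.divg_smul_tau (B.axi_exp t) x
    simp only [mul_smul] at this
    exact this
  have e1 : divg (B.V1 t) x = 0 := divg_wfld (B.dec_X.smooth B.smooth_Λ t) x
  have h1' : ContDiff ℝ ∞ fun x => ε • B.V1 t x := h1.const_smul ε
  have : B.F ε t = fun x => (B.V0 t x + ε • B.V1 t x)
      + (B.LF B.ST B.thT ε t x + B.LF B.SB B.thB ε t x) := rfl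
  rw [this, divg_add (h0.add h1') (hT.add hB), divg_add h0 h1', divg_add hT hB,
    divg_const_smul _ h1, e0, e1, B.divg_LF B.axi_ST B.axi_thT hε, B.divg_LF B.axi_SB B.axi_thB hε]
  simp

end Basin

namespace Basin

variable (B : Basin)

/-! #### Boundary values -/

/-- At `S = 0` the profiles are `kc = 1` and `ks = 0`, so only `Gc + ε G1` remains. The cutoff must
equal `1` on a neighbourhood, and not just at the point, because `G1` differentiates it. -/
theorem LF_eq_neg {S th : E3 → ℝ} {x : E3} (hS : S x = 0) (hth : th =ᶠ[𝓝 x] fun _ => 1)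
    (ε t : ℝ) : B.LF S th ε t x = -(B.Vint ε t x) := by
  have h1 : th x = 1 := hth.self_of_nhds
  have h2 : B.Y th t =ᶠ[𝓝 x] fun x => -(B.X t x) := by
    filter_upwards [hth] with y hy
    simp [Y, hy]
  have h3 : B.G1 th t x = -(B.V1 t x) := by
    rw [V1, ← wfld_neg]
    simp only [G1, wfld, divg, partialD_congr_of_eventuallyEq h2]
  simp [LF, lay, hS, kc, ks, Gc, h1, h3, Vint]
  abel

theorem LF_eq_zero {S th : E3 → ℝ} {x : E3} (hth : th =ᶠ[𝓝 x] fun _ => 0)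
    (ε t : ℝ) : B.LF S th ε t x = 0 := by
  have h1 : th x = 0 := hth.self_of_nhds
  have h2 : B.Y th t =ᶠ[𝓝 x] fun _ => 0 := by
    filter_upwards [hth] with y hy
    simp [Y, hy]
  have h3 : B.G1 th t x = 0 := by
    simp only [G1, wfld, divg, partialD_congr_of_eventuallyEq h2, partialD_const]
    simp
  simp [LF, lay, Gc, h1, h3, Gs, ← wsymL_apply]

theorem continuous_cut : Continuous fun x : E3 => 2 + 3 * (x 2 * (B.φ (B.r x))⁻¹) :=
  (contDiff_const.add (contDiff_const.mul
      ((contDiff_crd 2).mul (B.smooth_φ_inv.comp B.smooth_r))) : ContDiff ℝ ∞ _).continuous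

/-- The argument of the smooth transition is `2` at the surface and `-1` at the bottom. Both values
are strictly outside `[0, 1]`, so the cutoffs are locally constant there. -/
theorem thT_top {x : E3} (hx : x 2 = 0) : B.thT =ᶠ[𝓝 x] fun _ => 1 := by
  have : ∀ᶠ y in 𝓝 x, 1 < 2 + 3 * (y 2 * (B.φ (B.r y))⁻¹) :=
    B.continuous_cut.continuousAt.eventually (lt_mem_nhds (by simp [hx]))
  filter_upwards [this] with y hy
  exact Real.smoothTransition.one_of_one_le hy.le

theorem thT_bot {x : E3} (hx : x 2 = -B.φ (B.r x)) : B.thT =ᶠ[𝓝 x] fun _ => 0 := by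
  have h : x 2 * (B.φ (B.r x))⁻¹ = -1 := by
    rw [hx, neg_mul, mul_inv_cancel₀ (B.φ_pos _).ne']
  have : ∀ᶠ y in 𝓝 x, 2 + 3 * (y 2 * (B.φ (B.r y))⁻¹) < 0 :=
    B.continuous_cut.continuousAt.eventually (gt_mem_nhds (by simp only [h]; norm_num))
  filter_upwards [this] with y hy
  exact Real.smoothTransition.zero_of_nonpos hy.le

theorem thB_top {x : E3} (hx : x 2 = 0) : B.thB =ᶠ[𝓝 x] fun _ => 0 := by
  filter_upwards [B.thT_top hx] with y hy
  simp [thB, hy]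

theorem thB_bot {x : E3} (hx : x 2 = -B.φ (B.r x)) : B.thB =ᶠ[𝓝 x] fun _ => 1 := by
  filter_upwards [B.thT_bot hx] with y hy
  simp [thB, hy]

theorem F_top (ε t : ℝ) {x : E3} (hx : x 2 = 0) : B.F ε t x = 0 := by
  rw [F, UBL, B.LF_eq_zero (B.thB_top hx), B.LF_eq_neg (by simp [ST, hx]) (B.thT_top hx)]
  simp

theorem F_bot (ε t : ℝ) {x : E3} (hx : x 2 = -B.φ (B.r x)) : B.F ε t x = 0 := by
  rw [F, UBL, B.LF_eq_zero (B.thT_bot hx), B.LF_eq_neg (by simp [SB, hx]) (B.thB_bot hx)]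
  simp

/-! #### The domain -/

theorem compact_D : IsCompact B.D := by
  obtain ⟨M, hM⟩ := B.compact_K.exists_bound_of_continuousOn (f := fun y => B.φ (B.R y))
    (B.smooth_φ.comp B.smooth_R).continuous.continuousOn
  have h1 : IsCompact ((fun p : E2 × ℝ => pt p.1 p.2) '' (B.K ×ˢ Icc (-M) 0)) := by
    refine (B.compact_K.prod isCompact_Icc).image ?_
    refine (PiLp.continuous_toLp 2 _).comp (continuous_pi fun i => ?_)
    fin_cases i <;> simp <;> fun_prop
  refine h1.of_isClosed_subset ?_ ?_
  · refine (B.closed_K.preimage continuous_hor).inter (IsClosed.inter ?_ ?_)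
    · exact isClosed_le (B.smooth_φ.comp B.smooth_r).neg.continuous (contDiff_crd 2).continuous
    · exact isClosed_le (contDiff_crd 2).continuous continuous_const
  · rintro x ⟨h1, h2, h3⟩
    refine ⟨(hor x, x 2), ⟨h1, ?_, h3⟩, by simp⟩
    have := hM _ h1
    rw [Real.norm_eq_abs] at this
    have := (abs_le.1 this).2
    simp only [r] at h2
    linarith

theorem rate_D {x : E3} (hx : x ∈ B.D) : 2 * B.c ≤ B.Λ x := B.rate _ hx.1

theorem ST_nonneg {x : E3} (hx : x ∈ B.D) : 0 ≤ B.ST x :=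
  div_nonneg (by linarith [hx.2.2]) B.sq_pos.le

theorem sig_pos (s : ℝ) : 0 < B.sq * B.μ s ^ 3 := mul_pos B.sq_pos (pow_pos (B.μ_pos s) 3)

theorem SB_nonneg {x : E3} (hx : x ∈ B.D) : 0 ≤ B.SB x :=
  mul_nonneg (by linarith [hx.2.1]) (inv_nonneg.2 (B.sig_pos _).le)

theorem sM_pos : 0 < B.sM := B.sq_pos.trans_le B.width'

theorem abs_le_ST {x : E3} (hx : x ∈ B.D) : |x 2 - 0| ≤ B.sM * B.ST x := by
  rw [sub_zero, abs_of_nonpos hx.2.2, ST, mul_div_assoc', le_div_iff₀ B.sq_pos, mul_comm]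
  exact mul_le_mul_of_nonneg_right B.width' (by linarith [hx.2.2])

theorem abs_le_SB {x : E3} (hx : x ∈ B.D) : |x 2 - -B.φ (B.r x)| ≤ B.sM * B.SB x := by
  have h : 0 ≤ x 2 + B.φ (B.r x) := by linarith [hx.2.1]
  rw [sub_neg_eq_add, abs_of_nonneg h, SB, ← div_eq_mul_inv, mul_div_assoc',
    le_div_iff₀ (B.sig_pos _), mul_comm]
  exact mul_le_mul_of_nonneg_right (B.width _ hx.1) h

theorem segment_top {x : E3} (hx : x ∈ B.D) : ∀ s ∈ uIcc 0 (x 2), pt (hor x) s ∈ B.D := by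
  intro s hs
  rw [uIcc_of_ge hx.2.2] at hs
  refine ⟨by simpa using hx.1, ?_, by simpa using hs.2⟩
  have : B.r (pt (hor x) s) = B.r x := by simp [r]
  rw [this, pt_two]
  linarith [hx.2.1, hs.1]

theorem segment_bot {x : E3} (hx : x ∈ B.D) :
    ∀ s ∈ uIcc (-B.φ (B.r x)) (x 2), pt (hor x) s ∈ B.D := by
  intro s hs
  rw [uIcc_of_le hx.2.1] at hs
  have : B.r (pt (hor x) s) = B.r x := by simp [r]
  refine ⟨by simpa using hx.1, by rw [this, pt_two]; exact hs.1, ?_⟩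
  rw [pt_two]
  linarith [hx.2.2, hs.2]

/-! #### The Ekman equations on the boundary -/

theorem nu_zero (x : E3) : B.nu x 0 = partialD 0 B.r x := by simp [nu]
theorem nu_one (x : E3) : B.nu x 1 = partialD 1 B.r x := by simp [nu]
theorem nu_two (x : E3) : B.nu x 2 = 0 := by simp [nu, B.partialD_two_r]

theorem unit_r {x : E3} (hx : hor x ∈ B.K) : partialD 0 B.r x ^ 2 + partialD 1 B.r x ^ 2 = 1 :=
  B.unit x hx

theorem ezL_tau (x : E3) : ezL (B.tau x) = -B.nu x := by
  ext j
  fin_cases j <;> simp [tau, ezL_apply, ezWedge, nu_two]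

theorem partialD_ST (j : Fin 3) (x : E3) :
    partialD j B.ST x = if j = 2 then -B.sq⁻¹ else 0 := by
  have : B.ST = fun x => (-B.sq⁻¹) • x 2 := by
    funext x; simp [ST]; ring
  rw [this, partialD_const_smul _ (contDiff_crd 2), partialD_crd]
  simp

theorem grd_ST (x : E3) : grd B.ST x = (-B.sq⁻¹) • bas 2 := by
  ext j; fin_cases j <;> simp [partialD_ST]

theorem nsq_ST (x : E3) : 2 * B.β * nsq B.ST x = 1 := by
  simp only [nsq, Fin.sum_univ_three, partialD_ST]
  simp only [← B.sq_sq]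
  have := B.sq_pos.ne'
  simp
  field_simp

/-- The constant `√(2β)/2` in the potential `X` is chosen for this: it gives `Gs = -A ν` next to `Gc
= -A τ`, and `e_z ∧` rotates `(ν, τ)` by a right angle. The surface is flat, so no pressure is
needed. -/
theorem ekman_top (t : ℝ) {x : E3} (hx : x 2 = 0) :
    ((2 * B.β * nsq B.ST x) • B.Gs B.ST B.thT t x + ezL (B.Gc B.thT t x)
      + (0 : ℝ) • grd B.ST x = 0) ∧
      -((2 * B.β * nsq B.ST x) • B.Gc B.thT t x) + ezL (B.Gs B.ST B.thT t x) = 0 := by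
  have h1 : B.thT x = 1 := (B.thT_top hx).self_of_nhds
  have hX : B.X t x = (Real.exp (-t * B.Λ x) * B.f (B.r x) * (B.sq / 2)) • B.nu x := by
    simp only [X, hx]; module
  have hGs : B.Gs B.ST B.thT t x = -((Real.exp (-t * B.Λ x) * B.f (B.r x)) • B.nu x) := by
    rw [Gs, grd_ST, h1, hX]
    ext j
    have := B.sq_pos.ne'
    simp [wsym, nu_two]
    field_simp
  have hGc : B.Gc B.thT t x = -((Real.exp (-t * B.Λ x) * B.f (B.r x)) • B.tau x) := by
    rw [Gc, h1, V0]; module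
  rw [nsq_ST, hGs, hGc]
  simp only [map_neg, map_smul, ezL_tau]
  constructor
  · module
  · rw [← tau]; module

theorem partialD_SB {x : E3} (hx : x 2 = -B.φ (B.r x)) (j : Fin 3) :
    partialD j B.SB x
      = ((if j = 2 then 1 else 0) + deriv B.φ (B.r x) * partialD j B.r x)
        * (B.sq * B.μ (B.r x) ^ 3)⁻¹ := by
  have h1 : ContDiff ℝ ∞ fun x => B.φ (B.r x) := B.smooth_φ.comp B.smooth_r
  have h2 : ContDiff ℝ ∞ fun x => (B.sq * B.μ (B.r x) ^ 3)⁻¹ := B.smooth_sig_inv.comp B.smooth_r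
  have h3 : ContDiff ℝ ∞ fun x : E3 => x 2 + B.φ (B.r x) := (contDiff_crd 2).add h1
  have : B.SB = fun x => (x 2 + B.φ (B.r x)) * (B.sq * B.μ (B.r x) ^ 3)⁻¹ := rfl
  rw [this, partialD_mul h3 h2, partialD_add (contDiff_crd 2) h1, partialD_crd,
    partialD_comp B.smooth_r j x (contDiff_diff B.smooth_φ _).hasDerivAt, hx]
  ring

/-- The pumping coefficient enters here: `φ Λ = √(2β) (1 + μ) / 2`, so `X = -(√(2β) μ/2) A ν` at the
bottom. As `ν` is a unit vector, the resulting amplitude is tangent to the bottom. -/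
theorem Gs_SB (t : ℝ) {x : E3} (hx : x 2 = -B.φ (B.r x)) (hK : hor x ∈ B.K) :
    B.Gs B.SB B.thB t x = -((Real.exp (-t * B.Λ x) * B.f (B.r x) * (B.μ (B.r x) ^ 2)⁻¹) •
      (B.nu x - deriv B.φ (B.r x) • bas 2)) := by
  have h1 : B.thB x = 1 := (B.thB_bot hx).self_of_nhds
  have hs := B.sq_pos.ne'
  have hm := (B.μ_pos (B.r x)).ne'
  have hp := (B.φ_pos (B.r x)).ne'
  have hX : B.X t x
      = (-(Real.exp (-t * B.Λ x) * B.f (B.r x) * (B.sq * B.μ (B.r x) / 2))) • B.nu x := by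
    have : B.sq / 2 + B.Λ x * x 2 = -(B.sq * B.μ (B.r x) / 2) := by
      rw [hx, Λ, lam]; field_simp; ring
    simp only [X, this]; module
  have hu := B.unit_r hK
  rw [Gs, h1, hX]
  ext j
  simp only [wsym, grd_apply, Fin.sum_univ_three, B.partialD_SB hx]
  fin_cases j
  · simp [nu_zero, B.partialD_two_r]
    field_simp
  · simp [nu_one, B.partialD_two_r]
    field_simp
  · simp [nu_zero, nu_one, nu_two, B.partialD_two_r]
    field_simp
    linear_combination B.f (B.r x) * deriv B.φ (B.r x) * hu

/-- The field `e_z ∧ Gc = A ν` is not tangent to the slope; the pressure `qB` absorbs its normal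
component. The tangential component then forces `2β |∇S|² = μ⁻²`, and since `|∇(z + φ)|² = 1 + φ'² =
μ⁴`, this dictates the width `√(2β) μ³` in `SB`. -/
theorem ekman_bot (t : ℝ) {x : E3} (hx : x 2 = -B.φ (B.r x)) (hK : hor x ∈ B.K) :
    ((2 * B.β * nsq B.SB x) • B.Gs B.SB B.thB t x + ezL (B.Gc B.thB t x)
      + B.qB t x • grd B.SB x = 0) ∧
      -((2 * B.β * nsq B.SB x) • B.Gc B.thB t x) + ezL (B.Gs B.SB B.thB t x) = 0 := by
  have h1 : B.thB x = 1 := (B.thB_bot hx).self_of_nhds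
  have hs := B.sq_pos.ne'
  have hm := (B.μ_pos (B.r x)).ne'
  have hu := B.unit_r hK
  have hsl : B.μ (B.r x) ^ 4 = 1 + deriv B.φ (B.r x) ^ 2 := B.slope _ hK
  have hn : 2 * B.β * nsq B.SB x = (B.μ (B.r x) ^ 2)⁻¹ := by
    simp only [nsq, Fin.sum_univ_three, B.partialD_SB hx, B.partialD_two_r, ← B.sq_sq]
    simp
    field_simp
    linear_combination (deriv B.φ (B.r x)) ^ 2 * hu - hsl
  have hGc : B.Gc B.thB t x = -((Real.exp (-t * B.Λ x) * B.f (B.r x)) • B.tau x) := by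
    rw [Gc, h1, V0]; module
  rw [hn, B.Gs_SB t hx hK, hGc]
  constructor
  · simp only [map_neg, map_smul, ezL_tau]
    ext j
    simp only [qB, PiLp.add_apply, PiLp.smul_apply, PiLp.neg_apply, PiLp.sub_apply, grd_apply,
      B.partialD_SB hx, smul_eq_mul, PiLp.zero_apply]
    fin_cases j
    · simp [nu_zero]
      field_simp
      linear_combination Real.exp (-(t * B.Λ x)) * B.f (B.r x) * partialD 0 B.r x * hsl
    · simp [nu_one]
      field_simp
      linear_combination Real.exp (-(t * B.Λ x)) * B.f (B.r x) * partialD 1 B.r x * hsl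
    · simp [nu_two, B.partialD_two_r]
      field_simp
      try ring
  · have : ezL (bas 2) = 0 := by
      ext j; fin_cases j <;> simp [ezL_apply, ezWedge]
    have ht : ezL (B.nu x) = B.tau x := rfl
    simp only [map_neg, map_smul, map_sub, this, ht]
    module

end Basin

namespace Basin

variable (B : Basin)

/-! #### Bounds -/

/-- The size of the boundary layers. -/
def bl (ε : ℝ) (x : E3) : ℝ :=
  Real.exp (-(ε⁻¹ * (-x 2) / (2 * B.sM))) + Real.exp (-(ε⁻¹ * (x 2 + B.φ (B.r x)) / (2 * B.sM)))

/-- The scalar amplitude of the interior velocity, i.e. the derivative of the pressure. -/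
def A (t : ℝ) (x : E3) : ℝ := Real.exp (-t * B.Λ x) * B.f (B.r x)

/-- The pressure of the bottom layer, divided by `ε`. -/
def pB (ε t : ℝ) (x : E3) : ℝ :=
  lay B.SB ε (fun x => -(1 / 2 : ℝ) • B.qB t x) (fun x => (1 / 2 : ℝ) • B.qB t x) x

/-- The remainder in the Stokes-Coriolis system. -/
def E (ε t : ℝ) (x : E3) : E3 :=
  res B.β ε (B.F ε) t x + ε⁻¹ • B.A t x • B.nu x + grd (B.pB ε t) x

theorem exp_ST_le {ε : ℝ} (hε : 0 < ε) {x : E3} (hx : x ∈ B.D) :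
    Real.exp (-(ε⁻¹ * B.ST x / 2)) ≤ Real.exp (-(ε⁻¹ * (-x 2) / (2 * B.sM))) := by
  apply Real.exp_le_exp.2
  have h := B.abs_le_ST hx
  have hs := B.sM_pos
  rw [sub_zero, abs_of_nonpos hx.2.2] at h
  have : -x 2 / B.sM ≤ B.ST x := by rwa [div_le_iff₀ hs, mul_comm]
  have := mul_le_mul_of_nonneg_left this (inv_pos.2 hε).le
  have e : ε⁻¹ * (-x 2) / (2 * B.sM) = ε⁻¹ * (-x 2 / B.sM) / 2 := by field_simp
  rw [e]
  linarith

theorem exp_SB_le {ε : ℝ} (hε : 0 < ε) {x : E3} (hx : x ∈ B.D) :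
    Real.exp (-(ε⁻¹ * B.SB x / 2))
      ≤ Real.exp (-(ε⁻¹ * (x 2 + B.φ (B.r x)) / (2 * B.sM))) := by
  apply Real.exp_le_exp.2
  have h := B.abs_le_SB hx
  have hs := B.sM_pos
  rw [sub_neg_eq_add, abs_of_nonneg (by linarith [hx.2.1])] at h
  have : (x 2 + B.φ (B.r x)) / B.sM ≤ B.SB x := by rwa [div_le_iff₀ hs, mul_comm]
  have := mul_le_mul_of_nonneg_left this (inv_pos.2 hε).le
  have e : ε⁻¹ * (x 2 + B.φ (B.r x)) / (2 * B.sM) = ε⁻¹ * ((x 2 + B.φ (B.r x)) / B.sM) / 2 := by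
    field_simp
  rw [e]
  linarith

/-- Two cancellations take place: `e_z ∧ V0 = -A ν` against the pressure at order `ε⁻¹`, and `e_z ∧
V1 = Λ A τ` against `∂_t V0` at order `1`. -/
theorem Vint_res (ε t : ℝ) (hε : ε ≠ 0) (x : E3) :
    res B.β ε (B.Vint ε) t x + ε⁻¹ • B.A t x • B.nu x
      = ε • (deriv (fun s => B.V1 s x) t - B.β • lap (B.V0 t) x - ε • B.β • lap (B.V1 t) x) := by
  have h0 := B.dec_V0.smooth B.smooth_Λ t
  have h1 := B.dec_V1.smooth B.smooth_Λ t
  have d0 := B.dec_V0.differentiableAt_time B.smooth_Λ t x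
  have d1 := B.dec_V1.differentiableAt_time B.smooth_Λ t x
  have e0 : res B.β ε (B.Vint ε) t x = res B.β ε B.V0 t x + ε • res B.β ε B.V1 t x := by
    rw [← res_const_smul ε h1]
    exact res_add h0 (h1.const_smul ε) d0 (d1.const_smul ε)
  have e1 : ezL (B.V0 t x) = -(B.A t x • B.nu x) := by
    simp only [V0, map_smul, ezL_tau, A]; module
  have e2 : deriv (fun s => B.V0 s x) t = -(B.Λ x • B.A t x • B.tau x) := by
    have h : HasDerivAt (fun s : ℝ => Real.exp (-s * B.Λ x)) (Real.exp (-t * B.Λ x) * (-B.Λ x)) t := by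
      simpa using ((hasDerivAt_id t).neg.mul_const (B.Λ x)).exp
    have : deriv (fun s => B.V0 s x) t = _ := (h.smul_const (B.f (B.r x) • B.tau x)).deriv
    rw [this, A]; module
  have e3 : ezL (B.V1 t x) = B.Λ x • B.A t x • B.tau x := by
    -- On a vertical line `r`, and hence `Λ`, `A` and `ν`, are constant, so `X` is affine there with
    -- slope `Λ A ν`.
    have hd : HasDerivAt (fun s => B.X t (pt (hor x) s)) ((B.Λ x * B.A t x) • B.nu x) (x 2) := by
      have hr : ∀ s, B.r (pt (hor x) s) = B.r x := fun s => by simp [r]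
      have hn : ∀ s, B.nu (pt (hor x) s) = B.nu x := by
        intro s
        have hj : ∀ j, partialD j B.r (pt (hor x) s) = partialD j B.r x := by
          intro j
          have hz : ∀ s, HasDerivAt (fun s => partialD j B.r (pt (hor x) s)) 0 s := by
            intro s
            have := hasDerivAt_vertical (contDiff_partialD B.smooth_r j) (hor x) s
            rw [partialD_comm B.smooth_r] at this
            have h0 : partialD 2 B.r = fun _ => 0 := funext B.partialD_two_r
            rwa [h0, partialD_const] at this
          have := is_const_of_deriv_eq_zero (fun s => (hz s).differentiableAt)
            (fun s => (hz s).deriv) s (x 2)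
          simpa using this
        ext j
        simp [nu, hj]
      have hX : (fun s => B.X t (pt (hor x) s)) = fun s =>
          (B.A t x * (B.sq / 2) + B.Λ x * B.A t x * s) • B.nu x := by
        funext s
        simp only [X, Λ, hr, hn, pt_two, A]
        module
      rw [hX]
      have := (((hasDerivAt_id (x 2)).const_mul (B.Λ x * B.A t x)).const_add
        (B.A t x * (B.sq / 2))).smul_const (B.nu x)
      simpa using this
    have hd' := hasDerivAt_vertical (B.dec_X.smooth B.smooth_Λ t) (hor x) (x 2)
    rw [pt_hor] at hd'
    have hb : ezL (bas 2) = 0 := by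
      ext j; fin_cases j <;> simp [ezL_apply, ezWedge]
    have ht : ezL (B.nu x) = B.tau x := rfl
    rw [V1, wfld, hd'.unique hd]
    simp only [map_sub, map_smul, hb, ht]
    module
  rw [e0]
  simp only [res, e1, e2, e3]
  match_scalars <;> field_simp <;> ring

theorem res_F (ε t : ℝ) (x : E3) :
    res B.β ε (B.F ε) t x = res B.β ε (B.Vint ε) t x
      + ((res B.β ε (fun t => lay B.ST ε (B.Gc B.thT t) (B.Gs B.ST B.thT t)) t x
          + ε • res B.β ε (fun t => lay B.ST ε (B.G1 B.thT t) (B.G1 B.thT t)) t x)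
        + (res B.β ε (fun t => lay B.SB ε (B.Gc B.thB t) (B.Gs B.SB B.thB t)) t x
          + ε • res B.β ε (fun t => lay B.SB ε (B.G1 B.thB t) (B.G1 B.thB t)) t x)) := by
  have dt : ∀ {u : ℝ → E3 → E3}, (ContDiff ℝ ∞ fun q : ℝ × E3 => u q.1 q.2) →
      DifferentiableAt ℝ (fun s => u s x) t := by
    intro u hu
    have : ContDiff ℝ ∞ (fun s => u s x) := hu.comp (contDiff_id.prodMk contDiff_const)
    exact contDiff_diff this t
  have hL : ∀ {S th : E3 → ℝ}, ContDiff ℝ ∞ S → ContDiff ℝ ∞ th →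
      res B.β ε (B.LF S th ε) t x = res B.β ε (fun t => lay S ε (B.Gc th t) (B.Gs S th t)) t x
          + ε • res B.β ε (fun t => lay S ε (B.G1 th t) (B.G1 th t)) t x := by
    intro S th hS hth
    have h1 := B.contDiff_lay_uncurry ε hS (B.dec_Gc hth) (B.dec_Gs hS hth)
    have h2 := B.contDiff_lay_uncurry ε hS (B.dec_G1 hth) (B.dec_G1 hth)
    have h3 : ContDiff ℝ ∞ (lay S ε (B.G1 th t) (B.G1 th t)) :=
      contDiff_slice (f := fun t => lay S ε (B.G1 th t) (B.G1 th t)) h2 t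
    rw [← res_const_smul ε h3]
    exact res_add (contDiff_slice h1 t) (h3.const_smul ε) (dt h1)
      ((dt h2).const_smul ε)
  rw [← hL B.smooth_ST B.smooth_thT, ← hL B.smooth_SB B.smooth_thB]
  have hT := B.smooth_LF B.smooth_ST B.smooth_thT ε
  have hB := B.smooth_LF B.smooth_SB B.smooth_thB ε
  rw [← res_add (contDiff_slice hT t) (contDiff_slice hB t) (dt hT) (dt hB)]
  exact res_add (contDiff_slice (B.smooth_Vint ε) t) (contDiff_slice (B.smooth_UBL ε) t)
    (dt (B.smooth_Vint ε)) (dt (B.smooth_UBL ε))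

theorem E_bound : ∃ C, 0 ≤ C ∧ ∀ ε, 0 < ε → ε ≤ 1 → ∀ t, 0 ≤ t → ∀ x ∈ B.D,
    ‖B.E ε t x‖ ≤ C * Real.exp (-B.c * t) * (ε + B.bl ε x) := by
  have hR : ∀ x ∈ B.D, 2 * B.c ≤ B.Λ x := fun x hx => B.rate_D hx
  have h0 := (B.dec_V1.time B.smooth_Λ).sub
    ((B.dec_V0.lap B.smooth_Λ B.closed_K).const_smul B.β)
  obtain ⟨C0, c0, hC0⟩ := h0.bound B.c_pos B.compact_D hR
  obtain ⟨C1, c1, hC1⟩ := ((B.dec_V1.lap B.smooth_Λ B.closed_K).const_smul B.β).bound B.c_pos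
    B.compact_D hR
  obtain ⟨C2, c2, hC2⟩ := Dec.ekman_bound (β := B.β) (σ := B.sM) B.smooth_ST B.smooth_Λ B.closed_K
    B.c_pos B.compact_D hR (fun x hx => B.ST_nonneg hx) (B.dec_Gc B.smooth_thT)
    (B.dec_Gs B.smooth_ST B.smooth_thT) Dec.zero B.sM_pos.le
    (fun x hx => ⟨0, B.segment_top hx, B.abs_le_ST hx, fun t => B.ekman_top t (by simp)⟩)
  obtain ⟨C3, c3, hC3⟩ := Dec.ekman_bound (β := B.β) (σ := B.sM) B.smooth_SB B.smooth_Λ B.closed_K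
    B.c_pos B.compact_D hR (fun x hx => B.SB_nonneg hx) (B.dec_Gc B.smooth_thB)
    (B.dec_Gs B.smooth_SB B.smooth_thB) B.dec_qB B.sM_pos.le
    (fun x hx => ⟨-B.φ (B.r x), B.segment_bot hx, B.abs_le_SB hx,
      fun t => B.ekman_bot t (by simp [r]) (by simpa using hx.1)⟩)
  obtain ⟨C4, c4, hC4⟩ := Dec.res_lay_bound (β := B.β) B.smooth_ST B.smooth_Λ B.closed_K B.c_pos
    B.compact_D hR (fun x hx => B.ST_nonneg hx) (B.dec_G1 B.smooth_thT) (B.dec_G1 B.smooth_thT)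
  obtain ⟨C5, c5, hC5⟩ := Dec.res_lay_bound (β := B.β) B.smooth_SB B.smooth_Λ B.closed_K B.c_pos
    B.compact_D hR (fun x hx => B.SB_nonneg hx) (B.dec_G1 B.smooth_thB) (B.dec_G1 B.smooth_thB)
  refine ⟨C0 + C1 + C2 + C3 + C4 + C5, by positivity, fun ε hε hε1 t ht x hx => ?_⟩
  set e := Real.exp (-B.c * t)
  have he : 0 ≤ e := Real.exp_nonneg _
  set eT := Real.exp (-(ε⁻¹ * (-x 2) / (2 * B.sM)))
  set eB := Real.exp (-(ε⁻¹ * (x 2 + B.φ (B.r x)) / (2 * B.sM)))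
  have heT : 0 ≤ eT := Real.exp_nonneg _
  have heB : 0 ≤ eB := Real.exp_nonneg _
  have hz : grd (lay B.ST ε (fun _ => -(1 / 2 : ℝ) • (0 : ℝ)) (fun _ => (1 / 2 : ℝ) • (0 : ℝ))) x
      = 0 := by
    have : (lay B.ST ε (fun _ => -(1 / 2 : ℝ) • (0 : ℝ)) (fun _ => (1 / 2 : ℝ) • (0 : ℝ)))
      = fun _ => 0 := by funext y; simp [lay]
    rw [this]; ext j; simp [partialD_const]
  have b2 := hC2 ε hε hε1 t ht x hx
  rw [hz, add_zero] at b2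
  have b3 := hC3 ε hε hε1 t ht x hx
  have b4 := hC4 ε hε hε1 t ht x hx
  have b5 := hC5 ε hε hε1 t ht x hx
  have tT := B.exp_ST_le hε hx
  have tB := B.exp_SB_le hε hx
  have b0 := hC0 t ht x hx
  have b1 := hC1 t ht x hx
  have b01 : ‖ε • (deriv (fun s => B.V1 s x) t - B.β • lap (B.V0 t) x - ε • B.β • lap (B.V1 t) x)‖
      ≤ (C0 + C1) * e * ε := by
    rw [norm_smul, Real.norm_of_nonneg hε.le, mul_comm]
    refine mul_le_mul_of_nonneg_right ((norm_sub_le _ _).trans ?_) hε.le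
    rw [norm_smul, Real.norm_of_nonneg hε.le, add_mul]
    refine add_le_add b0 (le_trans ?_ b1)
    exact mul_le_of_le_one_left (norm_nonneg _) hε1
  -- The pressure of the bottom layer is grouped with the leading bottom layer, whose residual it
  -- helps to cancel.
  have split : B.E ε t x =
      ε • (deriv (fun s => B.V1 s x) t - B.β • lap (B.V0 t) x - ε • B.β • lap (B.V1 t) x)
      + res B.β ε (fun t => lay B.ST ε (B.Gc B.thT t) (B.Gs B.ST B.thT t)) t x
      + (res B.β ε (fun t => lay B.SB ε (B.Gc B.thB t) (B.Gs B.SB B.thB t)) t x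
        + grd (B.pB ε t) x)
      + ε • res B.β ε (fun t => lay B.ST ε (B.G1 B.thT t) (B.G1 B.thT t)) t x
      + ε • res B.β ε (fun t => lay B.SB ε (B.G1 B.thB t) (B.G1 B.thB t)) t x := by
    rw [E, res_F, ← B.Vint_res ε t hε.ne']
    module
  rw [split]
  have g2 : C2 * e * Real.exp (-(ε⁻¹ * B.ST x / 2)) ≤ C2 * e * eT := by gcongr
  have g3 : C3 * e * Real.exp (-(ε⁻¹ * B.SB x / 2)) ≤ C3 * e * eB := by gcongr
  have g4 : C4 * e * Real.exp (-(ε⁻¹ * B.ST x / 2)) ≤ C4 * e * eT := by gcongr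
  have g5 : C5 * e * Real.exp (-(ε⁻¹ * B.SB x / 2)) ≤ C5 * e * eB := by gcongr
  have n1 := norm_add_le_of_le (norm_add_le_of_le (norm_add_le_of_le (norm_add_le_of_le b01 b2) b3)
    b4) b5
  refine n1.trans ?_
  have hbl : B.bl ε x = eT + eB := rfl
  rw [hbl]
  have p1 : 0 ≤ e * ε := by positivity
  have p2 : 0 ≤ e * eT := by positivity
  have p3 : 0 ≤ e * eB := by positivity
  nlinarith [mul_nonneg c0 p2, mul_nonneg c0 p3, mul_nonneg c1 p2, mul_nonneg c1 p3,
    mul_nonneg c2 p1, mul_nonneg c2 p3, mul_nonneg c3 p1, mul_nonneg c3 p2, mul_nonneg c4 p1,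
    mul_nonneg c4 p3, mul_nonneg c5 p1, mul_nonneg c5 p2]

theorem norm_sq_eq (v : E3) : ‖v‖ ^ 2 = v 0 ^ 2 + v 1 ^ 2 + v 2 ^ 2 := by
  rw [EuclideanSpace.norm_sq_eq]; simp [Fin.sum_univ_three]

theorem norm_nu {x : E3} (hx : hor x ∈ B.K) : ‖B.nu x‖ = 1 := by
  have h : ‖B.nu x‖ ^ 2 = 1 := by
    rw [norm_sq_eq, nu_zero, nu_one, nu_two]
    simpa using B.unit_r hx
  nlinarith [norm_nonneg (B.nu x)]

theorem norm_tau {x : E3} (hx : hor x ∈ B.K) : ‖B.tau x‖ = 1 := by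
  have h : ‖B.tau x‖ ^ 2 = 1 := by
    rw [norm_sq_eq, tau, ezL_apply]
    have := B.unit_r hx
    simp [ezWedge, nu]
    linarith
  nlinarith [norm_nonneg (B.tau x)]

theorem N_nonneg : 0 ≤ B.N := (abs_nonneg _).trans (B.amp 0)

theorem exp_le_one {t : ℝ} (ht : 0 ≤ t) {x : E3} (hx : hor x ∈ B.K) :
    Real.exp (-t * B.Λ x) ≤ 1 := by
  apply Real.exp_le_one_iff.2
  have h1 : 2 * B.c ≤ B.Λ x := B.rate _ hx
  nlinarith [B.c_pos]

theorem abs_A_le {t : ℝ} (ht : 0 ≤ t) {x : E3} (hx : hor x ∈ B.K) : |B.A t x| ≤ B.N := by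
  rw [A, abs_mul, Real.abs_exp]
  calc _ ≤ 1 * B.N := mul_le_mul (B.exp_le_one ht hx) (B.amp _) (abs_nonneg _) zero_le_one
    _ = _ := one_mul _

/-- Solving the first Ekman equation at the surface gives `Gs = -A ν`, so the bound involves the
amplitude of the profile and none of its derivatives. -/
theorem norm_Gs_top {t : ℝ} (ht : 0 ≤ t) {x : E3} (hx : x 2 = 0) (hK : hor x ∈ B.K) :
    ‖B.Gs B.ST B.thT t x‖ ≤ 2 * B.N := by
  have h := (B.ekman_top t hx).1
  have h1 : B.thT x = 1 := (B.thT_top hx).self_of_nhds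
  have hGc : ezL (B.Gc B.thT t x) = B.A t x • B.nu x := by
    rw [Gc, h1, V0, A]
    simp only [map_neg, map_smul, ezL_tau]
    module
  rw [nsq_ST, one_smul, zero_smul, add_zero, hGc] at h
  rw [eq_neg_of_add_eq_zero_left h, norm_neg, norm_smul, B.norm_nu hK, mul_one, Real.norm_eq_abs]
  linarith [B.abs_A_le ht hK, B.N_nonneg]

/-- The factor `μ⁻²` compensates the slope: `|ν - φ' e_z| ≤ 1 + |φ'| ≤ 2 μ²` because `μ⁴ = 1 + φ'²`.
-/
theorem norm_Gs_bot {t : ℝ} (ht : 0 ≤ t) {x : E3} (hx : x 2 = -B.φ (B.r x)) (hK : hor x ∈ B.K) :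
    ‖B.Gs B.SB B.thB t x‖ ≤ 2 * B.N := by
  rw [B.Gs_SB t hx hK, norm_neg, norm_smul, norm_mul, Real.norm_eq_abs, Real.norm_eq_abs]
  have h1 : |Real.exp (-t * B.Λ x) * B.f (B.r x)| ≤ B.N := B.abs_A_le ht hK
  have hm := B.μ_pos (B.r x)
  have hsl : B.μ (B.r x) ^ 4 = 1 + deriv B.φ (B.r x) ^ 2 := B.slope _ hK
  have h2 : ‖B.nu x - deriv B.φ (B.r x) • bas 2‖ ≤ 1 + |deriv B.φ (B.r x)| := by
    refine (norm_sub_le _ _).trans (add_le_add (B.norm_nu hK).le ?_)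
    rw [norm_smul]; simp
  have h3 : 1 ≤ B.μ (B.r x) ^ 2 := by
    by_contra hc
    nlinarith [sq_nonneg (deriv B.φ (B.r x)), sq_nonneg (B.μ (B.r x))]
  have h4 : |deriv B.φ (B.r x)| ≤ B.μ (B.r x) ^ 2 := by
    apply abs_le_of_sq_le_sq _ (by positivity)
    nlinarith
  rw [abs_of_pos (by positivity : 0 < (B.μ (B.r x) ^ 2)⁻¹), mul_assoc]
  have h5 : (B.μ (B.r x) ^ 2)⁻¹ * ‖B.nu x - deriv B.φ (B.r x) • bas 2‖ ≤ 2 := by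
    rw [inv_mul_le_iff₀ (by positivity)]
    linarith
  calc _ ≤ B.N * 2 := mul_le_mul h1 h5 (by positivity) B.N_nonneg
    _ = _ := mul_comm _ _

/-- The leading constant `3N` (one `N` from `Gc`, two from `Gs` on the boundary) does not depend on
the truncation. The constant `C` does, but it comes with a factor `ε`: explicit for `G1`, and gained
from `S exp (-S/ε)` for the variation of `Gs` away from the boundary. -/
theorem LF_bound {S th : E3 → ℝ} (hS : ContDiff ℝ ∞ S) (hth : ContDiff ℝ ∞ th)
    (h01 : ∀ x, 0 ≤ th x ∧ th x ≤ 1) (hSD : ∀ x ∈ B.D, 0 ≤ S x)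
    (hsurf : ∀ x ∈ B.D, ∃ z, (∀ s ∈ uIcc z (x 2), pt (hor x) s ∈ B.D) ∧ |x 2 - z| ≤ B.sM * S x ∧
      ∀ t, 0 ≤ t → ‖B.Gs S th t (pt (hor x) z)‖ ≤ 2 * B.N) :
    ∃ C, 0 ≤ C ∧ ∀ ε, 0 < ε → ∀ t, 0 ≤ t → ∀ x ∈ B.D,
      ‖B.LF S th ε t x‖ ≤ (3 * B.N + C * ε) * Real.exp (-(ε⁻¹ * S x / 2)) := by
  have hR : ∀ x ∈ B.D, 2 * B.c ≤ B.Λ x := fun x hx => B.rate_D hx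
  obtain ⟨C1, c1, hC1⟩ := (B.dec_G1 hth).bound B.c_pos B.compact_D hR
  obtain ⟨C2, c2, hC2⟩ := (B.dec_Gs hS hth).vertical_bound B.smooth_Λ B.closed_K B.c_pos
    B.compact_D hR
  have hs := B.sM_pos
  have hN := B.N_nonneg
  refine ⟨2 * C1 + 2 * C2 * B.sM, by positivity, fun ε hε t ht x hx => ?_⟩
  have he : Real.exp (-B.c * t) ≤ 1 := Real.exp_le_one_iff.2 (by nlinarith [B.c_pos])
  have g1 : ‖B.G1 th t x‖ ≤ C1 := (hC1 t ht x hx).trans (mul_le_of_le_one_right c1 he)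
  obtain ⟨z, hz, hzS, hG⟩ := hsurf x hx
  have g2 : ‖B.Gs S th t x‖ ≤ 2 * B.N + C2 * (B.sM * S x) := by
    have h1 := hC2 t ht x z hz
    have h2 : C2 * Real.exp (-B.c * t) * |x 2 - z| ≤ C2 * 1 * (B.sM * S x) := by gcongr
    have h3 := norm_le_norm_add_norm_sub' (B.Gs S th t x) (B.Gs S th t (pt (hor x) z))
    linarith [hG t ht]
  have g3 : ‖B.Gc th t x‖ ≤ B.N := by
    have : B.Gc th t x = -(th x • B.A t x • B.tau x) := by rw [Gc, V0, A]; module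
    rw [this, norm_neg, norm_smul, norm_smul, B.norm_tau hx.1, mul_one, Real.norm_eq_abs,
      Real.norm_eq_abs, abs_of_nonneg (h01 x).1]
    exact (mul_le_of_le_one_left (abs_nonneg _) (h01 x).2).trans (B.abs_A_le ht hx.1)
  have hs0 : 0 ≤ ε⁻¹ * S x := mul_nonneg (by positivity) (hSD x hx)
  set e := Real.exp (-(ε⁻¹ * S x / 2))
  have E1 : Real.exp (-(ε⁻¹ * S x)) ≤ e := Real.exp_le_exp.2 (by linarith)
  have E2 : ε⁻¹ * S x * Real.exp (-(ε⁻¹ * S x)) ≤ 2 * e := mul_exp_neg_le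
  have l1 := norm_lay_le (S := S) (ε := ε) (B.Gc th t) (B.Gs S th t) x
  have l2 := norm_lay_le (S := S) (ε := ε) (B.G1 th t) (B.G1 th t) x
  have e0 : 0 ≤ Real.exp (-(ε⁻¹ * S x)) := Real.exp_nonneg _
  calc ‖B.LF S th ε t x‖ ≤ Real.exp (-(ε⁻¹ * S x)) * (‖B.Gc th t x‖ + ‖B.Gs S th t x‖)
        + ε * (Real.exp (-(ε⁻¹ * S x)) * (‖B.G1 th t x‖ + ‖B.G1 th t x‖)) := by
        refine norm_add_le_of_le l1 ?_
        rw [norm_smul, Real.norm_of_nonneg hε.le]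
        gcongr
    _ ≤ Real.exp (-(ε⁻¹ * S x)) * (B.N + (2 * B.N + C2 * (B.sM * S x)))
        + ε * (Real.exp (-(ε⁻¹ * S x)) * (C1 + C1)) := by gcongr
    _ = Real.exp (-(ε⁻¹ * S x)) * (3 * B.N + ε * (2 * C1))
        + ε * (C2 * B.sM) * (ε⁻¹ * S x * Real.exp (-(ε⁻¹ * S x))) := by field_simp; ring
    _ ≤ e * (3 * B.N + ε * (2 * C1)) + ε * (C2 * B.sM) * (2 * e) := by gcongr
    _ = _ := by ring

theorem thT_mem (x : E3) : 0 ≤ B.thT x ∧ B.thT x ≤ 1 :=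
  ⟨Real.smoothTransition.nonneg _, Real.smoothTransition.le_one _⟩

theorem thB_mem (x : E3) : 0 ≤ B.thB x ∧ B.thB x ≤ 1 :=
  ⟨sub_nonneg.2 (B.thT_mem x).2, sub_le_self _ (B.thT_mem x).1⟩

theorem UBL_bound : ∃ C, 0 ≤ C ∧ ∀ ε, 0 < ε → ∀ t, 0 ≤ t → ∀ x ∈ B.D,
    ‖B.UBL ε t x‖ ≤ (3 * B.N + C * ε) * B.bl ε x := by
  obtain ⟨C1, c1, hC1⟩ := B.LF_bound B.smooth_ST B.smooth_thT B.thT_mem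
    (fun x hx => B.ST_nonneg hx) (fun x hx => ⟨0, B.segment_top hx, B.abs_le_ST hx,
      fun t ht => B.norm_Gs_top ht (by simp) (by simpa using hx.1)⟩)
  obtain ⟨C2, c2, hC2⟩ := B.LF_bound B.smooth_SB B.smooth_thB B.thB_mem
    (fun x hx => B.SB_nonneg hx) (fun x hx => ⟨-B.φ (B.r x), B.segment_bot hx, B.abs_le_SB hx,
      fun t ht => B.norm_Gs_bot ht (by simp [r]) (by simpa using hx.1)⟩)
  have hN := B.N_nonneg
  refine ⟨C1 + C2, by positivity, fun ε hε t ht x hx => ?_⟩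
  rw [UBL, bl, mul_add]
  refine norm_add_le_of_le ((hC1 ε hε t ht x hx).trans ?_) ((hC2 ε hε t ht x hx).trans ?_)
  · exact mul_le_mul (by nlinarith) (B.exp_ST_le hε hx) (Real.exp_nonneg _) (by positivity)
  · exact mul_le_mul (by nlinarith) (B.exp_SB_le hε hx) (Real.exp_nonneg _) (by positivity)

end Basin

/-! ### Curves in Lebesgue spaces -/

section LebesgueCurves

variable {V : Type*} [NormedAddCommGroup V]

/-- Dominated convergence in `L²`. -/
theorem tendsto_eLpNorm_two_zero_of_dominated {α ι : Type*} [MeasurableSpace α] {μ : Measure α}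
    {l : Filter ι} [l.IsCountablyGenerated] {g : ι → α → V} {b : α → ℝ}
    (hg : ∀ i, AEStronglyMeasurable (g i) μ) (hbi : eLpNorm b 2 μ ≠ ⊤)
    (hb : ∀ᶠ i in l, ∀ᵐ x ∂μ, ‖g i x‖ ≤ b x)
    (hlim : ∀ᵐ x ∂μ, Tendsto (fun i => g i x) l (𝓝 0)) :
    Tendsto (fun i => eLpNorm (g i) 2 μ) l (𝓝 0) := by
  have e : ∀ i, eLpNorm (g i) 2 μ = (∫⁻ x, ‖g i x‖ₑ ^ (2 : ℝ) ∂μ) ^ (1 / 2 : ℝ) := by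
    intro i
    rw [eLpNorm_eq_lintegral_rpow_enorm_toReal (by norm_num) (by norm_num)]
    norm_num
  simp only [e]
  have h0 : (0 : ℝ≥0∞) = (∫⁻ _, 0 ∂μ) ^ (1 / 2 : ℝ) := by simp
  rw [h0]
  refine (ENNReal.continuous_rpow_const.tendsto _).comp ?_
  refine tendsto_lintegral_filter_of_dominated_convergence'
    (fun x => ‖b x‖ₑ ^ (2 : ℝ)) ?_ ?_ ?_ ?_
  · exact Eventually.of_forall fun i => (hg i).enorm.pow_const _
  · filter_upwards [hb] with i hi
    filter_upwards [hi] with x hx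
    gcongr
    rw [← ofReal_norm, ← ofReal_norm]
    exact ENNReal.ofReal_le_ofReal (hx.trans (le_abs_self _))
  · have := eLpNorm_lt_top_iff_lintegral_rpow_enorm_lt_top (f := b) (μ := μ) (p := 2) (by simp)
      (by simp)
    simpa using (this.1 hbi.lt_top).ne
  · filter_upwards [hlim] with x hx
    have h1 : Tendsto (fun i => ‖g i x‖ₑ) l (𝓝 0) := by
      have := (continuous_enorm.tendsto (0 : V)).comp hx
      rwa [enorm_zero] at this
    have := (ENNReal.continuous_rpow_const (y := 2)).tendsto 0 |>.comp h1
    simpa [Function.comp_def] using this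

/-- Dominated convergence for fields which are bounded and vanish outside of a set of finite
measure. -/
theorem tendsto_eLpNorm_two_zero {α ι : Type*} [MeasurableSpace α] {μ : Measure α}
    {l : Filter ι} [l.IsCountablyGenerated] {g : ι → α → V}
    (hg : ∀ i, AEStronglyMeasurable (g i) μ) {D : Set α} (hD : MeasurableSet D) (hμ : μ D ≠ ⊤)
    {C : ℝ} (hb : ∀ᶠ i in l, ∀ᵐ x ∂μ, ‖g i x‖ ≤ D.indicator (fun _ => C) x)
    (hlim : ∀ᵐ x ∂μ, Tendsto (fun i => g i x) l (𝓝 0)) :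
    Tendsto (fun i => eLpNorm (g i) 2 μ) l (𝓝 0) :=
  tendsto_eLpNorm_two_zero_of_dominated hg (memLp_indicator_const 2 hD C (Or.inr hμ)).2.ne hb hlim

variable (D : Set E3)

/-- Extension by zero. -/
def extFun (c : C(D, V)) : E3 → V := Function.extend Subtype.val c 0

variable {D}

theorem extFun_of_mem (c : C(D, V)) {x : E3} (hx : x ∈ D) : extFun D c x = c ⟨x, hx⟩ :=
  Subtype.val_injective.extend_apply c 0 (⟨x, hx⟩ : D)

theorem extFun_of_notMem (c : C(D, V)) {x : E3} (hx : x ∉ D) : extFun D c x = 0 :=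
  Function.extend_apply' _ _ _ fun ⟨y, hy⟩ => hx (hy ▸ y.2)

theorem stronglyMeasurable_extFun (hD : MeasurableSet D) (c : C(D, V)) :
    StronglyMeasurable (extFun D c) :=
  (MeasurableEmbedding.subtype_coe hD).stronglyMeasurable_extend c.continuous.stronglyMeasurable
    stronglyMeasurable_zero

variable (Ω : Set E3) (p : ℝ≥0∞)

theorem measure_lt_top_of_compactSpace [CompactSpace D] : volume.restrict Ω D < ⊤ :=
  (Measure.restrict_apply_le _ _).trans_lt (isCompact_iff_compactSpace.2 ‹_›).measure_lt_top

theorem eLpNorm_extFun_le [CompactSpace D] (c : C(D, V)) :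
    eLpNorm (extFun D c) p (volume.restrict Ω)
      ≤ volume.restrict Ω D ^ p.toReal⁻¹ * ENNReal.ofReal ‖c‖ := by
  have hD : MeasurableSet D := (isCompact_iff_compactSpace.2 ‹_›).measurableSet
  have h1 : extFun D c = D.indicator (extFun D c) := by
    funext x
    by_cases hx : x ∈ D
    · rw [indicator_of_mem hx]
    · rw [indicator_of_notMem hx, extFun_of_notMem c hx]
  rw [h1, eLpNorm_indicator_eq_eLpNorm_restrict hD]
  refine (eLpNorm_le_of_ae_bound (C := ‖c‖) ?_).trans ?_
  · filter_upwards [ae_restrict_mem hD] with x hx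
    rw [extFun_of_mem c hx]
    exact c.norm_coe_le_norm _
  · rw [Measure.restrict_apply_univ]

theorem memLp_extFun [CompactSpace D] (c : C(D, V)) :
    MemLp (extFun D c) p (volume.restrict Ω) := by
  have hD : MeasurableSet D := (isCompact_iff_compactSpace.2 ‹_›).measurableSet
  refine ⟨(stronglyMeasurable_extFun hD c).aestronglyMeasurable, ?_⟩
  refine (eLpNorm_extFun_le Ω p c).trans_lt (ENNReal.mul_lt_top ?_ ENNReal.ofReal_lt_top)
  exact ENNReal.rpow_lt_top_of_nonneg (by simp) (measure_lt_top_of_compactSpace Ω).ne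

/-- Restriction of a continuous map. -/
def restr (D : Set E3) (g : E3 → V) (hg : Continuous g) : C(D, V) :=
  ⟨fun x => g x, hg.comp continuous_subtype_val⟩

/-- A jointly continuous function defines a continuous curve. -/
theorem continuous_restr {g : ℝ → E3 → V}
    (hg : Continuous fun q : ℝ × E3 => g q.1 q.2) :
    Continuous fun t => restr D (g t) (hg.comp (Continuous.prodMk_right t)) := by
  let G : C(ℝ × D, V) := ⟨fun q => g q.1 q.2, hg.comp
    (continuous_fst.prodMk (continuous_subtype_val.comp continuous_snd))⟩
  exact G.curry.continuous

variable [NormedSpace ℝ V]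

/-- Extension by zero, as a map into a Lebesgue space. -/
def extLp [CompactSpace D] [Fact (1 ≤ p)] : C(D, V) →L[ℝ] Lp V p (volume.restrict Ω) :=
  LinearMap.mkContinuous
    { toFun := fun c => (memLp_extFun Ω p c).toLp _
      map_add' := fun c d => by
        rw [← MemLp.toLp_add]
        congr 1
        funext x
        by_cases hx : x ∈ D
        · simp [extFun_of_mem _ hx]
        · simp [extFun_of_notMem _ hx]
      map_smul' := fun a c => by
        rw [RingHom.id_apply, ← MemLp.toLp_const_smul]
        congr 1
        funext x
        by_cases hx : x ∈ D
        · simp [extFun_of_mem _ hx]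
        · simp [extFun_of_notMem _ hx] }
    (volume.restrict Ω D ^ p.toReal⁻¹).toReal
    (fun c => by
      have h := eLpNorm_extFun_le Ω p c
      have hne : volume.restrict Ω D ^ p.toReal⁻¹ ≠ ⊤ :=
        (ENNReal.rpow_lt_top_of_nonneg (by simp) (measure_lt_top_of_compactSpace Ω).ne).ne
      rw [LinearMap.coe_mk, AddHom.coe_mk, Lp.norm_toLp,
        ← ENNReal.toReal_ofReal (norm_nonneg c), ← ENNReal.toReal_mul]
      exact ENNReal.toReal_mono (ENNReal.mul_ne_top hne ENNReal.ofReal_ne_top) h)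

/-- Restriction to `D` followed by extension by zero. -/
def cutLp (D : Set E3) [CompactSpace D] [Fact (1 ≤ p)] (g : E3 → V) (hg : Continuous g) :
    Lp V p (volume.restrict Ω) := extLp Ω p (restr D g hg)

variable {Ω p}

theorem cutLp_ae_eq [CompactSpace D] [Fact (1 ≤ p)] {g : E3 → V} (hg : Continuous g)
    (hΩ : MeasurableSet Ω) (h0 : ∀ x ∈ Ω, x ∉ D → g x = 0) :
    cutLp Ω p D g hg =ᵐ[volume.restrict Ω] g := by
  have h1 : cutLp Ω p D g hg =ᵐ[volume.restrict Ω] extFun D (restr D g hg) :=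
    (memLp_extFun Ω p (restr D g hg)).coeFn_toLp
  filter_upwards [h1, ae_restrict_mem hΩ] with x hx hxΩ
  rw [hx]
  by_cases hxD : x ∈ D
  · rw [extFun_of_mem _ hxD]; rfl
  · rw [extFun_of_notMem _ hxD, h0 x hxΩ hxD]

theorem norm_cutLp_top_le [CompactSpace D] {g : E3 → V} (hg : Continuous g) {C : ℝ} (hC : 0 ≤ C)
    (hb : ∀ x ∈ D, ‖g x‖ ≤ C) : ‖cutLp Ω ⊤ D g hg‖ ≤ C := by
  have h := eLpNorm_extFun_le Ω ⊤ (restr D g hg)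
  have h2 : ‖restr D g hg‖ ≤ C := (ContinuousMap.norm_le _ hC).2 fun x => hb x x.2
  have h3 : ‖cutLp Ω ⊤ D g hg‖ = (eLpNorm (extFun D (restr D g hg)) ⊤ (volume.restrict Ω)).toReal :=
    Lp.norm_toLp _ (memLp_extFun Ω ⊤ (restr D g hg))
  rw [h3]
  refine ENNReal.toReal_le_of_le_ofReal hC (h.trans ?_)
  simpa using ENNReal.ofReal_le_ofReal h2

/-- Fundamental theorem of calculus in the Banach space `C(D, V)`: evaluation at a point commutes
with the integral, so the curve is a primitive of the continuous curve of time derivatives. -/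
theorem hasDerivAt_restr [CompactSpace D] [CompleteSpace V] {g g' : ℝ → E3 → V}
    (hg : Continuous fun q : ℝ × E3 => g q.1 q.2)
    (hg' : Continuous fun q : ℝ × E3 => g' q.1 q.2)
    (hd : ∀ t x, HasDerivAt (fun s => g s x) (g' t x) t) (t : ℝ) :
    HasDerivAt (fun t => restr D (g t) (hg.comp (Continuous.prodMk_right t)))
      (restr D (g' t) (hg'.comp (Continuous.prodMk_right t))) t := by
  have hc := continuous_restr (D := D) hg'
  have key : (fun t => restr D (g t) (hg.comp (Continuous.prodMk_right t))) = fun t =>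
      restr D (g 0) (hg.comp (Continuous.prodMk_right 0))
        + ∫ s in (0 : ℝ)..t, restr D (g' s) (hg'.comp (Continuous.prodMk_right s)) := by
    funext t
    ext x
    have h1 : (∫ s in (0 : ℝ)..t, restr D (g' s) (hg'.comp (Continuous.prodMk_right s))) x
        = ∫ s in (0 : ℝ)..t, g' s x := by
      have := (ContinuousMap.evalCLM ℝ x : C(D, V) →L[ℝ] V).intervalIntegral_comp_comm
        (hc.intervalIntegrable (μ := volume) 0 t)
      exact this.symm
    rw [ContinuousMap.add_apply, h1]
    have h2 : Continuous fun s => g' s x := hg'.comp (Continuous.prodMk_left (x : E3))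
    rw [intervalIntegral.integral_eq_sub_of_hasDerivAt (fun s _ => hd s x)
      (h2.intervalIntegrable 0 t)]
    simp [restr]
  rw [key]
  exact (intervalIntegral.integral_hasDerivAt_right (hc.intervalIntegrable 0 t)
    (hc.stronglyMeasurableAtFilter _ _) hc.continuousAt).const_add _

theorem continuous_cutLp [CompactSpace D] [Fact (1 ≤ p)] {g : ℝ → E3 → V}
    (hg : Continuous fun q : ℝ × E3 => g q.1 q.2) :
    Continuous fun t => cutLp Ω p D (g t) (hg.comp (Continuous.prodMk_right t)) :=
  (extLp Ω p).continuous.comp (continuous_restr hg)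

theorem hasDerivAt_cutLp [CompactSpace D] [Fact (1 ≤ p)] [CompleteSpace V] {g g' : ℝ → E3 → V}
    (hg : Continuous fun q : ℝ × E3 => g q.1 q.2)
    (hg' : Continuous fun q : ℝ × E3 => g' q.1 q.2)
    (hd : ∀ t x, HasDerivAt (fun s => g s x) (g' t x) t) (t : ℝ) :
    HasDerivAt (fun t => cutLp Ω p D (g t) (hg.comp (Continuous.prodMk_right t)))
      (cutLp Ω p D (g' t) (hg'.comp (Continuous.prodMk_right t))) t := by
  have h := hasDerivAt_restr (D := D) hg hg' hd t
  exact (extLp (V := V) (D := D) Ω p).hasFDerivAt.comp_hasDerivAt t h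

/-- Integration by parts against a test function. -/
theorem setIntegral_bilinear_partialD {W F G : Type*} [NormedAddCommGroup W] [NormedSpace ℝ W]
    [NormedAddCommGroup F] [NormedSpace ℝ F] [NormedAddCommGroup G] [NormedSpace ℝ G]
    (T : F →L[ℝ] G →L[ℝ] W) {f : E3 → F} (hf : ContDiff ℝ 1 f) {ψ : E3 → G}
    (hψ : IsTest Ω ψ) (j : Fin 3) :
    ∫ x in Ω, T (f x) (partialD j ψ x) = -∫ x in Ω, T (partialD j f x) (ψ x) := by
  have hoff : ∀ x, x ∉ Ω → ψ x = 0 := fun x hx => by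
    by_contra h
    exact hx (hψ.support (subset_tsupport _ h))
  have hoff' : ∀ x, x ∉ Ω → partialD j ψ x = 0 := fun x hx => by
    have : x ∉ tsupport ψ := fun h => hx (hψ.support h)
    unfold partialD
    rw [fderiv_of_notMem_tsupport ℝ this]; rfl
  rw [setIntegral_eq_integral_of_forall_compl_eq_zero (fun x hx => by simp [hoff' x hx]),
    setIntegral_eq_integral_of_forall_compl_eq_zero (fun x hx => by simp [hoff x hx])]
  have cf : Continuous f := hf.continuous
  have cψ : Continuous ψ := hψ.smooth.continuous
  have cf' : Continuous (partialD j f) :=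
    (hf.continuous_fderiv (by simp)).clm_apply continuous_const
  have cψ' : Continuous (partialD j ψ) := (contDiff_partialD hψ.smooth j).continuous
  have sψ' : HasCompactSupport (partialD j ψ) := by
    refine (hψ.compact.fderiv (𝕜 := ℝ)).comp_left (g := fun L => L (bas j)) rfl
  refine integral_bilinear_fderiv_right_eq_neg_left_of_integrable (B := T) ?_ ?_ ?_
    (fun x _ => hf.differentiable (by simp) x) (fun x _ => contDiff_diff hψ.smooth x)
  · refine Continuous.integrable_of_hasCompactSupport
      ((T.continuous.comp cf').clm_apply cψ) ?_
    exact hψ.compact.mono fun x hx h => hx (by simp [h])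
  · refine Continuous.integrable_of_hasCompactSupport
      ((T.continuous.comp cf).clm_apply cψ') ?_
    exact sψ'.mono fun x hx h => hx (by
      change T (f x) (partialD j ψ x) = 0
      simp [h])
  · refine Continuous.integrable_of_hasCompactSupport
      ((T.continuous.comp cf).clm_apply cψ) ?_
    exact hψ.compact.mono fun x hx h => hx (by simp [h])

end LebesgueCurves

/-! ### Fields which vanish on the boundary -/

section Vanishing

variable {V : Type*} [NormedAddCommGroup V] [NormedSpace ℝ V]

theorem exists_vertical_lipschitz {G : E3 → V} (hG : ContDiff ℝ ∞ G) {D : Set E3}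
    (hD : IsCompact D) : ∃ C, 0 ≤ C ∧ ∀ (x : E3) (z : ℝ), (∀ s ∈ uIcc z (x 2), pt (hor x) s ∈ D) →
      G (pt (hor x) z) = 0 → ‖G x‖ ≤ C * |x 2 - z| := by
  obtain ⟨C, hC⟩ := hD.exists_bound_of_continuousOn (contDiff_partialD hG 2).continuous.continuousOn
  refine ⟨|C|, abs_nonneg C, fun x z hs h0 => ?_⟩
  have := (convex_uIcc z (x 2)).norm_image_sub_le_of_norm_hasDerivWithin_le
    (f := fun s => G (pt (hor x) s)) (f' := fun s => partialD 2 G (pt (hor x) s)) (C := |C|)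
    (fun s _ => (hasDerivAt_vertical hG (hor x) s).hasDerivWithinAt)
    (fun s hs' => (hC _ (hs s hs')).trans (le_abs_self C)) left_mem_uIcc right_mem_uIcc
  simpa [h0] using this

theorem deriv_smoothTransition_of_one_lt {u : ℝ} (hu : 1 < u) :
    deriv Real.smoothTransition u = 0 := by
  have : Real.smoothTransition =ᶠ[𝓝 u] fun _ => 1 := by
    filter_upwards [lt_mem_nhds hu] with v hv using Real.smoothTransition.one_of_one_le hv.le
  rw [this.deriv_eq, deriv_const]

theorem deriv_smoothTransition_of_neg {u : ℝ} (hu : u < 0) :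
    deriv Real.smoothTransition u = 0 := by
  have : Real.smoothTransition =ᶠ[𝓝 u] fun _ => 0 := by
    filter_upwards [gt_mem_nhds hu] with v hv using Real.smoothTransition.zero_of_nonpos hv.le
  rw [this.deriv_eq, deriv_const]

theorem contDiff_deriv_smoothTransition : ContDiff ℝ ∞ (deriv Real.smoothTransition) :=
  (contDiff_infty_iff_deriv.1 Real.smoothTransition.contDiff).2

/-- In the cutoffs below, `u + 1 = (m + 1) d`: the weight records the product of `d` with the
derivative of the cutoff. -/
theorem exists_bound_deriv_smoothTransition :
    ∃ L, 0 ≤ L ∧ ∀ u, |(u + 1) * deriv Real.smoothTransition u| ≤ L := by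
  obtain ⟨L, hL⟩ := (isCompact_Icc (a := (0 : ℝ)) (b := 1)).exists_bound_of_continuousOn
    (f := fun u => (u + 1) * deriv Real.smoothTransition u)
    ((continuous_id.add continuous_const).mul
      contDiff_deriv_smoothTransition.continuous).continuousOn
  refine ⟨|L|, abs_nonneg L, fun u => ?_⟩
  rcases lt_or_ge u 0 with h | h
  · simp [deriv_smoothTransition_of_neg h]
  rcases lt_or_ge 1 u with h' | h'
  · simp [deriv_smoothTransition_of_one_lt h']
  exact (hL u ⟨h, h'⟩).trans (le_abs_self L)

/-- A cutoff of the set `d ≤ 1 / m`. -/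
def cutoff (d : E3 → ℝ) (m : ℕ) (x : E3) : ℝ := Real.smoothTransition ((m + 1 : ℝ) * d x - 1)

variable {d : E3 → ℝ}

theorem contDiff_cutoff (hd : ContDiff ℝ ∞ d) (m : ℕ) : ContDiff ℝ ∞ (cutoff d m) :=
  Real.smoothTransition.contDiff.comp ((contDiff_const.mul hd).sub contDiff_const)

theorem cutoff_mem (m : ℕ) (x : E3) : 0 ≤ cutoff d m x ∧ cutoff d m x ≤ 1 :=
  ⟨Real.smoothTransition.nonneg _, Real.smoothTransition.le_one _⟩

theorem partialD_cutoff (hd : ContDiff ℝ ∞ d) (m : ℕ) (j : Fin 3) (x : E3) :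
    partialD j (cutoff d m) x
      = deriv Real.smoothTransition ((m + 1 : ℝ) * d x - 1) * ((m + 1) * partialD j d x) := by
  have h1 : ContDiff ℝ ∞ fun x => (m + 1 : ℝ) * d x := contDiff_const.mul hd
  have h2 : ContDiff ℝ ∞ fun x => (m + 1 : ℝ) * d x - 1 := h1.sub contDiff_const
  have h3 : cutoff d m = fun x => Real.smoothTransition ((m + 1 : ℝ) * d x - 1) := rfl
  have h4 : partialD j (fun x => (m + 1 : ℝ) * d x) x = (m + 1) * partialD j d x :=
    partialD_const_smul (m + 1 : ℝ) hd j x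
  rw [h3, partialD_comp h2 j x
    (contDiff_diff Real.smoothTransition.contDiff _).hasDerivAt, partialD_sub h1 contDiff_const,
    partialD_const, sub_zero, h4]

theorem eventually_cutoff {x : E3} (hx : 0 < d x) :
    ∀ᶠ m : ℕ in atTop, 1 < (m + 1 : ℝ) * d x - 1 := by
  obtain ⟨N, hN⟩ := exists_nat_gt (2 / d x)
  filter_upwards [eventually_ge_atTop N] with m hm
  have h1 : (N : ℝ) ≤ m := by exact_mod_cast hm
  have h2 : 2 / d x < (m + 1 : ℝ) := by linarith
  rw [div_lt_iff₀ hx] at h2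
  linarith

theorem cutoff_eq_zero {m : ℕ} {x : E3} (hx : (m + 1 : ℝ) * d x ≤ 1) : cutoff d m x = 0 :=
  Real.smoothTransition.zero_of_nonpos (by linarith)

/-- The derivative of the cutoff is of size `m`, but it lives where `d` is of size `1 / m`, and
there `G` is of size `1 / m` too. -/
theorem exists_bound_cutoff_smul {G : E3 → V} {D : Set E3} (hD : IsCompact D)
    (hd : ContDiff ℝ ∞ d) {C : ℝ} (hC : 0 ≤ C) (h : ∀ x ∈ D, 0 ≤ d x ∧ ‖G x‖ ≤ C * d x)
    (j : Fin 3) : ∃ M, 0 ≤ M ∧ ∀ m, ∀ x ∈ D, ‖partialD j (cutoff d m) x • G x‖ ≤ M := by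
  obtain ⟨L, hL0, hL⟩ := exists_bound_deriv_smoothTransition
  obtain ⟨A, hA⟩ := hD.exists_bound_of_continuousOn (contDiff_partialD hd j).continuous.continuousOn
  refine ⟨L * |A| * C, by positivity, fun m x hx => ?_⟩
  obtain ⟨h0, h1⟩ := h x hx
  rw [partialD_cutoff hd, norm_smul, norm_mul, norm_mul]
  set u := (m + 1 : ℝ) * d x - 1 with hu
  have h2 := hL u
  have h3 : u + 1 = (m + 1 : ℝ) * d x := by rw [hu]; ring
  rw [h3, abs_mul, abs_mul, abs_of_nonneg h0] at h2
  calc _ ≤ ‖deriv Real.smoothTransition u‖ * (‖(m + 1 : ℝ)‖ * |A|) * (C * d x) := by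
        gcongr
        exact (hA x hx).trans (le_abs_self A)
    _ = (|(m + 1 : ℝ)| * d x * |deriv Real.smoothTransition u|) * |A| * C := by
        simp only [Real.norm_eq_abs]; ring
    _ ≤ L * |A| * C := by gcongr

theorem tendsto_cutLp {Ω D : Set E3} [CompactSpace D] (hΩ : MeasurableSet Ω) {g : ℕ → E3 → V}
    {g₀ : E3 → V} (hg : ∀ m, Continuous (g m)) (hg₀ : Continuous g₀)
    (h0 : ∀ m, ∀ x ∈ Ω, x ∉ D → g m x = 0) (h0' : ∀ x ∈ Ω, x ∉ D → g₀ x = 0) {C : ℝ}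
    (hb : ∀ m, ∀ x ∈ D, ‖g m x‖ ≤ C) (hlim : ∀ x ∈ Ω, ∀ᶠ m in atTop, g m x = g₀ x) :
    Tendsto (fun m => cutLp Ω 2 D (g m) (hg m)) atTop (𝓝 (cutLp Ω 2 D g₀ hg₀)) := by
  have hD : IsCompact D := isCompact_iff_compactSpace.2 ‹_›
  rw [Lp.tendsto_Lp_iff_tendsto_eLpNorm']
  obtain ⟨C', hC'⟩ := hD.exists_bound_of_continuousOn hg₀.continuousOn
  have e : ∀ m, eLpNorm (⇑(cutLp Ω 2 D (g m) (hg m)) - ⇑(cutLp Ω 2 D g₀ hg₀)) 2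
      (volume.restrict Ω) = eLpNorm (fun x => g m x - g₀ x) 2 (volume.restrict Ω) := fun m =>
    eLpNorm_congr_ae ((cutLp_ae_eq (hg m) hΩ (h0 m)).sub (cutLp_ae_eq hg₀ hΩ h0'))
  simp only [e]
  refine tendsto_eLpNorm_two_zero (D := D) (C := C + C')
    (fun m => ((hg m).sub hg₀).aestronglyMeasurable) hD.measurableSet
    (measure_lt_top_of_compactSpace Ω).ne ?_ ?_
  · refine Eventually.of_forall fun m => ?_
    filter_upwards [ae_restrict_mem hΩ] with x hx
    by_cases hxD : x ∈ D
    · rw [indicator_of_mem hxD]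
      exact (norm_sub_le _ _).trans (add_le_add (hb m x hxD) (hC' x hxD))
    · rw [indicator_of_notMem hxD, h0 m x hx hxD, h0' x hx hxD]; simp
  · filter_upwards [ae_restrict_mem hΩ] with x hx
    refine tendsto_const_nhds.congr' ?_
    filter_upwards [hlim x hx] with m hm
    rw [hm, sub_self]

end Vanishing

/-! ### Smooth fields as elements of `H¹₀` and of `𝒱_σ` -/

namespace Basin

variable (B : Basin)

instance : CompactSpace B.D := isCompact_iff_compactSpace.1 B.compact_D

/-- The ocean `Ω` is the domain described by `B` over the set `K`. -/
structure Fits (Ω : Set E3) : Prop where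
  open_Ω : IsOpen Ω
  mem_iff : ∀ x, hor x ∈ B.K → (x ∈ Ω ↔ -B.φ (B.r x) < x 2 ∧ x 2 < 0)
  tail : ∃ b Rad : ℝ, (∀ s, b ≤ s → B.f s = 0) ∧ ∀ x ∈ Ω, Rad < ‖x‖ → b ≤ B.r x

variable {B} {Ω : Set E3}

theorem Fits.hor_notMem (hΩ : B.Fits Ω) {x : E3} (hx : x ∈ Ω) (hxD : x ∉ B.D) : hor x ∉ B.K :=
  fun h => hxD ⟨h, ((hΩ.mem_iff x h).1 hx).1.le, ((hΩ.mem_iff x h).1 hx).2.le⟩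

theorem Fits.measurableSet (hΩ : B.Fits Ω) : MeasurableSet Ω := hΩ.open_Ω.measurableSet

variable (B) in
/-- Smooth fields over `K` which vanish at the surface and at the bottom. -/
structure Admissible (G : E3 → E3) : Prop where
  smooth : ContDiff ℝ ∞ G
  off : ∀ x, hor x ∉ B.K → G x = 0
  top : ∀ x : E3, x 2 = 0 → G x = 0
  bot : ∀ x : E3, x 2 = -B.φ (B.r x) → G x = 0

variable {G : E3 → E3}

theorem Admissible.partialD_off (hG : B.Admissible G) (j : Fin 3) {x : E3} (hx : hor x ∉ B.K) :
    partialD j G x = 0 := partialD_eq_zero_of_hor B.closed_K hG.off j hx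

variable (Ω) in
/-- The element of `H¹` defined by a smooth field. -/
def pair (hG : B.Admissible G) : Pairs Ω :=
  (cutLp Ω 2 B.D G hG.smooth.continuous,
    fun j => cutLp Ω 2 B.D (partialD j G) (contDiff_partialD hG.smooth j).continuous)

theorem pair_fst_ae (hΩ : B.Fits Ω) (hG : B.Admissible G) :
    (pair Ω hG).1 =ᵐ[volume.restrict Ω] G :=
  cutLp_ae_eq _ hΩ.measurableSet fun x hx hxD => hG.off x (hΩ.hor_notMem hx hxD)

theorem pair_snd_ae (hΩ : B.Fits Ω) (hG : B.Admissible G) (j : Fin 3) :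
    (pair Ω hG).2 j =ᵐ[volume.restrict Ω] partialD j G :=
  cutLp_ae_eq _ hΩ.measurableSet fun _ hx hxD => hG.partialD_off j (hΩ.hor_notMem hx hxD)

variable (B) in
/-- The cutoff near the surface and the bottom. -/
def chi (m : ℕ) (x : E3) : ℝ :=
  cutoff (fun x => -x 2) m x * cutoff (fun x => x 2 + B.φ (B.r x)) m x

variable (B) in
theorem smooth_depth : ContDiff ℝ ∞ fun x : E3 => x 2 + B.φ (B.r x) :=
  (contDiff_crd 2).add (B.smooth_φ.comp B.smooth_r)

theorem smooth_negz : ContDiff ℝ ∞ fun x : E3 => -x 2 := (contDiff_crd 2).neg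

variable (B) in
theorem smooth_chi (m : ℕ) : ContDiff ℝ ∞ (B.chi m) :=
  (contDiff_cutoff smooth_negz m).mul (contDiff_cutoff B.smooth_depth m)

theorem admissible_chi (hG : B.Admissible G) (m : ℕ) :
    B.Admissible fun x => B.chi m x • G x where
  smooth := (B.smooth_chi m).smul hG.smooth
  off x hx := by simp [hG.off x hx]
  top x hx := by simp [hG.top x hx]
  bot x hx := by simp [hG.bot x hx]

/-- The support lies over `K`, at distance at least `1 / (m + 1)` from the surface and, vertically,
from the bottom. This set is compact and contained in the open ocean. -/
theorem isTest_chi (hΩ : B.Fits Ω) (hG : B.Admissible G) (m : ℕ) :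
    IsTest Ω fun x => B.chi m x • G x := by
  set Dm : Set E3 := {x | hor x ∈ B.K ∧ 1 ≤ (m + 1 : ℝ) * -x 2 ∧
    1 ≤ (m + 1 : ℝ) * (x 2 + B.φ (B.r x))} with hDm
  have hm : (0 : ℝ) < m + 1 := by positivity
  have hsub : ∀ x ∈ Dm, hor x ∈ B.K ∧ -B.φ (B.r x) < x 2 ∧ x 2 < 0 := by
    rintro x ⟨h1, h2, h3⟩
    have h4 : 0 < -x 2 := pos_of_mul_pos_right (by linarith) hm.le
    have h5 : 0 < x 2 + B.φ (B.r x) := pos_of_mul_pos_right (by linarith) hm.le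
    exact ⟨h1, by linarith, by linarith⟩
  have hclosed : IsClosed Dm :=
    (B.closed_K.preimage continuous_hor).inter (IsClosed.inter
      (isClosed_le continuous_const (continuous_const.mul smooth_negz.continuous))
      (isClosed_le continuous_const (continuous_const.mul B.smooth_depth.continuous)))
  have hcomp : IsCompact Dm := B.compact_D.of_isClosed_subset hclosed fun x hx =>
    ⟨(hsub x hx).1, (hsub x hx).2.1.le, (hsub x hx).2.2.le⟩
  have hsupp : Function.support (fun x => B.chi m x • G x) ⊆ Dm := by
    intro x hx
    by_contra h
    apply hx
    by_cases h1 : hor x ∈ B.K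
    · have h2 : B.chi m x = 0 := by
        by_cases h3 : 1 ≤ (m + 1 : ℝ) * -x 2
        · have h4 : ¬ 1 ≤ (m + 1 : ℝ) * (x 2 + B.φ (B.r x)) := fun h4 => h ⟨h1, h3, h4⟩
          rw [chi, cutoff_eq_zero (d := fun x => x 2 + B.φ (B.r x)) (not_le.1 h4).le, mul_zero]
        · rw [chi, cutoff_eq_zero (d := fun x : E3 => -x 2) (not_le.1 h3).le, zero_mul]
      simp [h2]
    · simp [hG.off x h1]
  have htsupp : tsupport (fun x => B.chi m x • G x) ⊆ Dm := closure_minimal hsupp hclosed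
  exact ⟨(B.smooth_chi m).smul hG.smooth, hcomp.of_isClosed_subset (isClosed_tsupport _) htsupp,
    htsupp.trans fun _ hx => (hΩ.mem_iff _ (hsub _ hx).1).2 (hsub _ hx).2⟩

/-- The test fields `χ_m G` converge to `G` in `H¹` by dominated convergence. At each point of `Ω`
they and their derivatives are eventually equal to those of `G`, and the term `∇χ_m G` is bounded
because `G` vanishes linearly at the surface and at the bottom. -/
theorem pair_mem_H10 (hΩ : B.Fits Ω) (hG : B.Admissible G) : pair Ω hG ∈ H10 Ω := by
  have hchi := fun m => admissible_chi hG m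
  have hmem : ∀ m, pair Ω (hchi m) ∈ Submodule.span ℝ {w : Pairs Ω | ∃ ψ : E3 → E3, IsTest Ω ψ ∧
      w.1 =ᵐ[volume.restrict Ω] ψ ∧ ∀ j, w.2 j =ᵐ[volume.restrict Ω] partialD j ψ} := fun m =>
    Submodule.subset_span ⟨_, isTest_chi hΩ hG m, pair_fst_ae hΩ (hchi m),
      fun j => pair_snd_ae hΩ (hchi m) j⟩
  refine mem_closure_of_tendsto (f := fun m => pair Ω (hchi m)) (b := atTop) ?_
    (Eventually.of_forall hmem)
  obtain ⟨C1, hC1, h1⟩ := exists_vertical_lipschitz hG.smooth B.compact_D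
  have b1 : ∀ x ∈ B.D, 0 ≤ -x 2 ∧ ‖G x‖ ≤ C1 * -x 2 := fun x hx => by
    have := h1 x 0 (B.segment_top hx) (hG.top _ (by simp))
    rw [sub_zero, abs_of_nonpos hx.2.2] at this
    exact ⟨by linarith [hx.2.2], this⟩
  have b2 : ∀ x ∈ B.D, 0 ≤ x 2 + B.φ (B.r x) ∧ ‖G x‖ ≤ C1 * (x 2 + B.φ (B.r x)) := fun x hx => by
    have := h1 x (-B.φ (B.r x)) (B.segment_bot hx) (hG.bot _ (by simp [r]))
    rw [sub_neg_eq_add, abs_of_nonneg (by linarith [hx.2.1])] at this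
    exact ⟨by linarith [hx.2.1], this⟩
  have hev : ∀ x ∈ Ω, hor x ∈ B.K → ∀ᶠ m : ℕ in atTop, 1 < (m + 1 : ℝ) * -x 2 - 1 ∧
      1 < (m + 1 : ℝ) * (x 2 + B.φ (B.r x)) - 1 := fun x hx hK => by
    have h := (hΩ.mem_iff x hK).1 hx
    exact (eventually_cutoff (d := fun x => -x 2) (by linarith)).and
      (eventually_cutoff (d := fun x => x 2 + B.φ (B.r x)) (by linarith))
  have chi_le : ∀ m x, |B.chi m x| ≤ 1 := fun m x => by
    have c1 := cutoff_mem (d := fun x => -x 2) m x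
    have c2 := cutoff_mem (d := fun x => x 2 + B.φ (B.r x)) m x
    rw [chi, abs_of_nonneg (mul_nonneg c1.1 c2.1)]
    exact mul_le_one₀ c1.2 c2.1 c2.2
  have chi_one : ∀ (m : ℕ) (x : E3), 1 < (m + 1 : ℝ) * -x 2 - 1 →
      1 < (m + 1 : ℝ) * (x 2 + B.φ (B.r x)) - 1 → B.chi m x = 1 := fun m x h h' => by
    rw [chi, cutoff, cutoff, Real.smoothTransition.one_of_one_le h.le,
      Real.smoothTransition.one_of_one_le h'.le, one_mul]
  refine Tendsto.prodMk_nhds ?_ (tendsto_pi_nhds.2 fun j => ?_)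
  · obtain ⟨M, hM⟩ := B.compact_D.exists_bound_of_continuousOn hG.smooth.continuous.continuousOn
    refine tendsto_cutLp hΩ.measurableSet (fun m => (hchi m).smooth.continuous)
      hG.smooth.continuous (fun m x hx hxD => (hchi m).off x (hΩ.hor_notMem hx hxD))
      (fun x hx hxD => hG.off x (hΩ.hor_notMem hx hxD)) (C := M) (fun m x hx => ?_)
      (fun x hx => ?_)
    · rw [norm_smul]
      exact (mul_le_of_le_one_left (norm_nonneg _) (chi_le m x)).trans (hM x hx)
    · by_cases hK : hor x ∈ B.K
      · filter_upwards [hev x hx hK] with m hm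
        rw [chi_one m x hm.1 hm.2, one_smul]
      · exact Eventually.of_forall fun m => by rw [hG.off x hK, smul_zero]
  · obtain ⟨M, hM⟩ := B.compact_D.exists_bound_of_continuousOn
      (contDiff_partialD hG.smooth j).continuous.continuousOn
    obtain ⟨M1, hM1, k1⟩ := exists_bound_cutoff_smul B.compact_D smooth_negz hC1 b1 j
    obtain ⟨M2, hM2, k2⟩ := exists_bound_cutoff_smul B.compact_D B.smooth_depth hC1 b2 j
    have hform : ∀ m x, partialD j (fun x => B.chi m x • G x) x
        = cutoff (fun x => x 2 + B.φ (B.r x)) m x •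
            partialD j (cutoff (fun x : E3 => -x 2) m) x • G x
          + cutoff (fun x : E3 => -x 2) m x •
            partialD j (cutoff (fun x => x 2 + B.φ (B.r x)) m) x • G x
          + B.chi m x • partialD j G x := by
      intro m x
      rw [partialD_smul (B.smooth_chi m) hG.smooth]
      have : partialD j (B.chi m) x = _ :=
        partialD_mul (contDiff_cutoff smooth_negz m) (contDiff_cutoff B.smooth_depth m) j x
      rw [this]
      module
    refine tendsto_cutLp hΩ.measurableSet
      (fun m => (contDiff_partialD (hchi m).smooth j).continuous)
      (contDiff_partialD hG.smooth j).continuous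
      (fun m x hx hxD => (hchi m).partialD_off j (hΩ.hor_notMem hx hxD))
      (fun x hx hxD => hG.partialD_off j (hΩ.hor_notMem hx hxD)) (C := M1 + M2 + M)
      (fun m x hx => ?_) (fun x hx => ?_)
    · rw [hform]
      refine norm_add_le_of_le (norm_add_le_of_le ?_ ?_) ?_
      · rw [norm_smul, Real.norm_of_nonneg (cutoff_mem _ _).1]
        exact (mul_le_of_le_one_left (norm_nonneg _) (cutoff_mem _ _).2).trans (k1 m x hx)
      · rw [norm_smul, Real.norm_of_nonneg (cutoff_mem _ _).1]
        exact (mul_le_of_le_one_left (norm_nonneg _) (cutoff_mem _ _).2).trans (k2 m x hx)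
      · rw [norm_smul]
        exact (mul_le_of_le_one_left (norm_nonneg _) (chi_le m x)).trans (hM x hx)
    · by_cases hK : hor x ∈ B.K
      · filter_upwards [hev x hx hK] with m hm
        rw [hform, chi_one m x hm.1 hm.2, partialD_cutoff smooth_negz,
          partialD_cutoff B.smooth_depth, deriv_smoothTransition_of_one_lt hm.1,
          deriv_smoothTransition_of_one_lt hm.2]
        simp
      · exact Eventually.of_forall fun m => by
          rw [(hchi m).partialD_off j hK, hG.partialD_off j hK]

/-- The element of `𝒱_σ` defined by a smooth divergence free field. -/
def mkV (hΩ : B.Fits Ω) (hG : B.Admissible G) (hdiv : ∀ x, divg G x = 0) : Vσ Ω :=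
  ⟨pair Ω hG, pair_mem_H10 hΩ hG, by
    have h : ∀ᵐ x ∂(volume.restrict Ω), ∀ j : Fin 3,
        ((pair Ω hG).2 j : E3 → E3) x = partialD j G x :=
      ae_all_iff.2 fun j => pair_snd_ae hΩ hG j
    filter_upwards [h] with x hx
    simp only [hx]
    exact hdiv x⟩

end Basin

/-! ### Time regularity and the weak formulation -/

section TimeDerivative

variable {V : Type*} [NormedAddCommGroup V] [NormedSpace ℝ V]

/-- The time derivative of a time-dependent field. -/
def dt (F : ℝ → E3 → V) (t : ℝ) (x : E3) : V := deriv (fun s => F s x) t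

variable {F : ℝ → E3 → V} (hF : ContDiff ℝ ∞ fun q : ℝ × E3 => F q.1 q.2)
include hF

theorem hasDerivAt_dt (t : ℝ) (x : E3) : HasDerivAt (fun s => F s x) (dt F t x) t := by
  have : ContDiff ℝ ∞ (fun s => F s x) := hF.comp (contDiff_id.prodMk contDiff_const)
  exact (contDiff_diff this t).hasDerivAt

theorem dt_eq (t : ℝ) (x : E3) :
    dt F t x = fderiv ℝ (fun q : ℝ × E3 => F q.1 q.2) (t, x) (1, 0) := by
  have h := ((contDiff_diff hF (t, x)).hasFDerivAt).comp_hasDerivAt t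
    ((hasDerivAt_id t).prodMk (hasDerivAt_const t x))
  exact h.deriv

theorem partialD_eq (j : Fin 3) (t : ℝ) (x : E3) :
    partialD j (F t) x = fderiv ℝ (fun q : ℝ × E3 => F q.1 q.2) (t, x) (0, bas j) := by
  have h := ((contDiff_diff hF (t, x)).hasFDerivAt).comp x
    ((hasFDerivAt_const t x).prodMk (hasFDerivAt_id x))
  have h' : fderiv ℝ (F t) x = _ := h.fderiv
  rw [partialD, h']
  simp

theorem contDiff_dt : ContDiff ℝ ∞ fun q : ℝ × E3 => dt F q.1 q.2 := by
  simp only [dt_eq hF]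
  exact (hF.fderiv_right (m := ∞) (by simp)).clm_apply contDiff_const

theorem contDiff_partialD_uncurry (j : Fin 3) :
    ContDiff ℝ ∞ fun q : ℝ × E3 => partialD j (F q.1) q.2 := by
  simp only [partialD_eq hF]
  exact (hF.fderiv_right (m := ∞) (by simp)).clm_apply contDiff_const

/-- Symmetry of second derivatives in space-time. It identifies the time derivative of the gradient
component of a pair with the gradient of the time derivative. -/
theorem partialD_dt (j : Fin 3) (t : ℝ) (x : E3) :
    partialD j (dt F t) x = dt (fun t x => partialD j (F t) x) t x := by
  have hd : DifferentiableAt ℝ (fderiv ℝ fun q : ℝ × E3 => F q.1 q.2) (t, x) :=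
    contDiff_diff (hF.fderiv_right (m := ∞) (by simp)) _
  have hsym : IsSymmSndFDerivAt ℝ (fun q : ℝ × E3 => F q.1 q.2) (t, x) :=
    (contDiff_infty.1 hF 2).contDiffAt.isSymmSndFDerivAt (by simp)
  rw [partialD_eq (contDiff_dt hF), dt_eq (contDiff_partialD_uncurry hF j)]
  simp only [dt_eq hF, partialD_eq hF, Prod.mk.eta]
  rw [fderiv_clm_apply hd (differentiableAt_const _), fderiv_clm_apply hd (differentiableAt_const _)]
  simpa using hsym.eq (0, bas j) (1, 0)

end TimeDerivative

namespace Basin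

variable {B : Basin} {Ω : Set E3} {F : ℝ → E3 → E3}

theorem admissible_dt (hF : ContDiff ℝ ∞ fun q : ℝ × E3 => F q.1 q.2)
    (ha : ∀ t, B.Admissible (F t)) (t : ℝ) : B.Admissible (dt F t) where
  smooth := contDiff_slice (contDiff_dt hF) t
  off x hx := by simp [dt, fun s => (ha s).off x hx]
  top x hx := by simp [dt, fun s => (ha s).top x hx]
  bot x hx := by simp [dt, fun s => (ha s).bot x hx]

theorem divg_dt (hF : ContDiff ℝ ∞ fun q : ℝ × E3 => F q.1 q.2)
    (hd : ∀ t x, divg (F t) x = 0) (t : ℝ) (x : E3) : divg (dt F t) x = 0 := by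
  simp only [divg, partialD_dt hF]
  have h : ∀ j : Fin 3, HasDerivAt (fun s => partialD j (F s) x j)
      (dt (fun t x => partialD j (F t) x) t x j) t := fun j =>
    (crd j).hasFDerivAt.comp_hasDerivAt t (hasDerivAt_dt (contDiff_partialD_uncurry hF j) t x)
  have h2 := HasDerivAt.fun_sum (u := Finset.univ) fun j _ => h j
  have h3 : (fun s => ∑ j : Fin 3, partialD j (F s) x j) = fun _ => 0 := by
    funext s; exact hd s x
  rw [h3] at h2
  exact h2.unique (hasDerivAt_const _ _)

theorem hasDerivAt_mkV (hΩ : B.Fits Ω) (hF : ContDiff ℝ ∞ fun q : ℝ × E3 => F q.1 q.2)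
    (ha : ∀ t, B.Admissible (F t)) (hd : ∀ t x, divg (F t) x = 0) (t : ℝ) :
    HasDerivAt (fun t => mkV hΩ (ha t) (hd t))
      (mkV hΩ (admissible_dt hF ha t) (divg_dt hF hd t)) t := by
  have h1 : HasDerivAt (fun t => pair Ω (ha t)) (pair Ω (admissible_dt hF ha t)) t := by
    refine (hasDerivAt_cutLp hF.continuous (contDiff_dt hF).continuous
      (hasDerivAt_dt hF) t).prodMk (hasDerivAt_pi.2 fun j => ?_)
    have hj := contDiff_partialD_uncurry hF j
    have h2 := hasDerivAt_cutLp (Ω := Ω) (p := 2) (D := B.D) hj.continuous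
      (contDiff_dt hj).continuous
      (hasDerivAt_dt (F := fun t x => partialD j (F t) x) hj) t
    refine h2.congr_deriv ?_
    congr 1
    funext x
    exact (partialD_dt hF j t x).symm
  -- The norm of `𝒱_σ` is the restriction of the norm of pairs, so the two difference quotients have
  -- the same norm.
  rw [hasDerivAt_iff_tendsto] at h1 ⊢
  exact h1

theorem continuous_mkV (hΩ : B.Fits Ω) (hF : ContDiff ℝ ∞ fun q : ℝ × E3 => F q.1 q.2)
    (ha : ∀ t, B.Admissible (F t)) (hd : ∀ t x, divg (F t) x = 0) :
    Continuous fun t => mkV hΩ (ha t) (hd t) :=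
  continuous_iff_continuousAt.2 fun t => (hasDerivAt_mkV hΩ hF ha hd t).continuousAt

theorem contDiff_mkV (hΩ : B.Fits Ω) (hF : ContDiff ℝ ∞ fun q : ℝ × E3 => F q.1 q.2)
    (ha : ∀ t, B.Admissible (F t)) (hd : ∀ t x, divg (F t) x = 0) :
    ContDiff ℝ 1 fun t => mkV hΩ (ha t) (hd t) := by
  rw [contDiff_one_iff_deriv]
  refine ⟨fun t => (hasDerivAt_mkV hΩ hF ha hd t).differentiableAt, ?_⟩
  have : deriv (fun t => mkV hΩ (ha t) (hd t))
      = fun t => mkV hΩ (admissible_dt hF ha t) (divg_dt hF hd t) :=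
    funext fun t => (hasDerivAt_mkV hΩ hF ha hd t).deriv
  rw [this]
  exact continuous_mkV hΩ (contDiff_dt hF) (admissible_dt hF ha) (divg_dt hF hd)

theorem velocity_mkV_ae {G : E3 → E3} (hΩ : B.Fits Ω) (hG : B.Admissible G)
    (hdiv : ∀ x, divg G x = 0) : velocity (mkV hΩ hG hdiv) =ᵐ[volume.restrict Ω] G :=
  pair_fst_ae hΩ hG

theorem grad_mkV_ae {G : E3 → E3} (hΩ : B.Fits Ω) (hG : B.Admissible G)
    (hdiv : ∀ x, divg G x = 0) (j : Fin 3) :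
    grad (mkV hΩ hG hdiv) j =ᵐ[volume.restrict Ω] partialD j G :=
  pair_snd_ae hΩ hG j

end Basin

theorem integrable_inner_test {Ω : Set E3} {g ψ : E3 → E3} (hg : Continuous g)
    (hψ : IsTest Ω ψ) : Integrable (fun x => inner ℝ (g x) (ψ x)) (volume.restrict Ω) :=
  ((hg.inner hψ.smooth.continuous).integrable_of_hasCompactSupport
    (hψ.compact.mono fun x hx h => hx (by simp [h]))).integrableOn

/-- The weak formulation for classical solutions. -/
theorem weak_stokesCoriolis {Ω : Set E3} {β ε : ℝ} {F : ℝ → E3 → E3}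
    (hF : ContDiff ℝ ∞ fun q : ℝ × E3 => F q.1 q.2) {p : E3 → ℝ} (hp : ContDiff ℝ 1 p) (t : ℝ)
    {ψ : E3 → E3} (hψ : IsTest Ω ψ) :
    (∫ x in Ω, inner ℝ (dt F t x) (ψ x))
      + ε * β * (∑ j : Fin 3, ∫ x in Ω, inner ℝ (partialD j (F t) x) (partialD j ψ x))
      + 1 / ε * (∫ x in Ω, inner ℝ (ezL (F t x)) (ψ x))
    = 1 / ε * (∫ x in Ω, p x * ∑ j : Fin 3, partialD j ψ x j)
      + ∫ x in Ω, inner ℝ (res β ε F t x + ε⁻¹ • grd p x) (ψ x) := by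
  have hFt : ContDiff ℝ ∞ (F t) := contDiff_slice hF t
  have cdt : Continuous (dt F t) := (contDiff_slice (contDiff_dt hF) t).continuous
  have clap : Continuous (lap (F t)) := (contDiff_lap hFt).continuous
  have cez : Continuous fun x => ezL (F t x) := ezL.continuous.comp hFt.continuous
  have cpj : ∀ j, Continuous (partialD j p) := fun j =>
    (hp.continuous_fderiv (by simp)).clm_apply continuous_const
  have cgrd : Continuous (grd p) := by
    refine (PiLp.continuous_toLp 2 _).comp (continuous_pi fun i => ?_)
    fin_cases i <;> simp <;> exact cpj _
  have i1 : ∀ j : Fin 3, ∫ x in Ω, inner ℝ (partialD j (F t) x) (partialD j ψ x)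
      = -∫ x in Ω, inner ℝ (partialD j (partialD j (F t)) x) (ψ x) := fun j =>
    setIntegral_bilinear_partialD (innerSL ℝ)
      ((contDiff_partialD hFt j).of_le (by exact_mod_cast le_top)) hψ j
  have i2 : ∀ j : Fin 3, ∫ x in Ω, p x * partialD j ψ x j
      = -∫ x in Ω, partialD j p x * ψ x j := fun j =>
    setIntegral_bilinear_partialD ((1 : ℝ →L[ℝ] ℝ).smulRight (crd j)) hp hψ j
  have intg : ∀ {h : E3 → ℝ} {k : Fin 3 → E3 → ℝ} (j : Fin 3), Continuous h →
      (Continuous (k j)) → HasCompactSupport (k j) →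
      Integrable (fun x => h x * k j x) (volume.restrict Ω) := fun j hh hk hc =>
    ((hh.mul hk).integrable_of_hasCompactSupport hc.mul_left).integrableOn
  have s1 : ∀ j, HasCompactSupport fun x => ψ x j := fun j =>
    hψ.compact.comp_left (g := fun v : E3 => v j) rfl
  have s2 : ∀ j, HasCompactSupport fun x => partialD j ψ x j := fun j =>
    (hψ.compact.fderiv (𝕜 := ℝ)).comp_left (g := fun L : E3 →L[ℝ] E3 => L (bas j) j) rfl
  have c1 : ∀ j, Continuous fun x => ψ x j := fun j =>
    (crd j).continuous.comp hψ.smooth.continuous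
  have c2 : ∀ j, Continuous fun x => partialD j ψ x j := fun j =>
    (crd j).continuous.comp (contDiff_partialD hψ.smooth j).continuous
  have e3 : ∫ x in Ω, p x * ∑ j : Fin 3, partialD j ψ x j
      = -∫ x in Ω, inner ℝ (grd p x) (ψ x) := by
    have h1 : ∀ x, inner ℝ (grd p x) (ψ x) = ∑ j : Fin 3, partialD j p x * ψ x j := by
      intro x
      rw [PiLp.inner_apply]
      exact Finset.sum_congr rfl fun j _ => by rw [grd_apply]; simp [mul_comm]
    simp only [h1, Finset.mul_sum]
    rw [integral_finsetSum _ fun j _ =>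
        intg (k := fun j x => partialD j ψ x j) j hp.continuous (c2 j) (s2 j),
      integral_finsetSum _ fun j _ => intg (k := fun j x => ψ x j) j (cpj j) (c1 j) (s1 j),
      ← Finset.sum_neg_distrib]
    exact Finset.sum_congr rfl fun j _ => i2 j
  have e4 : ∑ j : Fin 3, ∫ x in Ω, inner ℝ (partialD j (F t) x) (partialD j ψ x)
      = -∫ x in Ω, inner ℝ (lap (F t) x) (ψ x) := by
    simp only [i1, lap, sum_inner]
    rw [integral_finsetSum _ fun j _ => integrable_inner_test
      (contDiff_partialD (contDiff_partialD hFt j) j).continuous hψ, Finset.sum_neg_distrib]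
  have j1 := integrable_inner_test cdt hψ
  have j2 := (integrable_inner_test clap hψ).const_mul (ε * β)
  have j3 := (integrable_inner_test cez hψ).const_mul ε⁻¹
  have j4 := (integrable_inner_test cgrd hψ).const_mul ε⁻¹
  have j12 : Integrable (fun x => inner ℝ (dt F t x) (ψ x)
      - ε * β * inner ℝ (lap (F t) x) (ψ x)) (volume.restrict Ω) := j1.sub j2
  have j123 : Integrable (fun x => inner ℝ (dt F t x) (ψ x)
      - ε * β * inner ℝ (lap (F t) x) (ψ x) + ε⁻¹ * inner ℝ (ezL (F t x)) (ψ x))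
      (volume.restrict Ω) := j12.add j3
  have e5 : ∫ x in Ω, inner ℝ (res β ε F t x + ε⁻¹ • grd p x) (ψ x)
      = (((∫ x in Ω, inner ℝ (dt F t x) (ψ x)) - ε * β * ∫ x in Ω, inner ℝ (lap (F t) x) (ψ x))
        + ε⁻¹ * ∫ x in Ω, inner ℝ (ezL (F t x)) (ψ x))
        + ε⁻¹ * ∫ x in Ω, inner ℝ (grd p x) (ψ x) := by
    rw [← integral_const_mul, ← integral_const_mul, ← integral_const_mul, ← integral_sub j1 j2,
      ← integral_add j12 j3, ← integral_add j123 j4]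
    refine integral_congr_ae (Eventually.of_forall fun x => ?_)
    simp only [res, inner_add_left, inner_sub_left, real_inner_smul_left]
    rfl
  rw [e3, e4, e5]
  ring

/-! ### The approximate solution for a given viscosity -/

theorem memLp_of_exp_bound {Z : Type*} [NormedAddCommGroup Z] [NormedSpace ℝ Z] {u : ℝ → Z}
    (hu : Continuous u) {c M : ℝ} (hc : 0 < c) (hM : 0 ≤ M)
    (hb : ∀ t, 0 ≤ t → ‖u t‖ ≤ M * Real.exp (-c * t)) :
    MemLp u 1 timeMeasure ∧ eLpNorm u 1 timeMeasure ≤ ENNReal.ofReal (M / c) := by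
  have hle : eLpNorm u 1 timeMeasure ≤ ENNReal.ofReal (M / c) := by
    have hi : IntegrableOn (fun t => M * Real.exp (-c * t)) (Ici 0) :=
      ((integrableOn_Ici_iff_integrableOn_Ioi (by simp)).2 (exp_neg_integrableOn_Ioi 0 hc)).const_mul M
    have hv : ∫ t in Ici (0 : ℝ), M * Real.exp (-c * t) = M / c := by
      rw [integral_Ici_eq_integral_Ioi, integral_const_mul, integral_exp_mul_Ioi (by linarith)]
      simp
      ring
    rw [eLpNorm_one_eq_lintegral_enorm, ← hv, ofReal_integral_eq_lintegral_ofReal hi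
      (Eventually.of_forall fun t => by positivity)]
    refine lintegral_mono_ae ?_
    filter_upwards [ae_restrict_mem measurableSet_Ici] with t ht
    rw [← ofReal_norm]
    exact ENNReal.ofReal_le_ofReal (hb t ht)
  exact ⟨⟨hu.aestronglyMeasurable, hle.trans_lt ENNReal.ofReal_lt_top⟩, hle⟩

theorem eLpNorm_le_mul_indicator {V : Type*} [NormedAddCommGroup V] {Ω D : Set E3}
    (hΩ : MeasurableSet Ω) {g : E3 → V} {h : E3 → ℝ} {a : ℝ} (ha : 0 ≤ a)
    (hb : ∀ x ∈ D, ‖g x‖ ≤ a * h x) (h0 : ∀ x ∈ Ω, x ∉ D → g x = 0) :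
    eLpNorm g 2 (volume.restrict Ω)
      ≤ ENNReal.ofReal a * eLpNorm (D.indicator h) 2 (volume.restrict Ω) := by
  have : ENNReal.ofReal a * eLpNorm (D.indicator h) 2 (volume.restrict Ω)
      = eLpNorm (a • D.indicator h) 2 (volume.restrict Ω) := by
    rw [eLpNorm_const_smul, ← ofReal_norm, Real.norm_of_nonneg ha]
  rw [this]
  refine eLpNorm_mono_ae ?_
  filter_upwards [ae_restrict_mem hΩ] with x hx
  by_cases hxD : x ∈ D
  · rw [Pi.smul_apply, indicator_of_mem hxD, smul_eq_mul]
    exact (hb x hxD).trans (le_abs_self _)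
  · rw [h0 x hx hxD, norm_zero]; exact norm_nonneg _

theorem locallyIntegrableOn_of_ae_eq {V : Type*} [NormedAddCommGroup V] {Ω : Set E3}
    {f g : E3 → V} (hg : Continuous g) (h : f =ᵐ[volume.restrict Ω] g) :
    LocallyIntegrableOn f Ω := by
  intro x _
  obtain ⟨s, hs, hi⟩ := (hg.locallyIntegrable (μ := volume)) x
  refine ⟨s ∩ Ω, inter_mem (mem_nhdsWithin_of_mem_nhds hs) self_mem_nhdsWithin, ?_⟩
  refine (hi.mono_set inter_subset_left).congr ?_
  have h' : f =ᵐ[volume.restrict (s ∩ Ω)] g :=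
    ae_restrict_of_ae_restrict_of_subset inter_subset_right h
  exact h'.symm

theorem continuous_slice {V : Type*} [NormedAddCommGroup V] {F : ℝ → E3 → V}
    (h : Continuous fun q : ℝ × E3 => F q.1 q.2) (t : ℝ) : Continuous (F t) :=
  h.comp (Continuous.prodMk_right t)

theorem hasWeakPartial_of_smooth {Ω : Set E3} {f g F : E3 → E3} (j : Fin 3)
    (hF : ContDiff ℝ ∞ F) (hf : f =ᵐ[volume.restrict Ω] F)
    (hg : g =ᵐ[volume.restrict Ω] partialD j F) : HasWeakPartial Ω j f g := by
  refine ⟨locallyIntegrableOn_of_ae_eq hF.continuous hf,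
    locallyIntegrableOn_of_ae_eq (contDiff_partialD hF j).continuous hg, fun ψ hψ => ?_⟩
  have h := setIntegral_bilinear_partialD (ContinuousLinearMap.lsmul ℝ ℝ : ℝ →L[ℝ] E3 →L[ℝ] E3).flip
    (hF.of_le (by exact_mod_cast le_top)) hψ j
  have e1 : ∫ x in Ω, partialD j ψ x • f x = ∫ x in Ω, partialD j ψ x • F x :=
    integral_congr_ae (by filter_upwards [hf] with x hx; rw [hx])
  have e2 : ∫ x in Ω, ψ x • g x = ∫ x in Ω, ψ x • partialD j F x :=
    integral_congr_ae (by filter_upwards [hg] with x hx; rw [hx])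
  rw [e1, e2]
  exact h

namespace Basin

variable {B : Basin} {Ω : Set E3}

variable (B) in
theorem admissible_F (ε t : ℝ) : B.Admissible (B.F ε t) where
  smooth := contDiff_slice (B.smooth_F ε) t
  off _ hx := B.F_eq_zero_off ε t hx
  top _ hx := B.F_top ε t hx
  bot _ hx := B.F_bot ε t hx

/-- The approximate velocity. -/
def Uapp (hΩ : B.Fits Ω) {ε : ℝ} (hε : ε ≠ 0) (t : ℝ) : Vσ Ω :=
  mkV hΩ (B.admissible_F ε t) (B.divg_F hε t)

variable (B) in
/-- The interior pressure as a function of the distance to the island. -/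
def Pint (b t s : ℝ) : ℝ := ∫ u in b..s, Real.exp (-t * B.lam u) * B.f u

variable (B) in
/-- The pressure. -/
def pres (b ε t : ℝ) (x : E3) : ℝ := B.Pint b t (B.r x) + ε * B.pB ε t x

variable (B) in
theorem smooth_pB (ε : ℝ) : ContDiff ℝ ∞ fun q : ℝ × E3 => B.pB ε q.1 q.2 :=
  B.contDiff_lay_uncurry ε B.smooth_SB (B.dec_qB.const_smul (-(1 / 2)))
    (B.dec_qB.const_smul (1 / 2))

variable (B) in
theorem continuous_integrand : Continuous fun q : ℝ × ℝ => Real.exp (-q.1 * B.lam q.2) * B.f q.2 := by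
  have h1 := B.smooth_lam.continuous
  have h2 := B.smooth_f.continuous
  fun_prop

variable (B) in
theorem hasDerivAt_Pint (b t s : ℝ) :
    HasDerivAt (B.Pint b t) (Real.exp (-t * B.lam s) * B.f s) s := by
  have h : Continuous fun u => Real.exp (-t * B.lam u) * B.f u :=
    B.continuous_integrand.comp (Continuous.prodMk_right t)
  exact intervalIntegral.integral_hasDerivAt_right (h.intervalIntegrable b s)
    (h.stronglyMeasurableAtFilter _ _) h.continuousAt

variable (B) in
theorem contDiff_pres (b ε t : ℝ) : ContDiff ℝ 1 (B.pres b ε t) := by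
  have h : ContDiff ℝ 1 (B.Pint b t) := by
    rw [contDiff_one_iff_deriv]
    refine ⟨fun s => (B.hasDerivAt_Pint b t s).differentiableAt, ?_⟩
    have : deriv (B.Pint b t) = fun s => Real.exp (-t * B.lam s) * B.f s :=
      funext fun s => (B.hasDerivAt_Pint b t s).deriv
    rw [this]
    exact B.continuous_integrand.comp (Continuous.prodMk_right t)
  have h2 : ContDiff ℝ ∞ (B.pB ε t) := contDiff_slice (B.smooth_pB ε) t
  exact (h.comp (B.smooth_r.of_le (by exact_mod_cast le_top))).add
    (contDiff_const.mul (h2.of_le (by exact_mod_cast le_top)))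

variable (B) in
theorem grd_pres (b ε t : ℝ) (x : E3) :
    grd (B.pres b ε t) x = B.A t x • B.nu x + ε • grd (B.pB ε t) x := by
  have h2 : ContDiff ℝ ∞ (B.pB ε t) := contDiff_slice (B.smooth_pB ε) t
  ext j
  have h1 := ((B.hasDerivAt_Pint b t (B.r x)).comp_hasFDerivAt x
    (contDiff_diff B.smooth_r x).hasFDerivAt).add
    ((contDiff_diff h2 x).hasFDerivAt.const_mul ε)
  have h3 : fderiv ℝ (B.pres b ε t) x = _ := h1.fderiv
  rw [grd_apply, partialD, h3]
  simp [A, nu, Λ, partialD]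

variable (B) in
theorem continuous_pres (b ε : ℝ) : Continuous fun q : ℝ × E3 => B.pres b ε q.1 q.2 := by
  have h0 : Continuous (Function.uncurry fun (q : ℝ × E3) (u : ℝ) =>
      Real.exp (-q.1 * B.lam u) * B.f u) :=
    B.continuous_integrand.comp
      ((continuous_fst.comp continuous_fst).prodMk continuous_snd)
  have h1 := intervalIntegral.continuous_parametric_intervalIntegral_of_continuous (μ := volume)
    (a₀ := b) h0 (B.smooth_r.continuous.comp continuous_snd)
  exact h1.add (continuous_const.mul (B.smooth_pB ε).continuous)

variable (B) in
-- The primitive is based at a point `b` beyond the support of `f`. The pressure therefore vanishes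
-- far away in the ocean, and this puts it in `L²`.
theorem pres_eq_zero {b : ℝ} (hb : ∀ s, b ≤ s → B.f s = 0) (ε t : ℝ) {x : E3} (hx : b ≤ B.r x) :
    B.pres b ε t x = 0 := by
  have h1 : B.Pint b t (B.r x) = 0 := by
    unfold Pint
    rw [intervalIntegral.integral_congr (g := fun _ => 0), intervalIntegral.integral_zero]
    intro u hu
    rw [uIcc_of_le hx] at hu
    simp [hb u hu.1]
  simp [pres, h1, pB, lay, qB, hb _ hx]

instance (Rad : ℝ) : CompactSpace (Metric.closedBall (0 : E3) Rad) :=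
  isCompact_iff_compactSpace.1 (isCompact_closedBall 0 Rad)

/-- The pressure as a curve in `L²`. -/
def papp (hΩ : B.Fits Ω) (ε t : ℝ) : Lp ℝ 2 (volume.restrict Ω) :=
  cutLp Ω 2 (Metric.closedBall (0 : E3) hΩ.tail.choose_spec.choose)
    (B.pres hΩ.tail.choose ε t) (continuous_slice (F := B.pres hΩ.tail.choose ε) (B.continuous_pres _ ε) t)

theorem contDiffOn_Uapp (hΩ : B.Fits Ω) {ε : ℝ} (hε : ε ≠ 0) :
    ContDiffOn ℝ 1 (Uapp hΩ hε) (Ici 0) :=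
  (contDiff_mkV hΩ (B.smooth_F ε) (B.admissible_F ε) (B.divg_F hε)).contDiffOn

theorem papp_ae (hΩ : B.Fits Ω) (ε t : ℝ) :
    papp hΩ ε t =ᵐ[volume.restrict Ω] B.pres hΩ.tail.choose ε t :=
  cutLp_ae_eq _ hΩ.measurableSet fun x hx hxD =>
    B.pres_eq_zero hΩ.tail.choose_spec.choose_spec.1 ε t
      (hΩ.tail.choose_spec.choose_spec.2 x hx (by simpa using hxD))

theorem memLp_papp (hΩ : B.Fits Ω) (ε T : ℝ) :
    MemLp (papp hΩ ε) 2 (volume.restrict (Icc 0 T)) := by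
  have hc : Continuous (papp hΩ ε) := continuous_cutLp (B.continuous_pres _ ε)
  obtain ⟨C, hC⟩ := (isCompact_Icc (a := (0 : ℝ)) (b := T)).exists_bound_of_continuousOn
    hc.continuousOn
  refine MemLp.of_bound hc.aestronglyMeasurable C ?_
  filter_upwards [ae_restrict_mem measurableSet_Icc] with t ht using hC t ht

variable (B) in
theorem continuous_E (ε : ℝ) : Continuous fun q : ℝ × E3 => B.E ε q.1 q.2 := by
  have hF := B.smooth_F ε
  have h1 : Continuous fun q : ℝ × E3 => dt (B.F ε) q.1 q.2 := (contDiff_dt hF).continuous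
  have h2 : Continuous fun q : ℝ × E3 => lap (B.F ε q.1) q.2 := by
    unfold lap
    exact continuous_finsetSum _ fun j _ => (contDiff_partialD_uncurry
      (F := fun t x => partialD j (B.F ε t) x) (contDiff_partialD_uncurry hF j) j).continuous
  have h3 : Continuous fun q : ℝ × E3 => ezL (B.F ε q.1 q.2) := ezL.continuous.comp hF.continuous
  have h4 : Continuous fun q : ℝ × E3 => B.A q.1 q.2 • B.nu q.2 := by
    have hΛ := B.smooth_Λ.continuous
    have hnu := B.smooth_nu.continuous
    have hf : Continuous fun x => B.f (B.r x) := (B.smooth_f.comp B.smooth_r).continuous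
    unfold A
    exact ((Real.continuous_exp.comp (continuous_fst.neg.mul (hΛ.comp continuous_snd))).mul
      (hf.comp continuous_snd)).smul (hnu.comp continuous_snd)
  have h5 : Continuous fun q : ℝ × E3 => grd (B.pB ε q.1) q.2 := by
    refine (PiLp.continuous_toLp 2 _).comp (continuous_pi fun i => ?_)
    have := fun j => (contDiff_partialD_uncurry (B.smooth_pB ε) j).continuous
    fin_cases i <;> simp <;> exact this _
  exact ((h1.sub (h2.const_smul (ε * B.β))).add (h3.const_smul ε⁻¹)).add
    (h4.const_smul ε⁻¹) |>.add h5

theorem E_eq_zero_off (ε t : ℝ) {x : E3} (hx : hor x ∉ B.K) : B.E ε t x = 0 := by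
  have h0 : ∀ x, hor x ∉ B.K → ∀ s, B.F ε s x = 0 := fun x hx s => B.F_eq_zero_off ε s hx
  have h1 : lap (B.F ε t) x = 0 := Finset.sum_eq_zero fun j _ =>
    partialD_eq_zero_of_hor B.closed_K (fun x hx =>
      partialD_eq_zero_of_hor B.closed_K (fun x hx => h0 x hx t) j hx) j hx
  have h2 : ∀ j, partialD j (B.pB ε t) x = 0 := fun j =>
    partialD_eq_zero_of_hor B.closed_K (fun x hx => by
      simp [pB, lay, B.dec_qB.eq_zero t hx]) j hx
  have h3 : grd (B.pB ε t) x = 0 := by ext j; simp [h2]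
  have h4 : B.A t x = 0 := by simp [A, B.f_r_eq_zero hx]
  simp [E, res, h0 x hx, h1, h3, h4]

variable (B Ω) in
/-- The remainder as a curve in `L²`. -/
def Eapp (ε t : ℝ) : L2 Ω :=
  cutLp Ω 2 B.D (B.E ε t) (continuous_slice (F := B.E ε) (B.continuous_E ε) t)

theorem Eapp_ae (hΩ : B.Fits Ω) (ε t : ℝ) : Eapp B Ω ε t =ᵐ[volume.restrict Ω] B.E ε t :=
  cutLp_ae_eq _ hΩ.measurableSet fun _ hx hxD => E_eq_zero_off ε t (hΩ.hor_notMem hx hxD)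

theorem solves (hΩ : B.Fits Ω) {ε : ℝ} (hε : ε ≠ 0) :
    SolvesStokesCoriolis Ω B.β ε (Uapp hΩ hε) (papp hΩ ε) (Eapp B Ω ε) := by
  refine (ae_restrict_iff' measurableSet_Ici).2 (Eventually.of_forall fun t ht ψ hψ => ?_)
  have hF := B.smooth_F ε
  have hadm := B.admissible_F ε
  have hd := B.divg_F hε
  have hU : derivWithin (Uapp hΩ hε) (Ici 0) t
      = mkV hΩ (admissible_dt hF hadm t) (divg_dt hF hd t) :=
    (hasDerivAt_mkV hΩ hF hadm hd t).hasDerivWithinAt.derivWithin (uniqueDiffOn_Ici 0 t ht)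
  have key := weak_stokesCoriolis (β := B.β) (ε := ε) hF
    (B.contDiff_pres hΩ.tail.choose ε t) t hψ
  have e1 : ∫ x in Ω, inner ℝ (velocity (derivWithin (Uapp hΩ hε) (Ici 0) t) x) (ψ x)
      = ∫ x in Ω, inner ℝ (dt (B.F ε) t x) (ψ x) := by
    rw [hU]
    refine integral_congr_ae ?_
    filter_upwards [velocity_mkV_ae hΩ (admissible_dt hF hadm t) (divg_dt hF hd t)] with x hx
    rw [hx]
  have e2 : ∀ j, ∫ x in Ω, inner ℝ (grad (Uapp hΩ hε t) j x) (partialD j ψ x)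
      = ∫ x in Ω, inner ℝ (partialD j (B.F ε t) x) (partialD j ψ x) := fun j => by
    refine integral_congr_ae ?_
    filter_upwards [grad_mkV_ae hΩ (hadm t) (hd t) j] with x hx
    rw [← hx]; rfl
  have e3 : ∫ x in Ω, inner ℝ (ezWedge (velocity (Uapp hΩ hε t) x)) (ψ x)
      = ∫ x in Ω, inner ℝ (ezL (B.F ε t x)) (ψ x) := by
    refine integral_congr_ae ?_
    filter_upwards [velocity_mkV_ae hΩ (hadm t) (hd t)] with x hx
    rw [ezL_apply, ← hx]; rfl
  have e4 : ∫ x in Ω, papp hΩ ε t x * ∑ j : Fin 3, partialD j ψ x j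
      = ∫ x in Ω, B.pres hΩ.tail.choose ε t x * ∑ j : Fin 3, partialD j ψ x j := by
    refine integral_congr_ae ?_
    filter_upwards [papp_ae hΩ ε t] with x hx
    rw [hx]
  have e5 : ∫ x in Ω, inner ℝ (Eapp B Ω ε t x) (ψ x)
      = ∫ x in Ω, inner ℝ (res B.β ε (B.F ε) t x
          + ε⁻¹ • grd (B.pres hΩ.tail.choose ε t) x) (ψ x) := by
    refine integral_congr_ae ?_
    filter_upwards [Eapp_ae hΩ ε t] with x hx
    rw [hx, E, grd_pres, smul_add, smul_smul ε⁻¹ ε, inv_mul_cancel₀ hε, one_smul, add_assoc]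
  rw [e1, e3, e4, e5, Finset.sum_congr rfl fun j _ => e2 j]
  exact key

variable (B Ω) in
/-- The gradient of the interior part, as a curve in `L^∞`. -/
def Gapp (ε t : ℝ) (j : Fin 3) : Lp E3 ⊤ (volume.restrict Ω) :=
  cutLp Ω ⊤ B.D (partialD j (B.Vint ε t))
    (continuous_slice (F := fun t => partialD j (B.Vint ε t))
      (contDiff_partialD_uncurry (B.smooth_Vint ε) j).continuous t)

theorem Gapp_weak (hΩ : B.Fits Ω) {ε : ℝ} (hε : ε ≠ 0) (t : ℝ) (j : Fin 3) :
    HasWeakPartial Ω j (fun x => velocity (Uapp hΩ hε t) x - B.UBL ε t x) (Gapp B Ω ε t j) := by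
  have hV : ContDiff ℝ ∞ (B.Vint ε t) := contDiff_slice (B.smooth_Vint ε) t
  refine hasWeakPartial_of_smooth j hV ?_ ?_
  · filter_upwards [velocity_mkV_ae hΩ (B.admissible_F ε t) (B.divg_F hε t)] with x hx
    rw [Uapp, hx, F]; abel
  · exact cutLp_ae_eq _ hΩ.measurableSet fun x hx hxD =>
      partialD_eq_zero_of_hor B.closed_K (fun x hx => B.Vint_eq_zero_off ε t hx) j
        (hΩ.hor_notMem hx hxD)

variable (B Ω) in
/-- The size of the remainders in `L²`. -/
def small (ε : ℝ) : ℝ≥0∞ :=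
  eLpNorm (B.D.indicator fun x => ε + B.bl ε x) 2 (volume.restrict Ω)

variable (B) in
theorem continuous_bl (ε : ℝ) : Continuous (B.bl ε) := by
  have h1 := B.smooth_depth.continuous
  have h2 := (smooth_negz).continuous
  unfold bl
  fun_prop

variable (B) in
theorem bl_le {ε : ℝ} (hε : 0 < ε) {x : E3} (hx : x ∈ B.D) : 0 ≤ B.bl ε x ∧ B.bl ε x ≤ 2 := by
  have hs := B.sM_pos
  refine ⟨by unfold bl; positivity, ?_⟩
  have h1 : 0 ≤ -x 2 := by linarith [hx.2.2]
  have h2 : 0 ≤ x 2 + B.φ (B.r x) := by linarith [hx.2.1]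
  have e1 : Real.exp (-(ε⁻¹ * (-x 2) / (2 * B.sM))) ≤ 1 :=
    Real.exp_le_one_iff.2 (neg_nonpos.2 (by positivity))
  have e2 : Real.exp (-(ε⁻¹ * (x 2 + B.φ (B.r x)) / (2 * B.sM))) ≤ 1 :=
    Real.exp_le_one_iff.2 (neg_nonpos.2 (by positivity))
  unfold bl
  linarith

/-- Dominated convergence over the compact set `D`: at a point of the open ocean both exponents tend
to `-∞`. -/
theorem tendsto_small (hΩ : B.Fits Ω) : Tendsto (small B Ω) (𝓝[>] 0) (𝓝 0) := by
  have hD := B.compact_D.measurableSet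
  have hs := B.sM_pos
  refine tendsto_eLpNorm_two_zero (D := B.D) (C := 3) (fun ε => ?_) hD
    (measure_lt_top_of_compactSpace Ω).ne ?_ ?_
  · exact ((continuous_const.add (B.continuous_bl ε)).stronglyMeasurable.indicator
      hD).aestronglyMeasurable
  · filter_upwards [Ioo_mem_nhdsGT (zero_lt_one' ℝ)] with ε hε
    refine Eventually.of_forall fun x => ?_
    by_cases hx : x ∈ B.D
    · simp only [indicator_of_mem hx]
      have := B.bl_le hε.1 hx
      rw [Real.norm_of_nonneg (by linarith [hε.1])]
      linarith [hε.2]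
    · simp [indicator_of_notMem hx]
  · filter_upwards [ae_restrict_mem hΩ.measurableSet] with x hx
    by_cases hxD : x ∈ B.D
    · simp only [indicator_of_mem hxD]
      have h := (hΩ.mem_iff x hxD.1).1 hx
      have hlim : ∀ a : ℝ, 0 < a → Tendsto (fun ε : ℝ => Real.exp (-(ε⁻¹ * a / (2 * B.sM))))
          (𝓝[>] 0) (𝓝 0) := by
        intro a ha
        refine Real.tendsto_exp_neg_atTop_nhds_zero.comp ?_
        exact (tendsto_inv_nhdsGT_zero.atTop_mul_const ha).atTop_div_const (by positivity)
      have h0 : Tendsto (fun ε : ℝ => ε) (𝓝[>] 0) (𝓝 0) := nhdsWithin_le_nhds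
      have := h0.add ((hlim _ (by linarith [h.2] : 0 < -x 2)).add
        (hlim _ (by linarith [h.1] : 0 < x 2 + B.φ (B.r x))))
      simpa [bl] using this
    · simp [indicator_of_notMem hxD]

theorem small_ne_top (ε : ℝ) : small B Ω ε ≠ ⊤ := by
  have hD := B.compact_D.measurableSet
  obtain ⟨C, hC⟩ := B.compact_D.exists_bound_of_continuousOn
    (continuous_const.add (B.continuous_bl ε) : Continuous fun x => ε + B.bl ε x).continuousOn
  rw [small, eLpNorm_indicator_eq_eLpNorm_restrict hD]
  refine ((eLpNorm_le_of_ae_bound (C := C) ?_).trans_lt (ENNReal.mul_lt_top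
    (ENNReal.rpow_lt_top_of_nonneg (by simp) ?_) ENNReal.ofReal_lt_top)).ne
  · filter_upwards [ae_restrict_mem hD] with x hx using hC x hx
  · rw [Measure.restrict_apply_univ]
    exact (measure_lt_top_of_compactSpace Ω).ne

theorem Eapp_bound (hΩ : B.Fits Ω) : ∃ C : ℝ, 0 ≤ C ∧ ∀ ε, 0 < ε → ε ≤ 1 →
    MemLp (Eapp B Ω ε) 1 timeMeasure ∧
      eLpNorm (Eapp B Ω ε) 1 timeMeasure ≤ ENNReal.ofReal C * small B Ω ε := by
  obtain ⟨C, hC0, hC⟩ := B.E_bound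
  refine ⟨C / B.c, div_nonneg hC0 B.c_pos.le, fun ε hε hε1 => ?_⟩
  have hb : ∀ t, 0 ≤ t → ‖Eapp B Ω ε t‖ ≤ (C * (small B Ω ε).toReal) * Real.exp (-B.c * t) := by
    intro t ht
    rw [Lp.norm_def, eLpNorm_congr_ae (Eapp_ae hΩ ε t)]
    have h := eLpNorm_le_mul_indicator (D := B.D) (g := B.E ε t) hΩ.measurableSet
      (mul_nonneg hC0 (Real.exp_nonneg (-B.c * t)))
      (fun x hx => hC ε hε hε1 t ht x hx) fun _ hx hxD => E_eq_zero_off ε t (hΩ.hor_notMem hx hxD)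
    have h2 := ENNReal.toReal_mono
      (ENNReal.mul_ne_top ENNReal.ofReal_ne_top (small_ne_top (B := B) (Ω := Ω) ε)) h
    rw [ENNReal.toReal_mul, ENNReal.toReal_ofReal (by positivity)] at h2
    linarith
  have h := memLp_of_exp_bound (continuous_cutLp (B.continuous_E ε) : Continuous (Eapp B Ω ε))
    B.c_pos (by positivity) hb
  refine ⟨h.1, h.2.trans (le_of_eq ?_)⟩
  rw [mul_div_right_comm, ENNReal.ofReal_mul (div_nonneg hC0 B.c_pos.le),
    ENNReal.ofReal_toReal (small_ne_top ε)]

theorem velocity_bound (hΩ : B.Fits Ω) : ∃ C : ℝ, 0 ≤ C ∧ ∀ ε, (hε : 0 < ε) → ε ≤ 1 → ∀ t, 0 ≤ t →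
    eLpNorm (fun x => velocity (Uapp hΩ hε.ne' t) x - B.V0 t x) 2 (volume.restrict Ω)
      ≤ ENNReal.ofReal C * small B Ω ε := by
  obtain ⟨C1, h1, hC1⟩ := B.UBL_bound
  obtain ⟨C2, h2, hC2⟩ := B.dec_V1.bound B.c_pos B.compact_D fun x hx => B.rate_D hx
  have hN := B.N_nonneg
  refine ⟨C2 + (3 * B.N + C1), by positivity, fun ε hε hε1 t ht => ?_⟩
  have e : (fun x => velocity (Uapp hΩ hε.ne' t) x - B.V0 t x) =ᵐ[volume.restrict Ω]
      fun x => ε • B.V1 t x + B.UBL ε t x := by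
    filter_upwards [velocity_mkV_ae hΩ (B.admissible_F ε t) (B.divg_F hε.ne' t)] with x hx
    rw [Uapp, hx, F, Vint]; abel
  rw [eLpNorm_congr_ae e]
  refine eLpNorm_le_mul_indicator hΩ.measurableSet (by positivity) (fun x hx => ?_)
    fun x hx hxD => ?_
  · have hbl := B.bl_le hε hx
    have b1 : ‖ε • B.V1 t x‖ ≤ ε * C2 := by
      rw [norm_smul, Real.norm_of_nonneg hε.le]
      refine mul_le_mul_of_nonneg_left ((hC2 t ht x hx).trans ?_) hε.le
      exact mul_le_of_le_one_right h2 (Real.exp_le_one_iff.2 (by nlinarith [B.c_pos]))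
    have b2 : ‖B.UBL ε t x‖ ≤ (3 * B.N + C1) * B.bl ε x := by
      refine (hC1 ε hε t ht x hx).trans (mul_le_mul_of_nonneg_right ?_ hbl.1)
      nlinarith
    refine (norm_add_le_of_le b1 b2).trans ?_
    nlinarith [mul_nonneg h2 hbl.1, mul_nonneg hN hε.le, mul_nonneg h1 hε.le]
  · have h := hΩ.hor_notMem hx hxD
    rw [B.dec_V1.eq_zero t h, B.UBL_eq_zero_off ε t h]; simp

/-- The bound `M` of the gradient of `V0` is an input because it has to be uniform in the
truncation. The constant of `V1` need not be, since it is multiplied by `ε`. -/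
theorem Gapp_bound {M : ℝ} (hM : 0 ≤ M)
    (hV0 : ∀ t, 0 ≤ t → ∀ x ∈ B.D, ∀ j, ‖partialD j (B.V0 t) x‖ ≤ M * Real.exp (-B.c * t)) :
    ∃ C : ℝ, 0 ≤ C ∧ ∀ ε, 0 < ε → MemLp (Gapp B Ω ε) 1 timeMeasure ∧
      eLpNorm (Gapp B Ω ε) 1 timeMeasure ≤ ENNReal.ofReal ((M + C * ε) / B.c) := by
  have h : ∀ j, ∃ C : ℝ, 0 ≤ C ∧ ∀ t, 0 ≤ t → ∀ x ∈ B.D,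
      ‖partialD j (B.V1 t) x‖ ≤ C * Real.exp (-B.c * t) := fun j =>
    (B.dec_V1.partialD B.smooth_Λ B.closed_K j).bound B.c_pos B.compact_D fun x hx => B.rate_D hx
  choose C hC0 hC using h
  have hsum : ∀ j, C j ≤ ∑ i, C i := fun j =>
    Finset.single_le_sum (fun i _ => hC0 i) (Finset.mem_univ j)
  have hsum0 : 0 ≤ ∑ i, C i := Finset.sum_nonneg fun i _ => hC0 i
  refine ⟨∑ j, C j, hsum0, fun ε hε => ?_⟩
  have hcont : Continuous (Gapp B Ω ε) := continuous_pi fun j =>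
    continuous_cutLp (contDiff_partialD_uncurry (B.smooth_Vint ε) j).continuous
  refine memLp_of_exp_bound hcont B.c_pos (by positivity) fun t ht => ?_
  have hnn : 0 ≤ (M + (∑ j, C j) * ε) * Real.exp (-B.c * t) := by positivity
  refine (pi_norm_le_iff_of_nonneg hnn).2 fun j => norm_cutLp_top_le _ hnn fun x hx => ?_
  have s0 := B.dec_V0.smooth B.smooth_Λ t
  have s1 := B.dec_V1.smooth B.smooth_Λ t
  have hform : partialD j (B.Vint ε t) x = partialD j (B.V0 t) x + ε • partialD j (B.V1 t) x := by
    rw [← partialD_const_smul ε s1]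
    exact partialD_add s0 (s1.const_smul ε) j x
  rw [hform, add_mul]
  refine norm_add_le_of_le (hV0 t ht x hx j) ?_
  rw [norm_smul, Real.norm_of_nonneg hε.le]
  have := (hC j t ht x hx).trans (mul_le_mul_of_nonneg_right (hsum j) (Real.exp_nonneg _))
  nlinarith

end Basin

/-! ### The weighted norm of the boundary layers -/

theorem lintegral_weighted_exp_le {k a : ℝ} (hk : 0 < k) (ha : 0 ≤ a) (h : ℝ) :
    ∫⁻ z in Ioo (-h) 0, ENNReal.ofReal (a * (Real.exp (k * z) + Real.exp (-(k * (z + h)))))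
      ≤ ENNReal.ofReal (a * (2 / k)) := by
  have i1 : IntegrableOn (fun z => Real.exp (k * z)) (Iic 0) := integrableOn_exp_mul_Iic hk 0
  have i2 : IntegrableOn (fun z => Real.exp (-k * z)) (Ioi (-h)) :=
    integrableOn_exp_mul_Ioi (by linarith) (-h)
  have b1 : ∫⁻ z in Ioo (-h) 0, ENNReal.ofReal (Real.exp (k * z)) ≤ ENNReal.ofReal (1 / k) := by
    refine (lintegral_mono_set (t := Iic 0) fun z hz => hz.2.le).trans ?_
    rw [← ofReal_integral_eq_lintegral_ofReal i1 (Eventually.of_forall fun z => (Real.exp_pos _).le),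
      integral_exp_mul_Iic hk]
    simp
  have b2 : ∫⁻ z in Ioo (-h) 0, ENNReal.ofReal (Real.exp (-(k * (z + h))))
      ≤ ENNReal.ofReal (1 / k) := by
    refine (lintegral_mono_set (t := Ioi (-h)) fun z hz => hz.1).trans ?_
    have e : (fun z => Real.exp (-(k * (z + h)))) = fun z => Real.exp (-k * h) * Real.exp (-k * z) := by
      funext z; rw [← Real.exp_add]; ring_nf
    rw [← ofReal_integral_eq_lintegral_ofReal (by rw [e]; exact i2.const_mul _)
      (Eventually.of_forall fun z => (Real.exp_pos _).le), e, integral_const_mul,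
      integral_exp_mul_Ioi (by linarith)]
    refine ENNReal.ofReal_le_ofReal (le_of_eq ?_)
    rw [neg_div_neg_eq, mul_div_assoc', ← Real.exp_add]
    simp
  have e : ∀ z, ENNReal.ofReal (a * (Real.exp (k * z) + Real.exp (-(k * (z + h)))))
      = ENNReal.ofReal a * (ENNReal.ofReal (Real.exp (k * z))
        + ENNReal.ofReal (Real.exp (-(k * (z + h))))) := fun z => by
    rw [ENNReal.ofReal_mul ha, ENNReal.ofReal_add (Real.exp_pos _).le (Real.exp_pos _).le]
  simp_rw [e]
  rw [lintegral_const_mul' _ _ ENNReal.ofReal_ne_top, lintegral_add_left (by fun_prop),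
    ENNReal.ofReal_mul ha]
  gcongr
  refine (add_le_add b1 b2).trans (le_of_eq ?_)
  rw [← ENNReal.ofReal_add (by positivity) (by positivity)]
  ring_nf

theorem mul_exp_neg_mul_le {k s : ℝ} (hk : 0 < k) :
    s * Real.exp (-(k * s)) ≤ 2 / k * Real.exp (-(k * s / 2)) := by
  have := mul_exp_neg_le (s := k * s)
  rw [div_mul_eq_mul_div, le_div_iff₀ hk]
  linarith

namespace Basin

variable (B : Basin)

/-- The minimum is bounded by the distance attached to each exponential, and that distance costs
half of the decay and gains `ε`. The exponents of `bl` carry a factor `1/2`, which the square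
removes. -/
theorem depth_mul_bl_sq_le {ε : ℝ} (hε : 0 < ε) {y : E2} {z : ℝ}
    (hz : z ∈ Ioo (-B.φ (B.R y)) 0) :
    min (-z) (B.φ (B.R y) + z) * B.bl ε (pt y z) ^ 2
      ≤ 4 * (ε * B.sM) * (Real.exp ((ε * B.sM)⁻¹ / 2 * z)
        + Real.exp (-((ε * B.sM)⁻¹ / 2 * (z + B.φ (B.R y))))) := by
  have hs := B.sM_pos
  set k := (ε * B.sM)⁻¹ with hk
  have hk0 : 0 < k := by positivity
  have hr : B.r (pt y z) = B.R y := by simp [r]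
  set h := B.φ (B.R y)
  have e1 : Real.exp (-(ε⁻¹ * (-z) / (2 * B.sM))) ^ 2 = Real.exp (-(k * (-z))) := by
    rw [← Real.exp_nat_mul, hk]; congr 1; field_simp; push_cast; ring
  have e2 : Real.exp (-(ε⁻¹ * (z + h) / (2 * B.sM))) ^ 2 = Real.exp (-(k * (z + h))) := by
    rw [← Real.exp_nat_mul, hk]; congr 1; field_simp; push_cast; ring
  have hbl : B.bl ε (pt y z) ^ 2 ≤ 2 * Real.exp (-(k * (-z))) + 2 * Real.exp (-(k * (z + h))) := by
    rw [← e1, ← e2, bl, hr, pt_two]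
    set p := Real.exp (-(ε⁻¹ * (-z) / (2 * B.sM)))
    set q := Real.exp (-(ε⁻¹ * (z + h) / (2 * B.sM)))
    nlinarith [sq_nonneg (p - q)]
  have hm0 : 0 ≤ min (-z) (h + z) := le_min (by linarith [hz.2]) (by linarith [hz.1])
  have m1 : min (-z) (h + z) * Real.exp (-(k * (-z))) ≤ 2 / k * Real.exp (k / 2 * z) := by
    refine (mul_le_mul_of_nonneg_right (min_le_left _ _) (Real.exp_nonneg _)).trans ?_
    refine (mul_exp_neg_mul_le hk0).trans (le_of_eq ?_)
    ring_nf
  have m2 : min (-z) (h + z) * Real.exp (-(k * (z + h)))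
      ≤ 2 / k * Real.exp (-(k / 2 * (z + h))) := by
    refine (mul_le_mul_of_nonneg_right (min_le_right _ _) (Real.exp_nonneg _)).trans ?_
    rw [add_comm h z]
    refine (mul_exp_neg_mul_le hk0).trans (le_of_eq ?_)
    ring_nf
  have hk' : 2 / k = 2 * (ε * B.sM) := by rw [hk]; field_simp
  rw [hk'] at m1 m2
  have := mul_le_mul_of_nonneg_left hbl hm0
  linarith

theorem exists_layer_norm_le : ∃ C : ℝ, 0 ≤ C ∧ ∀ ε, 0 < ε → ∀ t, 0 ≤ t → ∀ y ∈ B.K,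
    (∫⁻ z in Ioo (-B.φ (B.R y)) 0,
      ‖√(min (-z) (B.φ (B.R y) + z)) • B.UBL ε t (pt y z)‖ₑ ^ 2) ^ (1 / 2 : ℝ)
      ≤ ENNReal.ofReal (4 * (3 * B.N + C * ε) * (ε * B.sM)) := by
  obtain ⟨C, hC0, hC⟩ := B.UBL_bound
  refine ⟨C, hC0, fun ε hε t ht y hy => ?_⟩
  have hs := B.sM_pos
  have hN := B.N_nonneg
  set a := 3 * B.N + C * ε with ha
  have ha0 : 0 ≤ a := by positivity
  have hr : ∀ z, B.r (pt y z) = B.R y := fun z => by simp [r]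
  have hpt : ∀ z ∈ Ioo (-B.φ (B.R y)) 0,
      ‖√(min (-z) (B.φ (B.R y) + z)) • B.UBL ε t (pt y z)‖ₑ ^ 2
      ≤ ENNReal.ofReal (a ^ 2 * (4 * (ε * B.sM)) * (Real.exp ((ε * B.sM)⁻¹ / 2 * z)
        + Real.exp (-((ε * B.sM)⁻¹ / 2 * (z + B.φ (B.R y)))))) := by
    intro z hz
    have hD : pt y z ∈ B.D := by
      refine ⟨by simpa using hy, ?_, ?_⟩
      · rw [hr, pt_two]; exact hz.1.le
      · rw [pt_two]; exact hz.2.le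
    have hm0 : 0 ≤ min (-z) (B.φ (B.R y) + z) :=
      le_min (by linarith [hz.2]) (by linarith [hz.1])
    rw [← ofReal_norm, ← ENNReal.ofReal_pow (norm_nonneg _)]
    refine ENNReal.ofReal_le_ofReal ?_
    rw [norm_smul, Real.norm_of_nonneg (Real.sqrt_nonneg _), mul_pow, Real.sq_sqrt hm0]
    have h1 : ‖B.UBL ε t (pt y z)‖ ^ 2 ≤ (a * B.bl ε (pt y z)) ^ 2 :=
      pow_le_pow_left₀ (norm_nonneg _) (hC ε hε t ht _ hD) 2
    have h2 := B.depth_mul_bl_sq_le hε hz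
    calc _ ≤ min (-z) (B.φ (B.R y) + z) * (a * B.bl ε (pt y z)) ^ 2 :=
          mul_le_mul_of_nonneg_left h1 hm0
      _ = a ^ 2 * (min (-z) (B.φ (B.R y) + z) * B.bl ε (pt y z) ^ 2) := by ring
      _ ≤ _ := (mul_le_mul_of_nonneg_left h2 (sq_nonneg a)).trans (le_of_eq (by ring))
  have h := (setLIntegral_mono' measurableSet_Ioo hpt).trans
    (lintegral_weighted_exp_le (k := (ε * B.sM)⁻¹ / 2) (by positivity) (by positivity) _)
  -- One factor `ε` comes from the weight and one from the vertical integration; the square root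
  -- leaves a single power.
  have e : a ^ 2 * (4 * (ε * B.sM)) * (2 / ((ε * B.sM)⁻¹ / 2)) = (4 * a * (ε * B.sM)) ^ 2 := by
    field_simp; ring
  rw [e] at h
  refine (ENNReal.rpow_le_rpow h (by norm_num)).trans (le_of_eq ?_)
  rw [ENNReal.ofReal_rpow_of_nonneg (by positivity) (by norm_num), ← Real.sqrt_eq_rpow,
    Real.sqrt_sq (by positivity)]

end Basin

/-! ### The distance to a compact convex set -/

section Nearest

variable {F : Type*} [NormedAddCommGroup F] [InnerProductSpace ℝ F] {Γ : Set F}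

/-- `p` is the point of `Γ` nearest to `y`, characterized by the variational inequality. -/
def IsNearest (Γ : Set F) (y p : F) : Prop := p ∈ Γ ∧ ∀ w ∈ Γ, inner ℝ (y - p) (w - p) ≤ 0

theorem exists_isNearest (hc : IsCompact Γ) (hv : Convex ℝ Γ) (hn : Γ.Nonempty) (y : F) :
    ∃ p, IsNearest Γ y p := by
  obtain ⟨p, hp, h⟩ := hc.exists_infDist_eq_dist hn y
  refine ⟨p, hp, (norm_eq_iInf_iff_real_inner_le_zero hv hp).1 ?_⟩
  rw [← dist_eq_norm, ← h, Metric.infDist_eq_iInf]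
  simp_rw [dist_eq_norm]

theorem IsNearest.infDist_eq {y p : F} (h : IsNearest Γ y p) : Metric.infDist y Γ = ‖y - p‖ := by
  refine le_antisymm ((Metric.infDist_le_dist_of_mem h.1).trans_eq (dist_eq_norm _ _)) ?_
  refine (Metric.le_infDist ⟨p, h.1⟩).2 fun w hw => ?_
  rw [dist_eq_norm]
  have e : y - w = (y - p) - (w - p) := by abel
  have := norm_sub_sq_real (y - p) (w - p)
  rw [← e] at this
  refine abs_le_of_sq_le_sq' ?_ (norm_nonneg _) |>.2
  nlinarith [h.2 w hw, sq_nonneg ‖w - p‖]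

/-- Adding the two variational inequalities gives `‖p - p'‖² ≤ ⟨y - y', p - p'⟩`; Cauchy-Schwarz
concludes. -/
theorem IsNearest.norm_sub_le {y y' p p' : F} (h : IsNearest Γ y p) (h' : IsNearest Γ y' p') :
    ‖p - p'‖ ≤ ‖y - y'‖ := by
  have h1 := h.2 p' h'.1
  have h2 := h'.2 p h.1
  have h3 : ‖p - p'‖ ^ 2 ≤ inner ℝ (y - y') (p - p') := by
    rw [← real_inner_self_eq_norm_sq]
    have e1 : inner ℝ (y - p) (p' - p) = -inner ℝ (y - p) (p - p') := by
      rw [← inner_neg_right, neg_sub]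
    have e2 : inner ℝ (y - y') (p - p') - inner ℝ (p - p') (p - p')
        = inner ℝ (y - p) (p - p') - inner ℝ (y' - p') (p - p') := by
      rw [← inner_sub_left, ← inner_sub_left]; congr 1; abel
    linarith
  have h4 := real_inner_le_norm (y - y') (p - p')
  by_contra! hlt
  nlinarith [norm_nonneg (y - y'), norm_nonneg (p - p')]

/-- Points on the outward normal ray have the same nearest point. -/
theorem IsNearest.ray {y p : F} (h : IsNearest Γ y p) {s : ℝ} (hs : 0 ≤ s) :
    IsNearest Γ (p + s • (y - p)) p := by
  refine ⟨h.1, fun w hw => ?_⟩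
  rw [add_sub_cancel_left, inner_smul_left]
  exact mul_nonpos_of_nonneg_of_nonpos hs (h.2 w hw)

theorem IsNearest.mem_frontier {y p : F} (h : IsNearest Γ y p) (hc : IsClosed Γ) (hy : y ∉ Γ) :
    p ∈ frontier Γ := by
  rw [hc.frontier_eq]
  refine ⟨h.1, fun hi => hy ?_⟩
  have hlim : Tendsto (fun t : ℝ => p + t • (y - p)) (𝓝[>] 0) (𝓝 p) := by
    have : Continuous fun t : ℝ => p + t • (y - p) := by fun_prop
    simpa using (this.tendsto 0).mono_left nhdsWithin_le_nhds
  obtain ⟨t, ht, ht0⟩ := ((hlim.eventually (mem_interior_iff_mem_nhds.1 hi)).and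
    self_mem_nhdsWithin).exists
  have h1 := h.2 _ ht
  rw [add_sub_cancel_left, inner_smul_right, real_inner_self_eq_norm_sq] at h1
  have h2 : ‖y - p‖ = 0 := by
    have h0 : (0 : ℝ) < t := ht0
    by_contra hne
    have : 0 < ‖y - p‖ ^ 2 := by positivity
    nlinarith
  rw [sub_eq_zero.1 (norm_eq_zero.1 h2)]
  exact h.1

/-- The distance at each of `y` and `y + v` is tested with the point nearest to the other one. The
two inequalities agree up to `O(‖v‖²)` because the nearest point depends on `y` in a Lipschitz way.
-/
theorem IsNearest.hasFDerivAt_infDist_sq (hc : IsCompact Γ) (hv : Convex ℝ Γ) {y p : F}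
    (h : IsNearest Γ y p) :
    HasFDerivAt (fun x => Metric.infDist x Γ ^ 2) ((2 : ℝ) • innerSL ℝ (y - p)) y := by
  rw [hasFDerivAt_iff_isLittleO_nhds_zero]
  refine Asymptotics.IsBigO.trans_isLittleO (g := fun v : F => ‖v‖ ^ 2) ?_ ?_
  · refine Asymptotics.IsBigO.of_bound 1 (Eventually.of_forall fun v => ?_)
    obtain ⟨q, hq⟩ := exists_isNearest hc hv ⟨p, h.1⟩ (y + v)
    have hpq : ‖q - p‖ ≤ ‖v‖ := by simpa using hq.norm_sub_le h
    have up : Metric.infDist (y + v) Γ ^ 2 ≤ ‖(y - p) + v‖ ^ 2 := by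
      refine pow_le_pow_left₀ Metric.infDist_nonneg ?_ 2
      refine (Metric.infDist_le_dist_of_mem h.1).trans_eq ?_
      rw [dist_eq_norm]; congr 1; abel
    have lo : Metric.infDist y Γ ^ 2 ≤ ‖(y + v - q) - v‖ ^ 2 := by
      refine pow_le_pow_left₀ Metric.infDist_nonneg ?_ 2
      refine (Metric.infDist_le_dist_of_mem hq.1).trans_eq ?_
      rw [dist_eq_norm]; congr 1; abel
    rw [norm_add_sq_real] at up
    rw [norm_sub_sq_real, ← hq.infDist_eq] at lo
    have e : inner ℝ (y + v - q) v = inner ℝ (y - p) v + ‖v‖ ^ 2 - inner ℝ (q - p) v := by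
      rw [← real_inner_self_eq_norm_sq, ← inner_add_left, ← inner_sub_left]
      congr 1; abel
    have hi := (real_inner_le_norm (q - p) v).trans
      (mul_le_mul_of_nonneg_right hpq (norm_nonneg v))
    have hd : Metric.infDist y Γ = ‖y - p‖ := h.infDist_eq
    simp only [FunLike.coe_smul, Pi.smul_apply, innerSL_apply_apply, smul_eq_mul, norm_pow,
      one_mul, Real.norm_eq_abs, abs_norm]
    rw [hd] at lo ⊢
    rw [abs_le]
    constructor <;> nlinarith
  · exact (Asymptotics.isLittleO_norm_pow_id one_lt_two)

theorem IsNearest.infDist_pos {y p : F} (h : IsNearest Γ y p) (hy : y ∉ Γ) :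
    0 < Metric.infDist y Γ := by
  rw [h.infDist_eq, norm_pos_iff, sub_ne_zero]
  rintro rfl
  exact hy h.1

theorem IsNearest.hasFDerivAt_infDist (hc : IsCompact Γ) (hv : Convex ℝ Γ) {y p : F}
    (h : IsNearest Γ y p) (hy : y ∉ Γ) :
    HasFDerivAt (fun x => Metric.infDist x Γ)
      ((Metric.infDist y Γ)⁻¹ • innerSL ℝ (y - p)) y := by
  have h0 := h.infDist_pos hy
  have h1 := (h.hasFDerivAt_infDist_sq hc hv).sqrt (by positivity)
  simp only [Real.sqrt_sq Metric.infDist_nonneg] at h1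
  convert h1 using 1
  rw [smul_smul]
  congr 1
  field_simp

theorem IsNearest.gradient_infDist [CompleteSpace F] (hc : IsCompact Γ) (hv : Convex ℝ Γ) {y p : F}
    (h : IsNearest Γ y p) (hy : y ∉ Γ) :
    gradient (fun x => Metric.infDist x Γ) y = (Metric.infDist y Γ)⁻¹ • (y - p) := by
  refine HasGradientAt.gradient ?_
  rw [hasGradientAt_iff_hasFDerivAt]
  exact (h.hasFDerivAt_infDist hc hv hy).congr_fderiv (by ext v; simp)

theorem IsNearest.norm_gradient_infDist [CompleteSpace F] (hc : IsCompact Γ) (hv : Convex ℝ Γ)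
    {y p : F} (h : IsNearest Γ y p) (hy : y ∉ Γ) :
    ‖gradient (fun x => Metric.infDist x Γ) y‖ = 1 := by
  have h0 := h.infDist_pos hy
  rw [h.gradient_infDist hc hv hy, norm_smul, norm_inv, Real.norm_of_nonneg h0.le, ← h.infDist_eq,
    inv_mul_cancel₀ h0.ne']

theorem norm_inv_norm_smul_sub_le {a b : F} (ha : a ≠ 0) (hb : b ≠ 0) :
    ‖‖a‖⁻¹ • a - ‖b‖⁻¹ • b‖ ≤ 2 / ‖a‖ * ‖a - b‖ := by
  have ha' : 0 < ‖a‖ := norm_pos_iff.2 ha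
  have hb' : 0 < ‖b‖ := norm_pos_iff.2 hb
  have e : ‖a‖⁻¹ • a - ‖b‖⁻¹ • b = ‖a‖⁻¹ • (a - b) + (‖a‖⁻¹ - ‖b‖⁻¹) • b := by
    rw [smul_sub, sub_smul]; abel
  have e2 : ‖(‖a‖⁻¹ - ‖b‖⁻¹) • b‖ ≤ ‖a‖⁻¹ * ‖a - b‖ := by
    have : ‖a‖⁻¹ - ‖b‖⁻¹ = ‖a‖⁻¹ * ‖b‖⁻¹ * (‖b‖ - ‖a‖) := by field_simp
    rw [this, norm_smul, norm_mul, norm_mul, norm_inv, norm_inv, norm_norm, norm_norm]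
    have h3 : ‖‖b‖ - ‖a‖‖ ≤ ‖a - b‖ := by
      rw [norm_sub_rev a b]; exact abs_norm_sub_norm_le b a
    calc ‖a‖⁻¹ * ‖b‖⁻¹ * ‖‖b‖ - ‖a‖‖ * ‖b‖ = ‖a‖⁻¹ * ‖‖b‖ - ‖a‖‖ := by field_simp
      _ ≤ _ := by gcongr
  rw [e]
  refine (norm_add_le _ _).trans ?_
  rw [norm_smul, norm_inv, norm_norm]
  calc _ ≤ ‖a‖⁻¹ * ‖a - b‖ + ‖a‖⁻¹ * ‖a - b‖ := by linarith
    _ = _ := by ring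

/-- The unit normal field is Lipschitz away from the set. -/
theorem norm_gradient_infDist_sub_le [CompleteSpace F] (hc : IsCompact Γ) (hv : Convex ℝ Γ)
    {y y' p p' : F} (h : IsNearest Γ y p) (h' : IsNearest Γ y' p') (hy : y ∉ Γ) (hy' : y' ∉ Γ) :
    ‖gradient (fun x => Metric.infDist x Γ) y - gradient (fun x => Metric.infDist x Γ) y'‖
      ≤ 4 / Metric.infDist y Γ * ‖y - y'‖ := by
  have h0 := h.infDist_pos hy
  have h0' := h'.infDist_pos hy'
  rw [h.gradient_infDist hc hv hy, h'.gradient_infDist hc hv hy', h.infDist_eq, h'.infDist_eq]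
  rw [h.infDist_eq] at h0
  rw [h'.infDist_eq] at h0'
  refine (norm_inv_norm_smul_sub_le (norm_pos_iff.1 h0) (norm_pos_iff.1 h0')).trans ?_
  have e : (y - p) - (y' - p') = (y - y') - (p - p') := by abel
  have h2 : ‖(y - p) - (y' - p')‖ ≤ 2 * ‖y - y'‖ := by
    rw [e]
    refine (_root_.norm_sub_le _ _).trans ?_
    linarith [h.norm_sub_le h']
  calc _ ≤ 2 / ‖y - p‖ * (2 * ‖y - y'‖) := by gcongr
    _ = _ := by ring

end Nearest

/-! ### Smoothness of the distance to an island -/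

section Island

variable {Γ : Set E2}

theorem eq_of_periodic_injOn {V : Type*} {γ : ℝ → V} {L : ℝ} (hL : 0 < L)
    (hp : Function.Periodic γ L) (hi : InjOn γ (Ico 0 L)) {s t : ℝ} (h : γ s = γ t)
    (hd : |s - t| < L) : s = t := by
  obtain ⟨m, hm, -⟩ := existsUnique_add_zsmul_mem_Ico hL s 0
  obtain ⟨n, hn, -⟩ := existsUnique_add_zsmul_mem_Ico hL t 0
  rw [zero_add] at hm hn
  have e : s + m • L = t + n • L := hi hm hn (by rw [hp.zsmul m s, hp.zsmul n t, h])
  simp only [zsmul_eq_mul] at e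
  have e2 : s - t = ((n - m : ℤ) : ℝ) * L := by push_cast; linarith
  have : n - m = 0 := by
    rw [e2, abs_mul, abs_of_pos hL] at hd
    have h1 : |((n - m : ℤ) : ℝ)| < 1 := by
      by_contra! hge
      nlinarith
    rw [← Int.cast_abs] at h1
    exact Int.abs_lt_one_iff.1 (by exact_mod_cast h1)
  rw [this] at e2
  simp at e2
  linarith

/-- Points of a simple closed curve close to `γ s₀` have parameters close to `s₀`. -/
theorem exists_param_mem_nhds {V : Type*} [NormedAddCommGroup V] {γ : ℝ → V} {L : ℝ} (hL : 0 < L)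
    (hcont : Continuous γ) (hp : Function.Periodic γ L) (hi : InjOn γ (Ico 0 L)) (s₀ : ℝ)
    {N : Set ℝ} (hN : N ∈ 𝓝 s₀) : ∀ᶠ q in 𝓝 (γ s₀), q ∈ range γ → ∃ s ∈ N, γ s = q := by
  set T := Icc (s₀ - L / 2) (s₀ + L / 2) \ interior N with hT
  have hTc : IsCompact T := isCompact_Icc.diff isOpen_interior
  have h0 : γ s₀ ∉ γ '' T := by
    rintro ⟨s, hs, he⟩
    have hlt : |s - s₀| < L := by rw [abs_lt]; constructor <;> linarith [hs.1.1, hs.1.2]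
    have : s = s₀ := eq_of_periodic_injOn hL hp hi he hlt
    exact hs.2 (this ▸ mem_interior_iff_mem_nhds.2 hN)
  filter_upwards [(hTc.image hcont).isClosed.isOpen_compl.mem_nhds h0] with q hq hqr
  obtain ⟨s, rfl⟩ := hqr
  obtain ⟨s', hs', he⟩ := hp.exists_mem_Ico hL s (s₀ - L / 2)
  refine ⟨s', ?_, he.symm⟩
  by_contra hn
  exact hq ⟨s', ⟨⟨hs'.1, by linarith [hs'.2]⟩, fun h => hn (interior_subset h)⟩, he.symm⟩

theorem IsIsland.nonempty (hΓ : IsIsland Γ) : Γ.Nonempty := by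
  obtain ⟨L, γ, -, -, -, -, -, hr⟩ := hΓ.boundary
  have h : γ 0 ∈ frontier Γ := hr ▸ mem_range_self 0
  rw [hΓ.compact.isClosed.frontier_eq] at h
  exact ⟨_, h.1⟩

theorem IsIsland.exists_isNearest (hΓ : IsIsland Γ) (y : E2) : ∃ p, IsNearest Γ y p :=
  Ekman.exists_isNearest hΓ.compact hΓ.convex hΓ.nonempty y

/-- First and second order conditions at the nearest point of a curve. -/
theorem IsNearest.orthogonality {y : E2} {γ : ℝ → E2} (hγ : ContDiff ℝ ∞ γ)
    (hu : ∀ s, ‖deriv γ s‖ = 1) (hm : ∀ s, γ s ∈ Γ) {s : ℝ} (h : IsNearest Γ y (γ s)) :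
    inner ℝ (y - γ s) (deriv γ s) = 0 ∧
      ∃ d, d ≠ 0 ∧ HasDerivAt (fun σ => inner ℝ (y - γ σ) (deriv γ σ)) d s := by
  have hγ' : ContDiff ℝ ∞ (deriv γ) := (contDiff_infty_iff_deriv.1 hγ).2
  have hd1 : ∀ σ, HasDerivAt γ (deriv γ σ) σ := fun σ =>
    (hγ.differentiable (by simp) σ).hasDerivAt
  have hd2 : ∀ σ, HasDerivAt (deriv γ) (deriv (deriv γ) σ) σ := fun σ =>
    (hγ'.differentiable (by simp) σ).hasDerivAt
  set k : ℝ → ℝ := fun σ => inner ℝ (y - γ s) (γ σ - γ s) with hk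
  have k1 : ∀ σ, HasDerivAt k (inner ℝ (y - γ s) (deriv γ σ)) σ := fun σ => by
    simpa using (hasDerivAt_const σ (y - γ s)).inner ℝ ((hd1 σ).sub_const (γ s))
  have k2 : ∀ σ, HasDerivAt (fun σ => inner ℝ (y - γ s) (deriv γ σ))
      (inner ℝ (y - γ s) (deriv (deriv γ) σ)) σ := fun σ => by
    simpa using (hasDerivAt_const σ (y - γ s)).inner ℝ (hd2 σ)
  have kmax : IsLocalMax k s := Eventually.of_forall fun σ => by
    simpa [hk] using h.2 (γ σ) (hm σ)
  have h0 : inner ℝ (y - γ s) (deriv γ s) = 0 := kmax.hasDerivAt_eq_zero (k1 s)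
  have hdk : deriv k = fun σ => inner ℝ (y - γ s) (deriv γ σ) := funext fun σ => (k1 σ).deriv
  -- A positive second derivative would make the maximum `s` a local minimum as well. Then `k` would
  -- be locally constant and its second derivative zero.
  have hneg : inner ℝ (y - γ s) (deriv (deriv γ) s) ≤ 0 := by
    by_contra! hpos
    have hmin : IsLocalMin k s := isLocalMin_of_deriv_deriv_pos
      (by rw [hdk, (k2 s).deriv]; exact hpos) (by rw [hdk]; exact h0) (k1 s).continuousAt
    have hev : k =ᶠ[𝓝 s] fun _ => k s := by
      filter_upwards [kmax, hmin] with σ h1 h2 using le_antisymm h1 h2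
    have h1 : deriv k =ᶠ[𝓝 s] fun _ => 0 := by simpa using hev.deriv
    have h2 := h1.deriv_eq
    rw [hdk, (k2 s).deriv, deriv_const] at h2
    exact hpos.ne' h2
  refine ⟨h0, _, ?_, ((hd1 s).const_sub y).inner ℝ (hd2 s)⟩
  -- The derivative is `⟨y - γ, γ''⟩ - |γ'|² ≤ -1`; this is where convexity and unit speed yield
  -- nondegeneracy.
  rw [inner_neg_left, real_inner_self_eq_norm_sq, hu]
  intro he
  linarith

/-- The parameter of the nearest point solves `⟨y - γ(s), γ'(s)⟩ = 0`, and the derivative of this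
equation in `s` is not zero. The implicit function theorem gives a smooth local solution `g`, and
the distance is `‖y - γ(g y)‖`, the norm of a vector which does not vanish outside `Γ`. -/
theorem IsIsland.contDiffAt_rho (hΓ : IsIsland Γ) {y : E2} (hy : y ∉ Γ) :
    ContDiffAt ℝ ∞ (rho Γ) y := by
  obtain ⟨L, γ, hL, hγ, hper, hinj, hunit, hrange⟩ := hΓ.boundary
  have hcl := hΓ.compact.isClosed
  have hm : ∀ s, γ s ∈ Γ := fun s =>
    hcl.frontier_subset (hrange ▸ mem_range_self s)
  have hγ' : ContDiff ℝ ∞ (deriv γ) := (contDiff_infty_iff_deriv.1 hγ).2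
  obtain ⟨p, hp⟩ := hΓ.exists_isNearest y
  obtain ⟨s₀, rfl⟩ : p ∈ range γ := hrange ▸ hp.mem_frontier hcl hy
  obtain ⟨h0, d, hd, hder⟩ := hp.orthogonality hγ hunit hm
  set f : E2 × ℝ → ℝ := fun q => inner ℝ (q.1 - γ q.2) (deriv γ q.2) with hf
  have hfs : ContDiff ℝ ∞ f :=
    (contDiff_fst.sub (hγ.comp contDiff_snd)).inner ℝ (hγ'.comp contDiff_snd)
  have hfa : ContDiffAt ℝ ∞ f (y, s₀) := hfs.contDiffAt
  have hn : (∞ : WithTop ℕ∞) ≠ 0 := by simp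
  have hinv : (fderiv ℝ f (y, s₀) ∘L .inr ℝ E2 ℝ).IsInvertible := by
    refine ⟨ContinuousLinearEquiv.unitsEquivAut ℝ (Units.mk0 d hd), ?_⟩
    have h1 : HasFDerivAt (fun σ => f (y, σ)) (fderiv ℝ f (y, s₀) ∘L .inr ℝ E2 ℝ) s₀ :=
      ((hfs.differentiable hn) (y, s₀)).hasFDerivAt.comp s₀ (hasFDerivAt_prodMk_right y s₀)
    have h2 : (fderiv ℝ f (y, s₀) ∘L .inr ℝ E2 ℝ) 1 = d := h1.hasDerivAt.unique hder
    ext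
    rw [h2]
    simp
  set g := hfa.implicitFunction hn hinv with hg
  have hgs : ContDiffAt ℝ ∞ g y := hfa.contDiffAt_implicitFunction hn hinv
  have hg0 : g y = s₀ := hfa.implicitFunction_apply_self hn hinv
  have hev := hfa.eventually_apply_eq_iff_implicitFunction hn hinv
  rw [nhds_prod_eq, eventually_prod_iff] at hev
  obtain ⟨PA, hA, PN, hN, hAN⟩ := hev
  obtain ⟨δ, hδ, hδ'⟩ := Metric.eventually_nhds_iff.1
    (exists_param_mem_nhds hL hγ.continuous hper hinj s₀ hN)
  have key : rho Γ =ᶠ[𝓝 y] fun y' => ‖y' - γ (g y')‖ := by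
    filter_upwards [hA, Metric.ball_mem_nhds y hδ, hcl.isOpen_compl.mem_nhds hy] with y' h1 h2 h3
    obtain ⟨q, hq⟩ := hΓ.exists_isNearest y'
    -- For `y'` close to `y` the nearest point is close to `γ s₀`, so it has a parameter close to
    -- `s₀`, in the region where the implicit function is the only solution.
    have hqp : dist q (γ s₀) < δ := by
      rw [dist_eq_norm]
      refine (hq.norm_sub_le hp).trans_lt ?_
      rwa [← dist_eq_norm]
    obtain ⟨s, hs, rfl⟩ := hδ' hqp (hrange ▸ hq.mem_frontier hcl h3)
    have h4 : f (y', s) = f (y, s₀) :=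
      (hq.orthogonality hγ hunit hm).1.trans h0.symm
    have h5 : g y' = s := (hAN h1 hs).1 h4
    rw [h5]
    exact hq.infDist_eq
  refine ContDiffAt.congr_of_eventuallyEq ?_ key
  refine (contDiffAt_id.sub (hγ.contDiffAt.comp y hgs)).norm ℝ ?_
  simp only [id, Function.comp, hg0]
  rw [sub_ne_zero]
  rintro rfl
  exact hy (hm s₀)

end Island

/-! ### The initial profile along normal rays -/

section Profile

variable {Γ : Set E2}

theorem hasDerivAt_ray {V : Type*} [NormedAddCommGroup V] [NormedSpace ℝ V] {G : E2 → V} (p v : E2)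
    {s : ℝ} (hG : DifferentiableAt ℝ G (p + s • v)) :
    HasDerivAt (fun σ : ℝ => G (p + σ • v)) (fderiv ℝ G (p + s • v) v) s := by
  have h1 : HasDerivAt (fun σ : ℝ => p + σ • v) v s := by
    simpa using ((hasDerivAt_id s).smul_const v).const_add p
  exact hG.hasFDerivAt.comp_hasDerivAt s h1

theorem norm_perp (v : E2) : ‖perp v‖ = ‖v‖ := by
  rw [EuclideanSpace.norm_eq, EuclideanSpace.norm_eq]
  simp [perp, Fin.sum_univ_two, add_comm]

/-- The rotation by a right angle. -/
def perpL : E2 →L[ℝ] E2 := LinearMap.toContinuousLinearMap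
  { toFun := perp
    map_add' := fun v w => by ext i; fin_cases i <;> simp [perp]; ring
    map_smul' := fun c v => by ext i; fin_cases i <;> simp [perp] }

theorem continuous_rho : Continuous (rho Γ) := Metric.continuous_infDist_pt Γ

theorem notMem_of_rho_pos {y : E2} (h : 0 < rho Γ y) : y ∉ Γ := fun hy =>
  h.ne' (Metric.infDist_zero_of_mem hy)

theorem mem_surface_iff {ρ₀ : ℝ} {y : E2} : y ∈ surface Γ ρ₀ ↔ ρ₀ < rho Γ y := by
  have : 0 ≤ rho Γ y := Metric.infDist_nonneg
  simp [surface, this]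

theorem isOpen_surface {ρ₀ : ℝ} : IsOpen (surface Γ ρ₀) :=
  (isClosed_Icc.preimage continuous_rho).isOpen_compl

theorem contDiffAt_gradient_rho (hΓ : IsIsland Γ) {y : E2} (hy : 0 < rho Γ y) :
    ContDiffAt ℝ ∞ (gradient (rho Γ)) y := by
  have h := (hΓ.contDiffAt_rho (notMem_of_rho_pos hy)).fderiv_right (m := ∞) (by simp)
  exact (InnerProductSpace.toDual ℝ E2).symm.contDiff.contDiffAt.comp y h

theorem contDiffAt_azimuthalH (hΓ : IsIsland Γ) {u : ℝ → ℝ} {y : E2} (hy : 0 < rho Γ y)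
    (hu : ContDiffAt ℝ ∞ u (rho Γ y)) : ContDiffAt ℝ ∞ (azimuthalH Γ u) y := by
  refine (hu.comp y (hΓ.contDiffAt_rho (notMem_of_rho_pos hy))).smul ?_
  exact perpL.contDiff.contDiffAt.comp y (contDiffAt_gradient_rho hΓ hy)

theorem norm_gradient_rho (hΓ : IsIsland Γ) {y : E2} (hy : 0 < rho Γ y) :
    ‖gradient (rho Γ) y‖ = 1 := by
  obtain ⟨p, hp⟩ := hΓ.exists_isNearest y
  exact hp.norm_gradient_infDist hΓ.compact hΓ.convex (notMem_of_rho_pos hy)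

/-- The distance and its gradient along a normal ray. -/
theorem exists_ray (hΓ : IsIsland Γ) {y : E2} (hy : 0 < rho Γ y) :
    ∃ p v : E2, ‖v‖ = 1 ∧ p + rho Γ y • v = y ∧
      ∀ s, 0 < s → rho Γ (p + s • v) = s ∧ gradient (rho Γ) (p + s • v) = v := by
  obtain ⟨p, hp⟩ := hΓ.exists_isNearest y
  have hd : rho Γ y = ‖y - p‖ := hp.infDist_eq
  have hv1 : ‖(rho Γ y)⁻¹ • (y - p)‖ = 1 := by
    rw [norm_smul, norm_inv, Real.norm_of_nonneg hy.le, ← hd, inv_mul_cancel₀ hy.ne']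
  refine ⟨p, (rho Γ y)⁻¹ • (y - p), hv1, ?_, fun s hs => ?_⟩
  · rw [smul_smul, mul_inv_cancel₀ hy.ne', one_smul]; abel
  · set v := (rho Γ y)⁻¹ • (y - p) with hv
    have hx : IsNearest Γ (p + s • v) p := by
      rw [hv, smul_smul]; exact hp.ray (by positivity)
    have h1 : rho Γ (p + s • v) = s := by
      refine hx.infDist_eq.trans ?_
      rw [add_sub_cancel_left, norm_smul, hv1, mul_one, Real.norm_of_nonneg hs.le]
    refine ⟨h1, ?_⟩
    have h2 := hx.gradient_infDist hΓ.compact hΓ.convex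
      (notMem_of_rho_pos (Γ := Γ) (by rw [h1]; exact hs))
    refine h2.trans ?_
    change (rho Γ (p + s • v))⁻¹ • _ = _
    rw [h1, add_sub_cancel_left, smul_smul, inv_mul_cancel₀ hs.ne', one_smul]

/-- Along a normal ray the field is `u(s)` times a fixed unit vector, so directional derivatives of
the field along the ray are derivatives of `u`. -/
theorem abs_deriv_profile_le (hΓ : IsIsland Γ) {ρ₀ : ℝ} (hρ₀ : 0 < ρ₀) {u : ℝ → ℝ}
    (hu : ContDiffOn ℝ ∞ u (Ioi ρ₀)) {y : E2} (hy : ρ₀ < rho Γ y) :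
    |deriv u (rho Γ y)| ≤ ‖iteratedFDeriv ℝ 1 (azimuthalH Γ u) y‖ ∧
      |deriv (deriv u) (rho Γ y)| ≤ ‖iteratedFDeriv ℝ 2 (azimuthalH Γ u) y‖ := by
  obtain ⟨p, v, hv, hpy, hray⟩ := exists_ray hΓ (hρ₀.trans hy)
  set G := azimuthalH Γ u
  have hua : ∀ s, ρ₀ < s → ContDiffAt ℝ ∞ u s := fun s hs => hu.contDiffAt (Ioi_mem_nhds hs)
  have hGa : ∀ s, ρ₀ < s → ContDiffAt ℝ ∞ G (p + s • v) := fun s hs => by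
    have h0 := (hray s (hρ₀.trans hs)).1
    exact contDiffAt_azimuthalH hΓ (by rw [h0]; linarith) (by rw [h0]; exact hua s hs)
  have hform : ∀ s, ρ₀ < s → G (p + s • v) = u s • perp v := fun s hs => by
    have h0 := hray s (hρ₀.trans hs)
    change u (rho Γ (p + s • v)) • perp (gradient (rho Γ) (p + s • v)) = _
    rw [h0.1, h0.2]
  have hw : ‖perp v‖ = 1 := by rw [norm_perp, hv]
  have d1 : ∀ s, ρ₀ < s → fderiv ℝ G (p + s • v) v = deriv u s • perp v := fun s hs => by
    have h1 := hasDerivAt_ray p v ((hGa s hs).differentiableAt (by simp))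
    have h2 : HasDerivAt (fun s => u s • perp v) (deriv u s • perp v) s :=
      ((hua s hs).differentiableAt (by simp)).hasDerivAt.smul_const _
    refine (h1.congr_of_eventuallyEq ?_).unique h2
    filter_upwards [Ioi_mem_nhds hs] with σ hσ using (hform σ hσ).symm
  have d2 : ∀ s, ρ₀ < s → fderiv ℝ (fderiv ℝ G) (p + s • v) v v = deriv (deriv u) s • perp v := by
    intro s hs
    have h1 := (hasDerivAt_ray p v (((hGa s hs).fderiv_right (m := ∞) (by simp)).differentiableAt
      (by simp))).clm_apply (hasDerivAt_const s v)
    have hu' : DifferentiableAt ℝ (deriv u) s := by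
      have h3 : ContDiffOn ℝ ∞ (deriv u) (Ioi ρ₀) := hu.deriv_of_isOpen isOpen_Ioi (by simp)
      exact (h3.contDiffAt (Ioi_mem_nhds hs)).differentiableAt (by simp)
    have h2 : HasDerivAt (fun s => deriv u s • perp v) (deriv (deriv u) s • perp v) s :=
      hu'.hasDerivAt.smul_const _
    have h4 := (h1.congr_of_eventuallyEq (f₁ := fun s => deriv u s • perp v) ?_).unique h2
    · simpa using h4
    · filter_upwards [Ioi_mem_nhds hs] with σ hσ using (d1 σ hσ).symm
  have e1 := d1 _ hy
  have e2 := d2 _ hy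
  rw [hpy] at e1 e2
  constructor
  · rw [norm_iteratedFDeriv_one]
    have h := (fderiv ℝ G y).le_opNorm v
    rwa [e1, norm_smul, hw, hv, mul_one, mul_one] at h
  · rw [← norm_iteratedFDeriv_fderiv, norm_iteratedFDeriv_one]
    have h := ((fderiv ℝ (fderiv ℝ G) y v).le_opNorm v).trans
      (mul_le_mul_of_nonneg_right ((fderiv ℝ (fderiv ℝ G) y).le_opNorm v) (norm_nonneg v))
    rwa [e2, norm_smul, hw, hv, mul_one, mul_one, mul_one] at h

/-! ### Integration in the distance variable -/

theorem lipschitzWith_rho_vertical (a : ℝ) :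
    LipschitzWith 1 fun b : ℝ => rho Γ !₂[a, b] := by
  have h : LipschitzWith 1 fun b : ℝ => (!₂[a, b] : E2) := by
    refine LipschitzWith.of_dist_le_mul fun b c => ?_
    rw [EuclideanSpace.dist_eq]
    simp [Fin.sum_univ_two, Real.dist_eq, Real.sqrt_sq_eq_abs]
  have h2 := (Metric.lipschitz_infDist_pt Γ).comp h
  rwa [one_mul] at h2

theorem abs_apply_le_norm (v : E2) (i : Fin 2) : |v i| ≤ ‖v‖ := PiLp.norm_apply_le v i

/-- On a vertical line passing within `ρ₀` of a point of `Γ`, the distance goes from at most `ρ₀` to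
arbitrarily large values, so it takes every value in `S`. Being 1-Lipschitz, it does not increase
lengths. -/
theorem volume_le_vertical (hΓ : IsIsland Γ) {ρ₀ : ℝ} {p : E2} (hp : p ∈ Γ) {a : ℝ}
    (ha : a ∈ Ioo (p 0 - ρ₀) (p 0 + ρ₀)) {S : Set ℝ} (hS : S ⊆ Ioi ρ₀) :
    volume S ≤ volume ((fun b : ℝ => rho Γ !₂[a, b]) ⁻¹' S) := by
  set f : ℝ → ℝ := fun b => rho Γ !₂[a, b]
  have hf : LipschitzWith 1 f := lipschitzWith_rho_vertical a
  have hsub : S ⊆ f '' (f ⁻¹' S) := by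
    intro r hr
    have h0 : f (p 1) ≤ ρ₀ := by
      refine (Metric.infDist_le_dist_of_mem hp).trans ?_
      rw [EuclideanSpace.dist_eq]
      simp only [Fin.sum_univ_two, Real.dist_eq]
      simp only [Matrix.cons_val_zero, Matrix.cons_val_one, sub_self, abs_zero]
      rw [zero_pow two_ne_zero, add_zero, Real.sqrt_sq_eq_abs, abs_abs]
      exact abs_le.2 ⟨by linarith [ha.1], by linarith [ha.2]⟩
    obtain ⟨R, hR⟩ := hΓ.compact.isBounded.subset_closedBall (0 : E2)
    have h1 : r ≤ f (max (p 1) (r + R)) := by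
      refine (Metric.le_infDist hΓ.nonempty).2 fun w hw => ?_
      have hw' : ‖w‖ ≤ R := by simpa using hR hw
      have h2 : |(!₂[a, max (p 1) (r + R)] - w : E2) 1| ≤ ‖(!₂[a, max (p 1) (r + R)] - w : E2)‖ :=
        abs_apply_le_norm _ 1
      have h3 : |w 1| ≤ ‖w‖ := abs_apply_le_norm w 1
      rw [dist_eq_norm]
      refine le_trans ?_ ((le_abs_self _).trans h2)
      simp
      linarith [le_max_right (p 1) (r + R), le_abs_self (w 1)]
    have hr0 : ρ₀ < r := hS hr
    obtain ⟨b, -, hb⟩ := intermediate_value_Icc (le_max_left (p 1) (r + R))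
      hf.continuous.continuousOn ⟨h0.trans hr0.le, h1⟩
    exact ⟨b, by rw [mem_preimage, hb]; exact hr, hb⟩
  have h := hf.hausdorffMeasure_image_le (d := 1) zero_le_one (f ⁻¹' S)
  rw [hausdorffMeasure_real] at h
  refine (measure_mono hsub).trans (h.trans (le_of_eq ?_))
  simp

/-- The identification of the plane with `ℝ × ℝ`. -/
theorem measurePreserving_mkE2 :
    MeasurePreserving (fun q : ℝ × ℝ => (!₂[q.1, q.2] : E2)) volume volume := by
  have h1 := (volume_preserving_finTwoArrow ℝ).symm
  have h2 := PiLp.volume_preserving_toLp (Fin 2)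
  have e : (fun q : ℝ × ℝ => (!₂[q.1, q.2] : E2))
      = WithLp.toLp 2 ∘ MeasurableEquiv.finTwoArrow.symm := by
    funext q
    ext i
    fin_cases i <;> rfl
  rw [e]
  exact h2.comp h1

theorem volume_preimage_rho_ge (hΓ : IsIsland Γ) {ρ₀ : ℝ} {S : Set ℝ}
    (hm : MeasurableSet S) (hS : S ⊆ Ioi ρ₀) :
    ENNReal.ofReal (2 * ρ₀) * volume S ≤ volume (rho Γ ⁻¹' S) := by
  obtain ⟨p, hp⟩ := hΓ.nonempty
  have hmS : MeasurableSet (rho Γ ⁻¹' S) := continuous_rho.measurable hm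
  rw [← measurePreserving_mkE2.measure_preimage hmS.nullMeasurableSet, Measure.volume_eq_prod,
    Measure.prod_apply (measurePreserving_mkE2.measurable hmS)]
  calc ENNReal.ofReal (2 * ρ₀) * volume S
      = ∫⁻ _ in Ioo (p 0 - ρ₀) (p 0 + ρ₀), volume S := by
        rw [setLIntegral_const, Real.volume_Ioo, mul_comm]; ring_nf
    _ ≤ ∫⁻ a in Ioo (p 0 - ρ₀) (p 0 + ρ₀), volume ((fun b : ℝ => rho Γ !₂[a, b]) ⁻¹' S) :=
        setLIntegral_mono' measurableSet_Ioo fun a ha => volume_le_vertical hΓ hp ha hS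
    _ ≤ _ := setLIntegral_le_lintegral _ _

/-- A one-sided substitute for integration in normal coordinates: integrating over a strip of
vertical lines of width `2ρ₀` shows that the image of the planar measure under the distance
dominates `2ρ₀ dr`. -/
theorem lintegral_Ioi_le (hΓ : IsIsland Γ) {ρ₀ : ℝ} {h : ℝ → ℝ≥0∞}
    (hh : Measurable h) :
    ENNReal.ofReal (2 * ρ₀) * ∫⁻ r in Ioi ρ₀, h r ≤ ∫⁻ y in surface Γ ρ₀, h (rho Γ y) := by
  have hle : ENNReal.ofReal (2 * ρ₀) • volume.restrict (Ioi ρ₀)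
      ≤ (volume.restrict (surface Γ ρ₀)).map (rho Γ) := by
    refine Measure.le_iff.2 fun S hS => ?_
    rw [Measure.smul_apply, Measure.restrict_apply hS, smul_eq_mul,
      Measure.map_apply continuous_rho.measurable hS,
      Measure.restrict_apply (continuous_rho.measurable hS)]
    refine (volume_preimage_rho_ge hΓ (hS.inter measurableSet_Ioi) inter_subset_right).trans ?_
    exact measure_mono fun y hy => ⟨hy.1, mem_surface_iff.2 hy.2⟩
  have := lintegral_mono' hle (le_refl h)
  rwa [lintegral_smul_measure, lintegral_map hh continuous_rho.measurable, smul_eq_mul] at this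

/-! ### Sobolev embedding on a half line -/

/-- On the unit interval `[r, r + 1]` one has `|v(r)| ≤ ∫ |v| + ∫ |v'|`, and `|w| ≤ 1 + w²` brings
in the integrals of squares. -/
theorem exists_bound_of_sq_integrable {a : ℝ} {v : ℝ → ℝ} (hv : ContDiffOn ℝ 1 v (Ioi a))
    (h0 : ∫⁻ r in Ioi a, ‖v r‖ₑ ^ 2 ≠ ⊤) (h1 : ∫⁻ r in Ioi a, ‖deriv v r‖ₑ ^ 2 ≠ ⊤) :
    ∃ M, ∀ r ∈ Ioi a, |v r| ≤ M := by
  have hc0 : ContinuousOn v (Ioi a) := hv.continuousOn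
  have hc1 : ContinuousOn (deriv v) (Ioi a) := hv.continuousOn_deriv_of_isOpen isOpen_Ioi le_rfl
  have key : ∀ w : ℝ → ℝ, ContinuousOn w (Ioi a) → ∀ r ∈ Ioi a,
      (∫⁻ r in Ioi a, ‖w r‖ₑ ^ 2 ≠ ⊤) →
      ∫ s in Icc r (r + 1), |w s| ≤ 1 + (∫⁻ r in Ioi a, ‖w r‖ₑ ^ 2).toReal := by
    intro w hw r hr hfin
    have hsub : Icc r (r + 1) ⊆ Ioi a := fun s hs => lt_of_lt_of_le hr hs.1
    have i1 : IntegrableOn (fun s => |w s|) (Icc r (r + 1)) :=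
      ((hw.mono hsub).abs).integrableOn_compact isCompact_Icc
    have i2 : IntegrableOn (fun s => w s ^ 2) (Icc r (r + 1)) :=
      ((hw.mono hsub).pow 2).integrableOn_compact isCompact_Icc
    have h3 : ∫ s in Icc r (r + 1), |w s| ≤ ∫ s in Icc r (r + 1), (1 + w s ^ 2) := by
      refine integral_mono i1 ((integrable_const 1).add i2) fun s => ?_
      change |w s| ≤ 1 + w s ^ 2
      rw [← sq_abs]; nlinarith [sq_nonneg (|w s| - 1), abs_nonneg (w s)]
    refine h3.trans ?_
    rw [integral_add (integrable_const 1) i2]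
    simp only [integral_const, smul_eq_mul, mul_one]
    refine add_le_add (by simp) ?_
    rw [integral_eq_lintegral_of_nonneg_ae (Eventually.of_forall fun s => sq_nonneg _)
      i2.aestronglyMeasurable]
    refine ENNReal.toReal_mono hfin ((lintegral_mono_set hsub).trans_eq' ?_)
    refine lintegral_congr fun s => ?_
    rw [← ofReal_norm, ← ENNReal.ofReal_pow (norm_nonneg _), Real.norm_eq_abs, sq_abs]
  refine ⟨(1 + (∫⁻ r in Ioi a, ‖v r‖ₑ ^ 2).toReal)
    + (1 + (∫⁻ r in Ioi a, ‖deriv v r‖ₑ ^ 2).toReal), fun r hr => ?_⟩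
  have hsub : Icc r (r + 1) ⊆ Ioi a := fun s hs => lt_of_lt_of_le hr hs.1
  have b0 := key v hc0 r hr h0
  have b1 := key _ hc1 r hr h1
  set I := ∫ s in Icc r (r + 1), |deriv v s| with hI
  have hpt : ∀ s ∈ Icc r (r + 1), |v r| - I ≤ |v s| := by
    intro s hs
    have hi : IntegrableOn (fun s => |deriv v s|) (Icc r (r + 1)) :=
      ((hc1.mono hsub).abs).integrableOn_compact isCompact_Icc
    have hss : Icc r s ⊆ Icc r (r + 1) := Icc_subset_Icc_right hs.2
    have hftc : ∫ x in r..s, deriv v x = v s - v r := by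
      refine intervalIntegral.integral_deriv_eq_sub (fun x hx => ?_) ?_
      · rw [uIcc_of_le hs.1] at hx
        exact ((hv.contDiffAt (Ioi_mem_nhds (hsub (hss hx)))).differentiableAt one_ne_zero)
      · refine ContinuousOn.intervalIntegrable ?_
        rw [uIcc_of_le hs.1]
        exact hc1.mono (hss.trans hsub)
    have hle : |v s - v r| ≤ I := by
      rw [← hftc]
      refine (intervalIntegral.abs_integral_le_integral_abs hs.1).trans ?_
      rw [intervalIntegral.integral_of_le hs.1]
      exact setIntegral_mono_set hi (Eventually.of_forall fun x => abs_nonneg _)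
        (Eventually.of_forall fun x (hx : x ∈ Ioc r s) => hss (Ioc_subset_Icc_self hx))
    have := abs_sub_abs_le_abs_sub (v r) (v s)
    rw [abs_sub_comm] at this
    linarith
  have i0 : IntegrableOn (fun s => |v s|) (Icc r (r + 1)) :=
    ((hc0.mono hsub).abs).integrableOn_compact isCompact_Icc
  have h4 : ∫ _ in Icc r (r + 1), (|v r| - I) ≤ ∫ s in Icc r (r + 1), |v s| :=
    setIntegral_mono_on (integrable_const _) i0 measurableSet_Icc hpt
  simp only [integral_const, smul_eq_mul] at h4
  simp at h4
  linarith

/-- The half-line embedding is applied to `u'`; the square integrability of `u'` and `u''` comes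
from the first two derivatives of the planar field. -/
theorem exists_bound_deriv_profile (hΓ : IsIsland Γ) {ρ₀ : ℝ} (hρ₀ : 0 < ρ₀) {φ u : ℝ → ℝ}
    (hu : IsWellPrepared Γ ρ₀ φ u) : ∃ M, ∀ r ∈ Ioi ρ₀, |deriv u r| ≤ M := by
  have hs : ContDiffOn ℝ ∞ u (Ioi ρ₀) := hu.smooth.mono Ioi_subset_Ici_self
  have hs' : ContDiffOn ℝ ∞ (deriv u) (Ioi ρ₀) := hs.deriv_of_isOpen isOpen_Ioi (by simp)
  have key : ∀ (k : ℕ) (w : ℝ → ℝ), Measurable w → (∀ y ∈ surface Γ ρ₀,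
      |w (rho Γ y)| ≤ ‖iteratedFDeriv ℝ k (azimuthalH Γ u) y‖) →
      ∫⁻ r in Ioi ρ₀, ‖w r‖ₑ ^ 2 ≠ ⊤ := by
    intro k w hw hb hinf
    have h1 := lintegral_Ioi_le (ρ₀ := ρ₀) hΓ (hw.enorm.pow_const 2)
    rw [hinf, ENNReal.mul_top (by simpa using hρ₀), top_le_iff] at h1
    have h2 := (hu.sobolev k).2
    rw [eLpNorm_lt_top_iff_lintegral_rpow_enorm_lt_top (by simp) (by simp)] at h2
    refine (lt_of_le_of_lt ?_ h2).ne h1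
    refine setLIntegral_mono' isOpen_surface.measurableSet fun y hy => ?_
    simp only [ENNReal.toReal_ofNat, ENNReal.rpow_ofNat]
    refine pow_le_pow_left' ?_ 2
    rw [← ofReal_norm, ← ofReal_norm]
    exact ENNReal.ofReal_le_ofReal (hb y hy)
  refine exists_bound_of_sq_integrable (hs'.of_le (by exact_mod_cast le_top)) ?_ ?_
  · exact key 1 _ (measurable_deriv u) fun y hy =>
      (abs_deriv_profile_le hΓ hρ₀ hs (mem_surface_iff.1 hy)).1
  · exact key 2 _ (measurable_deriv _) fun y hy =>
      (abs_deriv_profile_le hΓ hρ₀ hs (mem_surface_iff.1 hy)).2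

end Profile

/-! ### Radial cutoffs -/

theorem exists_bound_cutoff_factors : ∃ L, 0 ≤ L ∧
    (∀ u, |(u + 1) * deriv Real.smoothTransition u| ≤ L) ∧
    ∀ u, |deriv Real.smoothTransition u| ≤ L := by
  obtain ⟨L, hL0, hL⟩ := exists_bound_deriv_smoothTransition
  refine ⟨L, hL0, hL, fun u => ?_⟩
  rcases lt_or_ge u 0 with h | h
  · simpa [deriv_smoothTransition_of_neg h] using hL0
  · refine le_trans ?_ (hL u)
    rw [abs_mul]
    exact le_mul_of_one_le_left (abs_nonneg _) (by rw [abs_of_nonneg] <;> linarith)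

/-- A cutoff vanishing for `r ≤ a + δ` and equal to `1` for `r ≥ a + 2δ`. -/
def cutIn (a δ r : ℝ) : ℝ := Real.smoothTransition ((r - a) / δ - 1)

/-- A cutoff equal to `1` for `r ≤ 1 / δ` and vanishing for `r ≥ 2 / δ`. -/
def cutOut (δ r : ℝ) : ℝ := Real.smoothTransition (2 - δ * r)

section RadialCutoffs

variable {a δ r : ℝ}

theorem contDiff_cutIn : ContDiff ℝ ∞ (cutIn a δ) :=
  Real.smoothTransition.contDiff.comp
    (((contDiff_id.sub contDiff_const).div_const δ).sub contDiff_const)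

theorem contDiff_cutOut : ContDiff ℝ ∞ (cutOut δ) :=
  Real.smoothTransition.contDiff.comp (contDiff_const.sub (contDiff_const.mul contDiff_id))

theorem cutIn_nonneg : 0 ≤ cutIn a δ r := Real.smoothTransition.nonneg _

theorem cutIn_le_one : cutIn a δ r ≤ 1 := Real.smoothTransition.le_one _

theorem cutOut_nonneg : 0 ≤ cutOut δ r := Real.smoothTransition.nonneg _

theorem cutOut_le_one : cutOut δ r ≤ 1 := Real.smoothTransition.le_one _

theorem cutIn_eq_zero (hδ : 0 < δ) (h : r ≤ a + δ) : cutIn a δ r = 0 :=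
  Real.smoothTransition.zero_of_nonpos (by
    have : (r - a) / δ ≤ 1 := (div_le_one hδ).2 (by linarith)
    linarith)

theorem cutIn_eq_one (hδ : 0 < δ) (h : a + 2 * δ ≤ r) : cutIn a δ r = 1 :=
  Real.smoothTransition.one_of_one_le (by
    have : 2 ≤ (r - a) / δ := (le_div_iff₀ hδ).2 (by linarith)
    linarith)

theorem cutOut_eq_zero (hδ : 0 < δ) (h : 2 / δ ≤ r) : cutOut δ r = 0 :=
  Real.smoothTransition.zero_of_nonpos (by rw [div_le_iff₀ hδ] at h; linarith)

theorem cutOut_eq_one (hδ : 0 < δ) (h : r ≤ 1 / δ) : cutOut δ r = 1 :=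
  Real.smoothTransition.one_of_one_le (by rw [le_div_iff₀ hδ] at h; linarith)

/-- Extension by zero through a cutoff. -/
theorem contDiff_cutIn_mul {h : ℝ → ℝ} (hδ : 0 < δ) (hh : ContDiffOn ℝ ∞ h (Ioi a)) :
    ContDiff ℝ ∞ fun r => cutIn a δ r * h r := by
  rw [contDiff_iff_contDiffAt]
  intro r
  rcases lt_or_ge a r with hr | hr
  · exact contDiff_cutIn.contDiffAt.mul (hh.contDiffAt (Ioi_mem_nhds hr))
  · refine (contDiffAt_const (c := (0 : ℝ))).congr_of_eventuallyEq ?_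
    filter_upwards [Iio_mem_nhds (show r < a + δ by linarith)] with s hs
    rw [cutIn_eq_zero hδ (le_of_lt hs), zero_mul]

theorem hasDerivAt_cutIn (a δ r : ℝ) : HasDerivAt (cutIn a δ)
    (deriv Real.smoothTransition ((r - a) / δ - 1) * δ⁻¹) r := by
  have h1 : HasDerivAt (fun r => (r - a) / δ - 1) δ⁻¹ r := by
    simpa using (((hasDerivAt_id r).sub_const a).div_const δ).sub_const 1
  have h2 : DifferentiableAt ℝ Real.smoothTransition ((r - a) / δ - 1) :=
    (Real.smoothTransition.contDiff (n := 1)).differentiable (by simp) _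
  exact h2.hasDerivAt.comp r h1

theorem hasDerivAt_cutOut (δ r : ℝ) : HasDerivAt (cutOut δ)
    (deriv Real.smoothTransition (2 - δ * r) * (-δ)) r := by
  have h1 : HasDerivAt (fun r => 2 - δ * r) (-δ) r := by
    simpa using ((hasDerivAt_id r).const_mul δ).const_sub 2
  have h2 : DifferentiableAt ℝ Real.smoothTransition (2 - δ * r) :=
    (Real.smoothTransition.contDiff (n := 1)).differentiable (by simp) _
  exact h2.hasDerivAt.comp r h1

/-- The derivative of a truncated profile is bounded independently of the truncation. -/
theorem abs_deriv_truncate_le {u : ℝ → ℝ} {L N P Q : ℝ}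
    (hL1 : ∀ u, |(u + 1) * deriv Real.smoothTransition u| ≤ L)
    (hL2 : ∀ u, |deriv Real.smoothTransition u| ≤ L) (hL : 0 ≤ L)
    (hδ : 0 < δ) (hδ1 : δ ≤ 1) (hr : a < r) (hd : DifferentiableAt ℝ u r) (hN : |u r| ≤ N)
    (hP : |u r| ≤ P * (r - a)) (hQ : |deriv u r| ≤ Q) :
    |deriv (fun r => cutIn a δ r * (cutOut δ r * u r)) r| ≤ L * P + L * N + Q := by
  have h : HasDerivAt (fun r => cutIn a δ r * (cutOut δ r * u r))
      (deriv Real.smoothTransition ((r - a) / δ - 1) * δ⁻¹ * (cutOut δ r * u r)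
        + cutIn a δ r * (deriv Real.smoothTransition (2 - δ * r) * (-δ) * u r
          + cutOut δ r * deriv u r)) r :=
    (hasDerivAt_cutIn a δ r).mul ((hasDerivAt_cutOut δ r).mul hd.hasDerivAt)
  have hP0 : 0 ≤ P := by
    have := (abs_nonneg _).trans hP
    by_contra! hneg
    nlinarith
  rw [h.deriv]
  set s := (r - a) / δ - 1 with hs
  have hsa : (s + 1) * δ = r - a := by rw [hs]; field_simp; ring
  -- The factor `δ⁻¹` of the inner cutoff is paid by `|u| ≤ P (r - a) = P (s + 1) δ`. The outer
  -- cutoff in `b2` only produces a factor `δ ≤ 1`.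
  have b1 : |deriv Real.smoothTransition s * δ⁻¹ * (cutOut δ r * u r)| ≤ L * P := by
    have e1 : |u r| ≤ P * ((s + 1) * δ) := hsa ▸ hP
    have hs1 : 0 < s + 1 := by
      have : 0 < (s + 1) * δ := by rw [hsa]; linarith
      exact pos_of_mul_pos_left this hδ.le
    rw [abs_mul, abs_mul, abs_mul, abs_of_nonneg cutOut_nonneg, abs_of_pos (inv_pos.2 hδ)]
    have e2 : cutOut δ r * |u r| ≤ P * ((s + 1) * δ) :=
      (mul_le_of_le_one_left (abs_nonneg _) cutOut_le_one).trans e1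
    calc _ ≤ |deriv Real.smoothTransition s| * δ⁻¹ * (P * ((s + 1) * δ)) := by gcongr
      _ = |(s + 1) * deriv Real.smoothTransition s| * P := by
          rw [abs_mul, abs_of_pos hs1]; field_simp
      _ ≤ L * P := by gcongr; exact hL1 s
  have b2 : |cutIn a δ r * (deriv Real.smoothTransition (2 - δ * r) * (-δ) * u r)| ≤ L * N := by
    rw [abs_mul, abs_mul, abs_mul, abs_neg, abs_of_pos hδ, abs_of_nonneg cutIn_nonneg]
    have e : |deriv Real.smoothTransition (2 - δ * r)| * δ * |u r| ≤ L * 1 * N := by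
      gcongr
      exact hL2 _
    refine (mul_le_of_le_one_left (by positivity) cutIn_le_one).trans (e.trans (by linarith))
  have b3 : |cutIn a δ r * (cutOut δ r * deriv u r)| ≤ Q := by
    rw [abs_mul, abs_mul, abs_of_nonneg cutIn_nonneg, abs_of_nonneg cutOut_nonneg]
    exact ((mul_le_of_le_one_left (mul_nonneg cutOut_nonneg (abs_nonneg _)) cutIn_le_one).trans
      (mul_le_of_le_one_left (abs_nonneg _) cutOut_le_one)).trans hQ
  rw [mul_add]
  have h1 := abs_add_le (deriv Real.smoothTransition s * δ⁻¹ * (cutOut δ r * u r))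
    (cutIn a δ r * (deriv Real.smoothTransition (2 - δ * r) * (-δ) * u r)
      + cutIn a δ r * (cutOut δ r * deriv u r))
  have h2 := abs_add_le (cutIn a δ r * (deriv Real.smoothTransition (2 - δ * r) * (-δ) * u r))
    (cutIn a δ r * (cutOut δ r * deriv u r))
  linarith

end RadialCutoffs

/-! ### A uniform bound of the gradient of the interior velocity -/

/-- Differentiating `μ⁴ = 1 + ψ²` gives `4 μ³ μ' = 2 ψ ψ'`, and `μ ≥ 1`. -/
theorem abs_deriv_le_of_pow_four {μ ψ : ℝ → ℝ} {s M₁ M₂ : ℝ} (hμ : DifferentiableAt ℝ μ s)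
    (hψ : DifferentiableAt ℝ ψ s) (h : ∀ s, μ s ^ 4 = 1 + ψ s ^ 2) (hpos : 0 < μ s)
    (h1 : |ψ s| ≤ M₁) (h2 : |deriv ψ s| ≤ M₂) :
    1 ≤ μ s ∧ μ s ^ 3 ≤ 1 + M₁ ^ 2 ∧ μ s ≤ 1 + M₁ ^ 2 ∧ |deriv μ s| ≤ M₁ * M₂ := by
  have hs := h s
  have hone : 1 ≤ μ s := by
    by_contra! hlt
    have : μ s ^ 4 < 1 := pow_lt_one₀ hpos.le hlt (by norm_num)
    nlinarith [sq_nonneg (ψ s)]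
  have hM : ψ s ^ 2 ≤ M₁ ^ 2 := by
    rw [← sq_abs]; exact pow_le_pow_left₀ (abs_nonneg _) h1 2
  have h34 : μ s ^ 3 ≤ μ s ^ 4 := pow_le_pow_right₀ hone (by norm_num)
  have h13 : μ s ≤ μ s ^ 3 := le_self_pow₀ hone (by norm_num)
  have hd1 : HasDerivAt (fun s => μ s ^ 4) (4 * μ s ^ 3 * deriv μ s) s := by
    simpa using hμ.hasDerivAt.fun_pow 4
  have hd2 : HasDerivAt (fun s => 1 + ψ s ^ 2) (2 * ψ s * deriv ψ s) s := by
    simpa using (hψ.hasDerivAt.fun_pow 2).const_add 1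
  have he : 4 * μ s ^ 3 * deriv μ s = 2 * ψ s * deriv ψ s :=
    (hd1.congr_of_eventuallyEq (Eventually.of_forall fun σ => (h σ).symm)).unique hd2
  have habs : 4 * μ s ^ 3 * |deriv μ s| = 2 * |ψ s| * |deriv ψ s| := by
    have := congrArg abs he
    rw [abs_mul, abs_mul, abs_mul, abs_mul, abs_of_pos (pow_pos hpos 3)] at this
    simpa using this
  have hprod : |ψ s| * |deriv ψ s| ≤ M₁ * M₂ :=
    mul_le_mul h1 h2 (abs_nonneg _) ((abs_nonneg _).trans h1)
  refine ⟨hone, by linarith, by linarith, ?_⟩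
  have h3 : 1 ≤ μ s ^ 3 := by linarith
  nlinarith [abs_nonneg (deriv μ s), abs_nonneg (ψ s), abs_nonneg (deriv ψ s)]

theorem norm_partialD_le {V : Type*} [NormedAddCommGroup V] [NormedSpace ℝ V] {g : E3 → V} {C : ℝ}
    (hC : 0 ≤ C) {x₀ : E3} (hg : DifferentiableAt ℝ g x₀)
    (h : ∀ᶠ x in 𝓝 x₀, ‖g x - g x₀‖ ≤ C * ‖x - x₀‖) (j : Fin 3) : ‖partialD j g x₀‖ ≤ C := by
  have h1 := hg.hasFDerivAt.le_of_lip' hC h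
  refine ((fderiv ℝ g x₀).le_opNorm _).trans ?_
  simpa using h1

namespace Basin

variable (B : Basin)

theorem abs_deriv_lam_mul_le {s M₁ M₂ H : ℝ} (hμ : ∀ s, B.μ s ^ 4 = 1 + deriv B.φ s ^ 2)
    (h1 : |deriv B.φ s| ≤ M₁) (h2 : |deriv (deriv B.φ) s| ≤ M₂) (hH : B.φ s ≤ H) :
    |deriv B.lam s| * B.φ s ^ 2 ≤ B.sq * (M₁ * (2 + M₁ ^ 2) + H * (M₁ * M₂)) := by
  have hφ := B.φ_pos s
  have hq := B.sq_pos
  have hdφ : DifferentiableAt ℝ B.φ s := B.smooth_φ.differentiable (by simp) s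
  have hdμ : DifferentiableAt ℝ B.μ s := B.smooth_μ.differentiable (by simp) s
  have hdφ' : DifferentiableAt ℝ (deriv B.φ) s :=
    (contDiff_infty_iff_deriv.1 B.smooth_φ).2.differentiable (by simp) s
  obtain ⟨hone, -, hμle, hμ'⟩ := abs_deriv_le_of_pow_four hdμ hdφ' hμ (B.μ_pos s) h1 h2
  have hlam : HasDerivAt B.lam ((0 * B.φ s - B.sq * deriv B.φ s) / B.φ s ^ 2 * ((1 + B.μ s) / 2)
      + B.sq / B.φ s * (deriv B.μ s / 2)) s :=
    ((hasDerivAt_const s B.sq).div hdφ.hasDerivAt hφ.ne').mul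
      ((hdμ.hasDerivAt.const_add 1).div_const 2)
  have hM1 : 0 ≤ M₁ := (abs_nonneg _).trans h1
  have e : deriv B.lam s * B.φ s ^ 2
      = B.sq * (-(deriv B.φ s * ((1 + B.μ s) / 2)) + B.φ s * (deriv B.μ s / 2)) := by
    rw [hlam.deriv]; field_simp; ring
  have b1 : |deriv B.φ s * ((1 + B.μ s) / 2)| ≤ M₁ * (2 + M₁ ^ 2) := by
    rw [abs_mul, abs_of_nonneg (show 0 ≤ (1 + B.μ s) / 2 by linarith)]
    exact mul_le_mul h1 (by nlinarith) (by linarith) hM1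
  have b2 : |B.φ s * (deriv B.μ s / 2)| ≤ H * (M₁ * M₂) := by
    rw [abs_mul, abs_of_pos hφ]
    refine mul_le_mul hH ?_ (abs_nonneg _) (hφ.le.trans hH)
    rw [abs_div, abs_two]
    linarith [abs_nonneg (deriv B.μ s)]
  calc |deriv B.lam s| * B.φ s ^ 2 = |deriv B.lam s * B.φ s ^ 2| := by
        rw [abs_mul, abs_of_pos (pow_pos hφ 2)]
    _ = B.sq * |-(deriv B.φ s * ((1 + B.μ s) / 2)) + B.φ s * (deriv B.μ s / 2)| := by
        rw [e, abs_mul, abs_of_pos hq]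
    _ ≤ _ := by
        refine mul_le_mul_of_nonneg_left ((abs_add_le _ _).trans ?_) hq.le
        rw [abs_neg]
        exact add_le_add b1 b2

theorem norm_partialD_V0_le {M₁ M₂ M₃ M₄ t : ℝ} (ht : 0 ≤ t) {x : E3} (hx : x ∈ B.D) (j : Fin 3)
    (hμ : 1 ≤ B.μ (B.r x)) (hc : 2 * B.c * B.φ (B.r x) ≤ B.sq)
    (h1 : |B.f (B.r x)| ≤ M₁ * B.φ (B.r x)) (h2 : |deriv B.lam (B.r x)| * B.φ (B.r x) ^ 2 ≤ M₂)
    (h3 : |deriv B.f (B.r x)| ≤ M₃) (hr : |partialD j B.r x| ≤ 1)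
    (h4 : ‖partialD j B.tau x‖ ≤ M₄) :
    ‖partialD j (B.V0 t) x‖ ≤ (M₃ + 2 * M₁ * M₂ / B.sq + B.N * M₄) * Real.exp (-B.c * t) := by
  have hφ := B.φ_pos (B.r x)
  have hq := B.sq_pos
  set s := B.r x with hs
  set e := Real.exp (-t * B.lam s) with he
  have he0 : 0 < e := Real.exp_pos _
  have hk : B.sq / B.φ s ≤ B.lam s := by
    rw [lam]
    exact le_mul_of_one_le_right (by positivity) (by linarith)
  have hck : 2 * B.c ≤ B.sq / B.φ s := (le_div_iff₀ hφ).2 hc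
  have hec : e ≤ Real.exp (-B.c * t) := by
    rw [he]
    refine Real.exp_le_exp.2 ?_
    nlinarith [B.c_pos]
  set k := B.sq / B.φ s with hkdef
  have hk0 : 0 < k := by positivity
  have hte : t * k * e ≤ 2 * Real.exp (-B.c * t) := by
    have e1 : e ≤ Real.exp (-(t * k)) := Real.exp_le_exp.2 (by nlinarith)
    have e2 := mul_exp_neg_le (s := t * k)
    have e3 : Real.exp (-(t * k / 2)) ≤ Real.exp (-B.c * t) := Real.exp_le_exp.2 (by nlinarith)
    have e4 : t * k * e ≤ t * k * Real.exp (-(t * k)) :=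
      mul_le_mul_of_nonneg_left e1 (by positivity)
    linarith
  have hM1 : 0 ≤ M₁ := by
    by_contra! hneg
    nlinarith [abs_nonneg (B.f s)]
  have hM2 : 0 ≤ M₂ := le_trans (by positivity) h2
  set g : ℝ → ℝ := fun σ => Real.exp (-t * B.lam σ) * B.f σ with hg
  have hgd : HasDerivAt g (e * (-t * deriv B.lam s) * B.f s + e * deriv B.f s) s :=
    (((B.smooth_lam.differentiable (by simp) s).hasDerivAt.const_mul (-t)).exp).mul
      (B.smooth_f.differentiable (by simp) s).hasDerivAt
  have hgs : ContDiff ℝ ∞ g := (contDiff_const.mul B.smooth_lam).exp.mul B.smooth_f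
  have hV : B.V0 t = fun x => g (B.r x) • B.tau x := by
    funext y
    rw [V0, smul_smul]; rfl
  have hform : partialD j (B.V0 t) x
      = g s • partialD j B.tau x + ((e * (-t * deriv B.lam s) * B.f s + e * deriv B.f s)
        * partialD j B.r x) • B.tau x := by
    have h5 : ContDiff ℝ ∞ fun x => g (B.r x) := hgs.comp B.smooth_r
    have h6 := partialD_comp B.smooth_r j x hgd
    rw [hV, ← h6]
    have h7 := ((contDiff_diff h5 x).hasFDerivAt.smul
      (contDiff_diff B.smooth_tau x).hasFDerivAt).fderiv
    unfold partialD
    refine (congrArg (fun A : E3 →L[ℝ] E3 => A (EuclideanSpace.single j 1)) h7).trans ?_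
    simp
    rfl
  have b1 : |e * (-t * deriv B.lam s) * B.f s| ≤ 2 * M₁ * M₂ / B.sq * Real.exp (-B.c * t) := by
    rw [abs_mul, abs_mul, abs_mul, abs_neg, abs_of_pos he0, abs_of_nonneg ht]
    have hl : |deriv B.lam s| ≤ M₂ / B.φ s ^ 2 := (le_div_iff₀ (pow_pos hφ 2)).2 h2
    calc e * (t * |deriv B.lam s|) * |B.f s| ≤ e * (t * (M₂ / B.φ s ^ 2)) * (M₁ * B.φ s) := by
          gcongr
      _ = M₁ * M₂ / B.sq * (t * k * e) := by rw [hkdef]; field_simp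
      _ ≤ M₁ * M₂ / B.sq * (2 * Real.exp (-B.c * t)) := by gcongr
      _ = _ := by ring
  have b2 : |e * deriv B.f s| ≤ M₃ * Real.exp (-B.c * t) := by
    rw [abs_mul, abs_of_pos he0, mul_comm]
    exact mul_le_mul h3 hec he0.le ((abs_nonneg _).trans h3)
  have b3 : ‖g s • partialD j B.tau x‖ ≤ B.N * M₄ * Real.exp (-B.c * t) := by
    rw [norm_smul, hg, norm_mul, Real.norm_eq_abs, Real.norm_eq_abs, abs_of_pos (Real.exp_pos _)]
    have hN := B.N_nonneg
    have hM4 := (norm_nonneg _).trans h4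
    calc _ ≤ Real.exp (-B.c * t) * B.N * M₄ := by
          refine mul_le_mul (mul_le_mul hec (B.amp _) (abs_nonneg _) (Real.exp_nonneg _)) h4
            (norm_nonneg _) (by positivity)
      _ = _ := by ring
  rw [hform]
  refine (norm_add_le _ _).trans ?_
  rw [norm_smul _ (B.tau x), B.norm_tau hx.1, mul_one, norm_mul, Real.norm_eq_abs,
    Real.norm_eq_abs]
  have b4 := (abs_add_le (e * (-t * deriv B.lam s) * B.f s) (e * deriv B.f s)).trans
    (add_le_add b1 b2)
  have b5 := mul_le_of_le_one_right
    (abs_nonneg (e * (-t * deriv B.lam s) * B.f s + e * deriv B.f s)) hr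
  linarith

end Basin

/-! ### Truncated data -/

/-- The data of the problem, together with bounds. -/
structure OceanData where
  (Γ : Set E2)
  (ρ₀ H β N M : ℝ)
  (φ u : ℝ → ℝ)
  island : IsIsland Γ
  ρ₀_pos : 0 < ρ₀
  H_pos : 0 < H
  β_pos : 0 < β
  smooth_φ : ContDiffOn ℝ ∞ φ (Ioi ρ₀)
  smooth_u : ContDiffOn ℝ ∞ u (Ioi ρ₀)
  φ_pos : ∀ r ∈ Ioi ρ₀, 0 < φ r
  φ_le : ∀ r ∈ Ioi ρ₀, φ r ≤ H
  abs_deriv_φ_le : ∀ r ∈ Ioi ρ₀, |deriv φ r| ≤ M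
  abs_u_le : ∀ r ∈ Ioi ρ₀, |u r| ≤ N

theorem hor_single (j : Fin 3) (v : E2) :
    inner ℝ v (hor (EuclideanSpace.single j 1)) = (pt v 0) j := by
  fin_cases j <;> simp [hor, pt, PiLp.inner_apply, Fin.sum_univ_two]

theorem norm_hor_le (x : E3) : ‖hor x‖ ≤ ‖x‖ := by
  rw [EuclideanSpace.norm_eq, EuclideanSpace.norm_eq]
  refine Real.sqrt_le_sqrt ?_
  simp [hor, Fin.sum_univ_two, Fin.sum_univ_three]
  positivity

theorem norm_pt_zero (v : E2) : ‖pt v 0‖ = ‖v‖ := by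
  rw [EuclideanSpace.norm_eq, EuclideanSpace.norm_eq]
  simp [pt, Fin.sum_univ_two, Fin.sum_univ_three]

theorem ezL_pt (v : E2) : ezL (pt v 0) = pt (perp v) 0 := by
  rw [ezL_apply]
  ext j; fin_cases j <;> simp [ezWedge, pt, perp]

namespace OceanData

variable (O : OceanData) {δ : ℝ}

/-- A positive smooth extension of the depth. -/
def φt (δ r : ℝ) : ℝ := 1 + cutIn O.ρ₀ (δ / 4) r * (O.φ r - 1)

/-- The fourth root of `1 + φ'²`. -/
def μt (δ r : ℝ) : ℝ := (1 + deriv (O.φt δ) r ^ 2) ^ (1 / 4 : ℝ)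

/-- The truncated profile. -/
def ft (δ r : ℝ) : ℝ := cutIn O.ρ₀ δ r * (cutOut δ r * O.u r)

/-- A globally smooth function which agrees with the distance away from the coast. -/
def Rt (δ : ℝ) (y : E2) : ℝ := cutIn O.ρ₀ (δ / 4) (rho O.Γ y) * rho O.Γ y

/-- The part of the surface on which the truncated profile lives. -/
def Kt (δ : ℝ) : Set E2 := rho O.Γ ⁻¹' Icc (O.ρ₀ + δ) (2 / δ)

theorem φt_eq (hδ : 0 < δ) {r : ℝ} (hr : O.ρ₀ + δ / 2 ≤ r) : O.φt δ r = O.φ r := by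
  rw [φt, cutIn_eq_one (by linarith) (by linarith)]; ring

theorem φt_eventuallyEq (hδ : 0 < δ) {r : ℝ} (hr : O.ρ₀ + δ / 2 < r) : O.φt δ =ᶠ[𝓝 r] O.φ := by
  filter_upwards [Ioi_mem_nhds hr] with s hs using O.φt_eq hδ (le_of_lt hs)

theorem smooth_φt (hδ : 0 < δ) : ContDiff ℝ ∞ (O.φt δ) :=
  contDiff_const.add (contDiff_cutIn_mul (by linarith) (O.smooth_φ.sub contDiffOn_const))

theorem φt_pos (hδ : 0 < δ) (r : ℝ) : 0 < O.φt δ r := by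
  rcases lt_or_ge O.ρ₀ r with hr | hr
  · have h := O.φ_pos r hr
    have h1 := cutIn_nonneg (a := O.ρ₀) (δ := δ / 4) (r := r)
    have h2 := cutIn_le_one (a := O.ρ₀) (δ := δ / 4) (r := r)
    rw [φt]
    rcases h2.lt_or_eq with h3 | h3
    · nlinarith
    · rw [h3]; linarith
  · rw [φt, cutIn_eq_zero (by linarith) (by linarith)]; norm_num

theorem smooth_deriv_φt (hδ : 0 < δ) : ContDiff ℝ ∞ (deriv (O.φt δ)) :=
  (contDiff_infty_iff_deriv.1 (O.smooth_φt hδ)).2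

theorem smooth_μt (hδ : 0 < δ) : ContDiff ℝ ∞ (O.μt δ) :=
  (contDiff_const.add ((O.smooth_deriv_φt hδ).pow 2)).rpow_const_of_ne
    fun r => by positivity

theorem μt_pos (δ r : ℝ) : 0 < O.μt δ r := Real.rpow_pos_of_pos (by positivity) _

theorem μt_pow (δ r : ℝ) : O.μt δ r ^ 4 = 1 + deriv (O.φt δ) r ^ 2 := by
  rw [μt, ← Real.rpow_natCast, ← Real.rpow_mul (by positivity)]
  norm_num

theorem smooth_ft (hδ : 0 < δ) : ContDiff ℝ ∞ (O.ft δ) :=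
  contDiff_cutIn_mul hδ (contDiff_cutOut.contDiffOn.mul O.smooth_u)

theorem ft_eq_zero_of_le (hδ : 0 < δ) {r : ℝ} (hr : r ≤ O.ρ₀ + δ) : O.ft δ r = 0 := by
  rw [ft, cutIn_eq_zero hδ hr, zero_mul]

theorem ft_eq_zero_of_ge (hδ : 0 < δ) {r : ℝ} (hr : 2 / δ ≤ r) : O.ft δ r = 0 := by
  rw [ft, cutOut_eq_zero hδ hr, zero_mul, mul_zero]

theorem abs_ft_le (δ r : ℝ) : |O.ft δ r| ≤ |O.u r| := by
  rw [ft, abs_mul, abs_mul, abs_of_nonneg cutIn_nonneg, abs_of_nonneg cutOut_nonneg]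
  exact (mul_le_of_le_one_left (mul_nonneg cutOut_nonneg (abs_nonneg _)) cutIn_le_one).trans
    (mul_le_of_le_one_left (abs_nonneg _) cutOut_le_one)

theorem N_nonneg : 0 ≤ O.N :=
  (abs_nonneg _).trans (O.abs_u_le (O.ρ₀ + 1) (by simp))

theorem rho_nonneg (y : E2) : 0 ≤ rho O.Γ y := Metric.infDist_nonneg

theorem Rt_eq (hδ : 0 < δ) {y : E2} (hy : O.ρ₀ + δ / 2 ≤ rho O.Γ y) : O.Rt δ y = rho O.Γ y := by
  rw [Rt, cutIn_eq_one (by linarith) (by linarith), one_mul]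

theorem Rt_le (y : E2) : O.Rt δ y ≤ rho O.Γ y :=
  mul_le_of_le_one_left (O.rho_nonneg y) cutIn_le_one

theorem Rt_eventuallyEq (hδ : 0 < δ) {y : E2} (hy : O.ρ₀ + δ / 2 < rho O.Γ y) :
    O.Rt δ =ᶠ[𝓝 y] rho O.Γ := by
  filter_upwards [(isOpen_Ioi.preimage continuous_rho).mem_nhds hy] with y' hy'
    using O.Rt_eq hδ (le_of_lt hy')

theorem smooth_Rt (hδ : 0 < δ) : ContDiff ℝ ∞ (O.Rt δ) := by
  rw [contDiff_iff_contDiffAt]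
  intro y
  rcases lt_or_ge O.ρ₀ (rho O.Γ y) with hy | hy
  · have h := O.island.contDiffAt_rho (notMem_of_rho_pos (O.ρ₀_pos.trans hy))
    exact (contDiff_cutIn.contDiffAt.comp y h).mul h
  · refine (contDiffAt_const (c := (0 : ℝ))).congr_of_eventuallyEq ?_
    filter_upwards [(isOpen_Iio.preimage (continuous_rho (Γ := O.Γ))).mem_nhds
      (show rho O.Γ y < O.ρ₀ + δ / 4 by linarith)] with y' hy'
    rw [Rt, cutIn_eq_zero (by linarith) (le_of_lt hy'), zero_mul]

theorem compact_Kt (δ : ℝ) : IsCompact (O.Kt δ) := by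
  refine (O.island.compact.cthickening (r := 2 / δ)).of_isClosed_subset
    (isClosed_Icc.preimage continuous_rho) fun y hy => ?_
  obtain ⟨p, hp⟩ := O.island.exists_isNearest y
  refine Metric.mem_cthickening_of_dist_le y p _ _ hp.1 ?_
  rw [dist_eq_norm, ← hp.infDist_eq]
  exact hy.2

theorem supp_Kt (hδ : 0 < δ) {y : E2} (hy : y ∉ O.Kt δ) : O.ft δ (O.Rt δ y) = 0 := by
  rcases le_or_gt (O.ρ₀ + δ) (rho O.Γ y) with h | h
  · rw [O.Rt_eq hδ (by linarith)]
    refine O.ft_eq_zero_of_ge hδ ?_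
    by_contra! hlt
    exact hy ⟨h, hlt.le⟩
  · exact O.ft_eq_zero_of_le hδ ((O.Rt_le y).trans h.le)

theorem hasFDerivAt_rho {y : E2} (hy : 0 < rho O.Γ y) :
    HasFDerivAt (rho O.Γ) (innerSL ℝ (gradient (rho O.Γ) y)) y := by
  have h := ((O.island.contDiffAt_rho (notMem_of_rho_pos hy)).differentiableAt
    (by simp)).hasGradientAt
  exact (hasGradientAt_iff_hasFDerivAt.1 h).congr_fderiv (by ext v; simp)

theorem partialD_Rt (hδ : 0 < δ) {x : E3} (hx : O.ρ₀ + δ / 2 < rho O.Γ (hor x)) (j : Fin 3) :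
    partialD j (O.Rt δ ∘ hor) x = (pt (gradient (rho O.Γ) (hor x)) 0) j := by
  have h0 : 0 < rho O.Γ (hor x) := by linarith [O.ρ₀_pos]
  have h1 := (O.hasFDerivAt_rho h0).congr_of_eventuallyEq (O.Rt_eventuallyEq hδ hx)
  have h2 : HasFDerivAt hor horL x := by
    have := horL.hasFDerivAt (x := x)
    rwa [show (horL : E3 → E2) = hor from funext horL_apply] at this
  rw [partialD, (h1.comp x h2).fderiv, ← hor_single]
  simp [horL_apply]

theorem grd_Rt (hδ : 0 < δ) {x : E3} (hx : O.ρ₀ + δ / 2 < rho O.Γ (hor x)) :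
    grd (O.Rt δ ∘ hor) x = pt (gradient (rho O.Γ) (hor x)) 0 := by
  ext j
  rw [grd_apply, O.partialD_Rt hδ hx]

theorem abs_deriv_φt_le (hδ : 0 < δ) {r : ℝ} (hr : O.ρ₀ + δ / 2 < r) :
    |deriv (O.φt δ) r| ≤ O.M := by
  rw [(O.φt_eventuallyEq hδ hr).deriv_eq]
  exact O.abs_deriv_φ_le r (show O.ρ₀ < r by linarith)

theorem one_le_μt (δ r : ℝ) : 1 ≤ O.μt δ r := by
  by_contra! hlt
  have : O.μt δ r ^ 4 < 1 := pow_lt_one₀ (O.μt_pos δ r).le hlt (by norm_num)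
  rw [O.μt_pow] at this
  nlinarith [sq_nonneg (deriv (O.φt δ) r)]

/-- The data for the construction of the approximate solution with the truncated profile. -/
def basin (hδ : 0 < δ) : Basin where
  β := O.β
  c := √(2 * O.β) / (2 * O.H)
  sM := √(2 * O.β) * (1 + O.M ^ 2)
  N := O.N
  φ := O.φt δ
  μ := O.μt δ
  f := O.ft δ
  R := O.Rt δ
  K := O.Kt δ
  β_pos := O.β_pos
  c_pos := div_pos (Real.sqrt_pos.2 (mul_pos two_pos O.β_pos)) (mul_pos two_pos O.H_pos)
  smooth_φ := O.smooth_φt hδ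
  smooth_μ := O.smooth_μt hδ
  smooth_f := O.smooth_ft hδ
  smooth_R := O.smooth_Rt hδ
  φ_pos := O.φt_pos hδ
  μ_pos := O.μt_pos δ
  compact_K := O.compact_Kt δ
  supp _ hy := O.supp_Kt hδ hy
  unit x hx := by
    have h : O.ρ₀ + δ / 2 < rho O.Γ (hor x) := by have := hx.1; linarith
    rw [O.partialD_Rt hδ h, O.partialD_Rt hδ h]
    have h1 := norm_gradient_rho O.island (show 0 < rho O.Γ (hor x) by linarith [O.ρ₀_pos])
    have h2 := EuclideanSpace.norm_sq_eq (gradient (rho O.Γ) (hor x))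
    rw [h1, Fin.sum_univ_two] at h2
    simpa [pt] using h2.symm
  slope y _ := O.μt_pow δ _
  rate y hy := by
    have h1 : O.ρ₀ + δ ≤ rho O.Γ y := hy.1
    have hφ := O.φ_pos _ (show O.ρ₀ < rho O.Γ y by linarith)
    have hφH := O.φ_le _ (show O.ρ₀ < rho O.Γ y by linarith)
    have hH := O.H_pos
    rw [O.Rt_eq hδ (by linarith), O.φt_eq hδ (by linarith)]
    have hμ := O.one_le_μt δ (rho O.Γ y)
    have h2 : √(2 * O.β) / O.H ≤ √(2 * O.β) / O.φ (rho O.Γ y) := by gcongr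
    calc 2 * (√(2 * O.β) / (2 * O.H)) = √(2 * O.β) / O.H := by field_simp
      _ ≤ √(2 * O.β) / O.φ (rho O.Γ y) := h2
      _ ≤ _ := le_mul_of_one_le_right (by positivity) (by linarith)
  width y hy := by
    have h1 : O.ρ₀ + δ ≤ rho O.Γ y := hy.1
    rw [O.Rt_eq hδ (by linarith)]
    have h2 := O.abs_deriv_φt_le hδ (show O.ρ₀ + δ / 2 < rho O.Γ y by linarith)
    have h3 : O.μt δ (rho O.Γ y) ^ 3 ≤ O.μt δ (rho O.Γ y) ^ 4 :=
      pow_le_pow_right₀ (O.one_le_μt δ _) (by norm_num)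
    rw [O.μt_pow] at h3
    have h4 := pow_le_pow_left₀ (abs_nonneg _) h2 2
    rw [sq_abs] at h4
    gcongr
    linarith
  width' := le_mul_of_one_le_right (Real.sqrt_nonneg _) (by nlinarith [sq_nonneg O.M])
  amp s := by
    rcases lt_or_ge O.ρ₀ s with hs | hs
    · exact (O.abs_ft_le δ s).trans (O.abs_u_le s hs)
    · rw [O.ft_eq_zero_of_le hδ (by linarith), abs_zero]; exact O.N_nonneg

/-- The ocean. -/
def Om : Set E3 := ocean O.Γ O.ρ₀ O.φ

theorem isOpen_Om : IsOpen O.Om := by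
  have h1 : IsOpen (hor ⁻¹' surface O.Γ O.ρ₀) := isOpen_surface.preimage continuous_hor
  have hc : ContinuousOn (fun x : E3 => O.φ (rho O.Γ (hor x)) + x 2)
      (hor ⁻¹' surface O.Γ O.ρ₀) := by
    refine ContinuousOn.add (O.smooth_φ.continuousOn.comp
      (continuous_rho.comp continuous_hor).continuousOn fun x hx => mem_surface_iff.1 hx) ?_
    exact (contDiff_crd 2).continuous.continuousOn
  have h2 := hc.isOpen_inter_preimage h1 (isOpen_Ioi (a := (0 : ℝ)))
  have h3 : IsOpen {x : E3 | x 2 < 0} := isOpen_lt (contDiff_crd 2).continuous continuous_const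
  convert h2.inter h3 using 1
  ext x
  simp only [Om, ocean, mem_ofPred_eq, mem_inter_iff, mem_preimage, mem_Ioi]
  constructor
  · rintro ⟨a, b, c⟩; exact ⟨⟨a, by linarith⟩, c⟩
  · rintro ⟨⟨a, b⟩, c⟩; exact ⟨a, by linarith, c⟩

theorem fits (hδ : 0 < δ) : (O.basin hδ).Fits O.Om where
  open_Ω := O.isOpen_Om
  mem_iff x hx := by
    have h1 : O.ρ₀ + δ ≤ rho O.Γ (hor x) := hx.1
    have h2 : hor x ∈ surface O.Γ O.ρ₀ := mem_surface_iff.2 (by linarith)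
    have h3 : (O.basin hδ).φ ((O.basin hδ).r x) = O.φ (rho O.Γ (hor x)) := by
      change O.φt δ (O.Rt δ (hor x)) = _
      rw [O.Rt_eq hδ (by linarith), O.φt_eq hδ (by linarith)]
    rw [h3]
    exact ⟨fun h => h.2, fun h => ⟨h2, h⟩⟩
  tail := by
    obtain ⟨P, hP⟩ := O.island.compact.isBounded.subset_closedBall (0 : E2)
    refine ⟨2 / δ, P + (2 / δ + O.ρ₀ + δ) + O.H, fun s hs => O.ft_eq_zero_of_ge hδ hs,
      fun x hx hn => ?_⟩
    have h1 : O.ρ₀ < rho O.Γ (hor x) := mem_surface_iff.1 hx.1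
    have hφH := O.φ_le _ h1
    have hz : |x 2| ≤ O.H := abs_le.2 ⟨by linarith [hx.2.1], by linarith [hx.2.2, O.H_pos]⟩
    have hx3 : ‖x‖ ≤ ‖hor x‖ + |x 2| := by
      have e : x = pt (hor x) 0 + x 2 • bas 2 := by
        ext j; fin_cases j <;> simp [pt, hor]
      have := norm_add_le (pt (hor x) 0) (x 2 • bas 2)
      rw [← e, norm_pt_zero, norm_smul] at this
      simpa [bas] using this
    obtain ⟨p, hp⟩ := O.island.exists_isNearest (hor x)
    have hp' : ‖p‖ ≤ P := by simpa using hP hp.1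
    have h3 : ‖hor x‖ ≤ rho O.Γ (hor x) + ‖p‖ := by
      have h4 : rho O.Γ (hor x) = ‖hor x - p‖ := hp.infDist_eq
      rw [h4]
      have := norm_add_le (hor x - p) p
      rwa [sub_add_cancel] at this
    have h5 : 2 / δ + O.ρ₀ + δ ≤ rho O.Γ (hor x) := by linarith
    have h6 : 0 < 2 / δ := by positivity
    change 2 / δ ≤ O.Rt δ (hor x)
    rw [O.Rt_eq hδ (by linarith)]
    linarith [O.ρ₀_pos]

end OceanData

/-! ### Estimates for the truncated data -/

theorem measurePreserving_pt :
    MeasurePreserving (fun q : ℝ × E2 => pt q.2 q.1) volume volume := by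
  have h1 := (volume_preserving_piFinSuccAbove (fun _ : Fin 3 => ℝ) 2).symm
  have h2 := PiLp.volume_preserving_toLp (Fin 3)
  have h3 : MeasurePreserving (Prod.map (id : ℝ → ℝ) (WithLp.ofLp : E2 → Fin 2 → ℝ))
      volume volume := (MeasurePreserving.id volume).prod (PiLp.volume_preserving_ofLp (Fin 2))
  have e : (fun q : ℝ × E2 => pt q.2 q.1) = WithLp.toLp 2 ∘
      (MeasurableEquiv.piFinSuccAbove (fun _ : Fin 3 => ℝ) 2).symm ∘ Prod.map id WithLp.ofLp := by
    funext q
    ext i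
    fin_cases i <;> rfl
  rw [e]
  exact h2.comp (h1.comp h3)

namespace OceanData

variable (O : OceanData) {δ : ℝ}

theorem rho_hor_gt {x : E3} (hx : x ∈ O.Om) : O.ρ₀ < rho O.Γ (hor x) := mem_surface_iff.1 hx.1

theorem lintegral_hor_le {g : E2 → ℝ≥0∞}
    (hg : AEMeasurable g (volume.restrict (surface O.Γ O.ρ₀))) :
    ∫⁻ x in O.Om, g (hor x) ≤ ENNReal.ofReal O.H * ∫⁻ y in surface O.Γ O.ρ₀, g y := by
  have hle : (volume.restrict O.Om).map hor
      ≤ ENNReal.ofReal O.H • volume.restrict (surface O.Γ O.ρ₀) := by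
    refine Measure.le_iff.2 fun S hS => ?_
    have hmS : MeasurableSet (hor ⁻¹' S) := continuous_hor.measurable hS
    rw [Measure.map_apply continuous_hor.measurable hS, Measure.restrict_apply hmS,
      Measure.smul_apply, Measure.restrict_apply hS, smul_eq_mul,
      ← measurePreserving_pt.measure_preimage
        (hmS.inter O.isOpen_Om.measurableSet).nullMeasurableSet]
    have hsub : (fun q : ℝ × E2 => pt q.2 q.1) ⁻¹' (hor ⁻¹' S ∩ O.Om)
        ⊆ Ioo (-O.H) 0 ×ˢ (S ∩ surface O.Γ O.ρ₀) := by
      rintro ⟨z, y⟩ ⟨h1, h2⟩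
      have h3 : y ∈ surface O.Γ O.ρ₀ := by simpa using h2.1
      have h4 := h2.2.1
      have h5 := h2.2.2
      rw [hor_pt, pt_two] at h4
      rw [pt_two] at h5
      have h6 := O.φ_le _ (mem_surface_iff.1 h3)
      have h1' : y ∈ S := by simpa using h1
      exact ⟨⟨show -O.H < z by linarith, h5⟩, h1', h3⟩
    refine (measure_mono hsub).trans (le_of_eq ?_)
    rw [Measure.volume_eq_prod, Measure.prod_prod, Real.volume_Ioo]
    simp
  have hg' : AEMeasurable g ((volume.restrict O.Om).map hor) :=
    (hg.smul_measure _).mono_measure hle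
  rw [← lintegral_map' hg' continuous_hor.aemeasurable]
  refine (lintegral_mono' hle (le_refl g)).trans (le_of_eq ?_)
  rw [lintegral_smul_measure, smul_eq_mul]

theorem continuousOn_comp_rho {g : ℝ → ℝ} (hg : ContinuousOn g (Ioi O.ρ₀)) :
    ContinuousOn (fun x : E3 => g (rho O.Γ (hor x))) O.Om :=
  hg.comp (continuous_rho.comp continuous_hor).continuousOn fun _ hx => O.rho_hor_gt hx

theorem continuousOn_azimuthal {g : ℝ → ℝ} (hg : ContinuousOn g (Ioi O.ρ₀)) :
    ContinuousOn (azimuthal O.Γ g) O.Om := by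
  have h1 : ContinuousOn (fun x : E3 => gradient (rho O.Γ) (hor x)) O.Om := by
    refine ContinuousOn.comp (g := gradient (rho O.Γ)) (t := surface O.Γ O.ρ₀) (fun y hy => ?_)
      continuous_hor.continuousOn fun x hx => hx.1
    exact (contDiffAt_gradient_rho O.island
      (O.ρ₀_pos.trans (mem_surface_iff.1 hy))).continuousAt.continuousWithinAt
  have h2 : ContinuousOn (fun x : E3 => g (rho O.Γ (hor x)) • ezL (pt (gradient (rho O.Γ) (hor x)) 0))
      O.Om := by
    refine (O.continuousOn_comp_rho hg).smul (ezL.continuous.comp_continuousOn ?_)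
    have : Continuous fun y : E2 => pt y 0 := by
      unfold pt
      fun_prop
    exact this.comp_continuousOn h1
  refine h2.congr fun x _ => ?_
  simp only [ezL_pt]
  ext j; fin_cases j <;> simp [azimuthal, azimuthalH, pt]

theorem norm_azimuthal (g : ℝ → ℝ) {x : E3} (hx : x ∈ O.Om) :
    ‖azimuthal O.Γ g x‖ = |g (rho O.Γ (hor x))| := by
  rw [azimuthal, norm_pt_zero, azimuthalH, norm_smul, norm_perp,
    norm_gradient_rho O.island (O.ρ₀_pos.trans (O.rho_hor_gt hx)), mul_one, Real.norm_eq_abs]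

theorem azimuthal_sub (f g : ℝ → ℝ) (x : E3) :
    azimuthal O.Γ f x - azimuthal O.Γ g x = azimuthal O.Γ (fun r => f r - g r) x := by
  ext j; fin_cases j <;> simp [azimuthal, azimuthalH, pt] <;> ring

theorem pumping_nonneg {r : ℝ} (hr : O.ρ₀ < r) : 0 ≤ pumping O.β O.φ r := by
  have := O.φ_pos r hr
  unfold pumping
  positivity

theorem continuousOn_pumping : ContinuousOn (pumping O.β O.φ) (Ioi O.ρ₀) := by
  have h1 := O.smooth_φ.continuousOn
  have h2 : ContinuousOn (deriv O.φ) (Ioi O.ρ₀) :=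
    O.smooth_φ.continuousOn_deriv_of_isOpen isOpen_Ioi (by simp)
  refine (continuousOn_const.div h1 fun r hr => (O.φ_pos r hr).ne').mul
    ((continuousOn_const.add ?_).div_const 2)
  exact (continuousOn_const.add (h2.pow 2)).rpow_const fun r _ => Or.inr (by norm_num)

/-! #### The truncation error -/

/-- The error in `L²` which is made when the profile is truncated. -/
def gap (δ : ℝ) : ℝ≥0∞ :=
  eLpNorm (fun x => O.u (rho O.Γ (hor x)) - O.ft δ (rho O.Γ (hor x))) 2 (volume.restrict O.Om)

theorem tendsto_gap (h : ∫⁻ y in surface O.Γ O.ρ₀, ‖O.u (rho O.Γ y)‖ₑ ^ 2 ≠ ⊤) :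
    Tendsto (fun n : ℕ => O.gap (1 / (n + 1))) atTop (𝓝 0) := by
  have hu := O.smooth_u.continuousOn
  have hpos : ∀ n : ℕ, (0 : ℝ) < 1 / (n + 1) := fun n => by positivity
  have hΩ := O.isOpen_Om.measurableSet
  refine tendsto_eLpNorm_two_zero_of_dominated (b := fun x => |O.u (rho O.Γ (hor x))| +
    |O.u (rho O.Γ (hor x))|) (fun n => ?_) ?_ (Eventually.of_forall fun n =>
      Eventually.of_forall fun x => ?_) ?_
  · exact ((O.continuousOn_comp_rho hu).sub (O.continuousOn_comp_rho
      (O.smooth_ft (hpos n)).continuous.continuousOn)).aestronglyMeasurable hΩ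
  · have h1 : eLpNorm (fun x => |O.u (rho O.Γ (hor x))|) 2 (volume.restrict O.Om) < ⊤ := by
      rw [eLpNorm_lt_top_iff_lintegral_rpow_enorm_lt_top (by simp) (by simp)]
      have hm : AEMeasurable (fun y => ‖O.u (rho O.Γ y)‖ₑ ^ 2)
          (volume.restrict (surface O.Γ O.ρ₀)) := by
        refine (ContinuousOn.aemeasurable ?_ isOpen_surface.measurableSet).enorm.pow_const 2
        exact hu.comp continuous_rho.continuousOn fun y hy => mem_surface_iff.1 hy
      have h2 := O.lintegral_hor_le hm
      refine lt_of_le_of_lt (le_of_eq ?_)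
        (h2.trans_lt (ENNReal.mul_lt_top ENNReal.ofReal_lt_top h.lt_top))
      refine lintegral_congr fun x => ?_
      simp
    have hm : AEStronglyMeasurable (fun x => |O.u (rho O.Γ (hor x))|) (volume.restrict O.Om) :=
      ((O.continuousOn_comp_rho hu).abs).aestronglyMeasurable hΩ
    exact ((eLpNorm_add_le hm hm (by norm_num)).trans_lt (ENNReal.add_lt_top.2 ⟨h1, h1⟩)).ne
  · refine (norm_sub_le _ _).trans ?_
    rw [Real.norm_eq_abs, Real.norm_eq_abs]
    exact add_le_add le_rfl (O.abs_ft_le _ _)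
  · filter_upwards [ae_restrict_mem hΩ] with x hx
    have hr := O.rho_hor_gt hx
    set r := rho O.Γ (hor x)
    have hr0 : 0 < r := O.ρ₀_pos.trans hr
    refine tendsto_const_nhds.congr' ?_
    have hlim := tendsto_one_div_add_atTop_nhds_zero_nat (𝕜 := ℝ)
    filter_upwards [hlim.eventually_lt_const (show 0 < (r - O.ρ₀) / 2 by linarith),
      hlim.eventually_lt_const (show 0 < 1 / r by positivity)] with n h1 h2
    have h3 : r ≤ 1 / (1 / ((n : ℝ) + 1)) := by
      rw [le_div_iff₀ (hpos n)]
      rw [lt_div_iff₀ hr0] at h2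
      linarith
    rw [ft, cutIn_eq_one (hpos n) (by linarith), cutOut_eq_one (hpos n) h3]
    simp

theorem ft_eq_zero_of_notMem {x : E3} (hδ : 0 < δ) (hK : hor x ∉ O.Kt δ) :
    O.ft δ (rho O.Γ (hor x)) = 0 := by
  rcases le_or_gt (rho O.Γ (hor x)) (O.ρ₀ + δ) with h | h
  · exact O.ft_eq_zero_of_le hδ h
  · refine O.ft_eq_zero_of_ge hδ ?_
    by_contra! hlt
    exact hK ⟨h.le, hlt.le⟩

theorem V0_eq (hδ : 0 < δ) (t : ℝ) (x : E3) :
    (O.basin hδ).V0 t x = limitField O.Γ O.β O.φ (O.ft δ) t x := by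
  by_cases hK : hor x ∈ O.Kt δ
  · have h1 : O.ρ₀ + δ ≤ rho O.Γ (hor x) := hK.1
    have hR : O.Rt δ (hor x) = rho O.Γ (hor x) := O.Rt_eq hδ (by linarith)
    have hlt : O.ρ₀ + δ / 2 < rho O.Γ (hor x) := by linarith
    have hlam : (O.basin hδ).Λ x = pumping O.β O.φ (rho O.Γ (hor x)) := by
      change √(2 * O.β) / O.φt δ (O.Rt δ (hor x)) * ((1 + O.μt δ (O.Rt δ (hor x))) / 2) = _
      rw [hR, O.φt_eq hδ hlt.le, μt, (O.φt_eventuallyEq hδ hlt).deriv_eq]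
      rfl
    have htau : (O.basin hδ).tau x = pt (perp (gradient (rho O.Γ) (hor x))) 0 := by
      change ezL (grd (O.Rt δ ∘ hor) x) = _
      rw [O.grd_Rt hδ hlt, ezL_pt]
    rw [Basin.V0, hlam, htau]
    change _ • O.ft δ (O.Rt δ (hor x)) • _ = _
    rw [hR]
    ext j; fin_cases j <;> simp [limitField, azimuthal, azimuthalH, pt] <;> ring
  · rw [(O.basin hδ).dec_V0.eq_zero t hK]
    have := O.ft_eq_zero_of_notMem hδ hK
    ext j; fin_cases j <;> simp [limitField, azimuthal, azimuthalH, pt, this]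

theorem continuousOn_limitField {g : ℝ → ℝ} (hg : ContinuousOn g (Ioi O.ρ₀)) (t : ℝ) :
    ContinuousOn (limitField O.Γ O.β O.φ g t) O.Om :=
  O.continuousOn_azimuthal (hg.mul (continuousOn_const.mul O.continuousOn_pumping).rexp)

theorem limitField_gap (hδ : 0 < δ) {t : ℝ} (ht : 0 ≤ t) :
    eLpNorm (fun x => (O.basin hδ).V0 t x - limitField O.Γ O.β O.φ O.u t x) 2
      (volume.restrict O.Om) ≤ O.gap δ := by
  refine eLpNorm_mono_ae ?_
  filter_upwards [ae_restrict_mem O.isOpen_Om.measurableSet] with x hx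
  rw [O.V0_eq hδ, norm_sub_rev, limitField, limitField, azimuthal_sub, O.norm_azimuthal _ hx,
    ← sub_mul, abs_mul, abs_of_pos (Real.exp_pos _), Real.norm_eq_abs]
  refine mul_le_of_le_one_right (abs_nonneg _) (Real.exp_le_one_iff.2 ?_)
  have := O.pumping_nonneg (O.rho_hor_gt hx)
  nlinarith

theorem velocity_gap (hδ : 0 < δ) : ∃ C : ℝ, 0 ≤ C ∧ ∀ ε, (hε : 0 < ε) → ε ≤ 1 → ∀ t, 0 ≤ t →
    eLpNorm (fun x => velocity (Basin.Uapp (O.fits hδ) hε.ne' t) x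
      - limitField O.Γ O.β O.φ O.u t x) 2 (volume.restrict O.Om)
      ≤ ENNReal.ofReal C * (O.basin hδ).small O.Om ε + O.gap δ := by
  obtain ⟨C, hC0, hC⟩ := Basin.velocity_bound (O.fits hδ)
  refine ⟨C, hC0, fun ε hε hε1 t ht => ?_⟩
  have hΩ := O.isOpen_Om.measurableSet
  have hV : Continuous ((O.basin hδ).V0 t) :=
    ((O.basin hδ).dec_V0.smooth (O.basin hδ).smooth_Λ t).continuous
  have h1 : AEStronglyMeasurable (fun x => velocity (Basin.Uapp (O.fits hδ) hε.ne' t) x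
      - (O.basin hδ).V0 t x) (volume.restrict O.Om) :=
    (Lp.aestronglyMeasurable _).sub hV.aestronglyMeasurable
  have h2 : AEStronglyMeasurable (fun x => (O.basin hδ).V0 t x
      - limitField O.Γ O.β O.φ O.u t x) (volume.restrict O.Om) :=
    hV.aestronglyMeasurable.sub
      ((O.continuousOn_limitField O.smooth_u.continuousOn t).aestronglyMeasurable hΩ)
  have e : (fun x => velocity (Basin.Uapp (O.fits hδ) hε.ne' t) x
      - limitField O.Γ O.β O.φ O.u t x)
      = (fun x => velocity (Basin.Uapp (O.fits hδ) hε.ne' t) x - (O.basin hδ).V0 t x)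
        + fun x => (O.basin hδ).V0 t x - limitField O.Γ O.β O.φ O.u t x := by
    funext x; simp
  rw [e]
  exact (eLpNorm_add_le h1 h2 (by norm_num)).trans
    (add_le_add (hC ε hε hε1 t ht) (O.limitField_gap hδ ht))

/-! #### The uniform gradient bound -/

theorem norm_partialD_tau_le (hδ : 0 < δ) {x : E3} (hx : hor x ∈ O.Kt δ) (j : Fin 3) :
    ‖partialD j (O.basin hδ).tau x‖ ≤ 4 / O.ρ₀ := by
  have hρ := O.ρ₀_pos
  have h1 : O.ρ₀ + δ ≤ rho O.Γ (hor x) := hx.1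
  have htau : ∀ x', O.ρ₀ + δ / 2 < rho O.Γ (hor x') →
      (O.basin hδ).tau x' = pt (perp (gradient (rho O.Γ) (hor x'))) 0 := fun x' hx' => by
    change ezL (grd (O.Rt δ ∘ hor) x') = _
    rw [O.grd_Rt hδ hx', ezL_pt]
  refine norm_partialD_le (by positivity) (contDiff_diff (O.basin hδ).smooth_tau x) ?_ j
  have hopen : IsOpen {x' : E3 | O.ρ₀ + δ / 2 < rho O.Γ (hor x')} :=
    isOpen_lt continuous_const (continuous_rho.comp continuous_hor)
  filter_upwards [hopen.mem_nhds (show O.ρ₀ + δ / 2 < rho O.Γ (hor x) by linarith)] with x' hx'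
  have hx'' : O.ρ₀ + δ / 2 < rho O.Γ (hor x') := hx'
  rw [htau x' hx', htau x (by linarith)]
  obtain ⟨p, hp⟩ := O.island.exists_isNearest (hor x)
  obtain ⟨p', hp'⟩ := O.island.exists_isNearest (hor x')
  have hg := norm_gradient_infDist_sub_le O.island.compact O.island.convex hp hp'
    (notMem_of_rho_pos (by linarith)) (notMem_of_rho_pos (by linarith))
  have e : pt (perp (gradient (rho O.Γ) (hor x'))) 0 - pt (perp (gradient (rho O.Γ) (hor x))) 0
      = pt (perp (gradient (rho O.Γ) (hor x') - gradient (rho O.Γ) (hor x))) 0 := by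
    ext i; fin_cases i <;> simp [pt, perp]; ring
  have e2 : hor x - hor x' = hor (x - x') := by
    rw [← horL_apply, ← horL_apply, ← horL_apply, map_sub]
  rw [e, norm_pt_zero, norm_perp, norm_sub_rev, norm_sub_rev x' x]
  refine hg.trans ?_
  rw [e2]
  have h3 : 4 / Metric.infDist (hor x) O.Γ ≤ 4 / O.ρ₀ := by
    have : O.ρ₀ ≤ Metric.infDist (hor x) O.Γ := by
      change O.ρ₀ ≤ rho O.Γ (hor x); linarith
    gcongr
  exact mul_le_mul h3 (norm_hor_le _) (norm_nonneg _) (by positivity)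

theorem exists_bound_gradient {P Q M₂ : ℝ} (hP : ∀ r ∈ Ioi O.ρ₀, |O.u r| ≤ P * O.φ r)
    (hQ : ∀ r ∈ Ioi O.ρ₀, |deriv O.u r| ≤ Q)
    (hM₂ : ∀ r ∈ Ioi O.ρ₀, |deriv (deriv O.φ) r| ≤ M₂)
    (hlin : ∀ r ∈ Ioi O.ρ₀, O.φ r ≤ O.M * (r - O.ρ₀)) :
    ∃ M', 0 ≤ M' ∧ ∀ δ, (hδ : 0 < δ) → δ ≤ 1 → ∀ t, 0 ≤ t → ∀ x ∈ (O.basin hδ).D, ∀ j,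
      ‖partialD j ((O.basin hδ).V0 t) x‖ ≤ M' * Real.exp (-(O.basin hδ).c * t) := by
  obtain ⟨L, hL0, hL1, hL2⟩ := exists_bound_cutoff_factors
  set q := √(2 * O.β)
  set M' := (L * (P * O.M) + L * O.N + Q)
    + 2 * P * (q * (O.M * (2 + O.M ^ 2) + O.H * (O.M * M₂))) / q + O.N * (4 / O.ρ₀) with hM'
  refine ⟨|M'|, abs_nonneg _, fun δ hδ hδ1 t ht x hx j => ?_⟩
  have hK : hor x ∈ O.Kt δ := hx.1
  have h1 : O.ρ₀ + δ ≤ rho O.Γ (hor x) := hK.1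
  set r := rho O.Γ (hor x) with hr
  have hlt : O.ρ₀ + δ / 2 < r := by linarith
  have hr0 : r ∈ Ioi O.ρ₀ := show O.ρ₀ < r by linarith
  have hR : (O.basin hδ).r x = r := O.Rt_eq hδ hlt.le
  have hφ : (O.basin hδ).φ r = O.φ r := O.φt_eq hδ hlt.le
  have hφp := O.φ_pos r hr0
  have hP0 : 0 ≤ P := by
    have := (abs_nonneg _).trans (hP r hr0)
    by_contra! hneg
    nlinarith
  have hP' : |O.u r| ≤ P * O.M * (r - O.ρ₀) := by
    refine (hP r hr0).trans ?_
    rw [mul_assoc]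
    exact mul_le_mul_of_nonneg_left (hlin r hr0) hP0
  have hd2 : |deriv (deriv (O.basin hδ).φ) r| ≤ M₂ := by
    change |deriv (deriv (O.φt δ)) r| ≤ M₂
    rw [(O.φt_eventuallyEq hδ hlt).deriv.deriv_eq]
    exact hM₂ r hr0
  have hpr : |partialD j (O.basin hδ).r x| ≤ 1 := by
    change |partialD j (O.Rt δ ∘ hor) x| ≤ 1
    rw [O.partialD_Rt hδ hlt]
    have h2 := norm_gradient_rho O.island (show 0 < rho O.Γ (hor x) by linarith [O.ρ₀_pos])
    rw [← h2, ← norm_pt_zero]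
    exact PiLp.norm_apply_le (pt (gradient (rho O.Γ) (hor x)) 0) j
  have key := (O.basin hδ).norm_partialD_V0_le (M₁ := P)
    (M₂ := q * (O.M * (2 + O.M ^ 2) + O.H * (O.M * M₂))) (M₃ := L * (P * O.M) + L * O.N + Q)
    (M₄ := 4 / O.ρ₀) ht hx j (O.one_le_μt δ _) ?_ ?_ ?_ ?_ hpr (O.norm_partialD_tau_le hδ hK j)
  · refine key.trans (mul_le_mul_of_nonneg_right ?_ (Real.exp_nonneg _))
    exact le_abs_self M'
  · rw [hR, hφ]
    change 2 * (√(2 * O.β) / (2 * O.H)) * O.φ r ≤ √(2 * O.β)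
    have h2 := O.φ_le r hr0
    have hH := O.H_pos
    calc 2 * (√(2 * O.β) / (2 * O.H)) * O.φ r = √(2 * O.β) * (O.φ r / O.H) := by field_simp
      _ ≤ _ := mul_le_of_le_one_right (Real.sqrt_nonneg _) ((div_le_one hH).2 h2)
  · rw [hR, hφ]
    exact (O.abs_ft_le δ r).trans (hP r hr0)
  · rw [hR]
    exact (O.basin hδ).abs_deriv_lam_mul_le (O.μt_pow δ) (O.abs_deriv_φt_le hδ hlt) hd2
      (hφ.trans_le (O.φ_le r hr0))
  · rw [hR]
    refine abs_deriv_truncate_le hL1 hL2 hL0 hδ hδ1 hr0 ?_ (O.abs_u_le r hr0) hP' (hQ r hr0)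
    exact (O.smooth_u.contDiffAt (Ioi_mem_nhds hr0)).differentiableAt (by simp)

/-! #### The weighted norm of the boundary layers -/

theorem hvNorm_UBL_le (hδ : 0 < δ) : ∃ C : ℝ, 0 ≤ C ∧ ∀ ε, 0 < ε → ∀ t, 0 ≤ t →
    hvNorm O.Γ O.ρ₀ O.φ (fun x => √(dφ O.Γ O.φ x) • (O.basin hδ).UBL ε t x)
      ≤ ENNReal.ofReal (4 * (3 * O.N + C * ε) * (ε * (√(2 * O.β) * (1 + O.M ^ 2)))) := by
  obtain ⟨C, hC0, hC⟩ := (O.basin hδ).exists_layer_norm_le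
  refine ⟨C, hC0, fun ε hε t ht => iSup₂_le fun y hy => ?_⟩
  by_cases hK : y ∈ O.Kt δ
  · have h1 : O.ρ₀ + δ ≤ rho O.Γ y := hK.1
    have hφ : (O.basin hδ).φ ((O.basin hδ).R y) = O.φ (rho O.Γ y) := by
      change O.φt δ (O.Rt δ y) = _
      rw [O.Rt_eq hδ (by linarith), O.φt_eq hδ (by linarith)]
    have h := hC ε hε t ht y hK
    rw [hφ] at h
    refine le_trans (le_of_eq ?_) h
    simp only [dφ, hor_pt, pt_two]
  · have h0 : ∀ z, (O.basin hδ).UBL ε t (pt y z) = 0 := fun z =>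
      (O.basin hδ).UBL_eq_zero_off ε t (by rw [hor_pt]; exact hK)
    simp [h0]

end OceanData

/-! ### Choice of the truncation in terms of the viscosity -/

theorem exists_diagonal {P : ℕ → ℝ → Prop} (h0 : ∀ ε, P 0 ε)
    (h : ∀ n, ∀ᶠ ε in 𝓝[>] (0 : ℝ), P n ε) :
    ∃ n : ℝ → ℕ, (∀ ε, P (n ε) ε) ∧ Tendsto n (𝓝[>] 0) atTop := by
  classical
  refine ⟨fun ε => Nat.findGreatest (fun k => P k ε) ⌊ε⁻¹⌋₊,
    fun ε => Nat.findGreatest_spec (P := fun k => P k ε) (Nat.zero_le _) (h0 ε), ?_⟩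
  refine tendsto_atTop.2 fun m => ?_
  filter_upwards [h m, (tendsto_inv_nhdsGT_zero (𝕜 := ℝ)).eventually_ge_atTop (m : ℝ)] with ε h1 h2
  exact Nat.le_findGreatest (Nat.le_floor h2) h1

/-- An approximate solution for one value of the viscosity. -/
structure Candidate (Ω : Set E3) where
  U : ℝ → Vσ Ω
  p : ℝ → Lp ℝ 2 (volume.restrict Ω)
  E : ℝ → L2 Ω
  UBL : ℝ → E3 → E3
  G : ℝ → Fin 3 → Lp E3 ⊤ (volume.restrict Ω)

namespace OceanData

variable (O : OceanData)

/-- The candidate has all the required properties, with an error at most `η`. -/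
structure Good (ε : ℝ) (m : ℝ≥0) (η : ℝ≥0∞) (X : Candidate O.Om) : Prop where
  contDiffOn_U : ContDiffOn ℝ 1 X.U (Ici 0)
  memLp_p : ∀ T : ℝ, MemLp X.p 2 (volume.restrict (Icc 0 T))
  memLp_E : MemLp X.E 1 timeMeasure
  solves : SolvesStokesCoriolis O.Om O.β ε X.U X.p X.E
  norm_E_le : eLpNorm X.E 1 timeMeasure ≤ η
  norm_sub_le : ∀ t ∈ Ici (0 : ℝ), eLpNorm (fun x => velocity (X.U t) x
    - limitField O.Γ O.β O.φ O.u t x) 2 (volume.restrict O.Om) ≤ η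
  continuousOn_UBL : ContinuousOn (fun q : ℝ × E3 => X.UBL q.1 q.2) (Ici 0 ×ˢ O.Om)
  weak : ∀ t ∈ Ici (0 : ℝ), ∀ j : Fin 3, HasWeakPartial O.Om j
    (fun x => velocity (X.U t) x - X.UBL t x) (X.G t j)
  memLp_G : MemLp X.G 1 timeMeasure
  norm_G_le : eLpNorm X.G 1 timeMeasure ≤ m
  hvNorm_le : ∀ t ∈ Ici (0 : ℝ), hvNorm O.Γ O.ρ₀ O.φ (fun x => √(dφ O.Γ O.φ x) • X.UBL t x)
    ≤ ENNReal.ofReal (16 * O.N * (ε * (√(2 * O.β) * (1 + O.M ^ 2))))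

/-- The trivial approximation. -/
def zeroCandidate (Ω : Set E3) : Candidate Ω := ⟨0, 0, 0, 0, 0⟩

theorem good_zero (ε : ℝ) (m : ℝ≥0) {η : ℝ≥0∞}
    (h : ∀ t ∈ Ici (0 : ℝ), eLpNorm (limitField O.Γ O.β O.φ O.u t) 2 (volume.restrict O.Om) ≤ η) :
    O.Good ε m η (zeroCandidate O.Om) := by
  have hv : (velocity (0 : Vσ O.Om) : E3 → E3) =ᵐ[volume.restrict O.Om] 0 :=
    Lp.coeFn_zero E3 2 (volume.restrict O.Om)
  have hg : ∀ j, (grad (0 : Vσ O.Om) j : E3 → E3) =ᵐ[volume.restrict O.Om] 0 := fun j =>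
    Lp.coeFn_zero E3 2 (volume.restrict O.Om)
  refine ⟨contDiffOn_const, fun T => MemLp.zero', MemLp.zero', ?_, ?_, fun t ht => ?_,
    continuousOn_const, fun t _ j => ?_, MemLp.zero', ?_, fun t _ => ?_⟩
  · refine Eventually.of_forall fun t ψ hψ => ?_
    have hd : derivWithin (zeroCandidate O.Om).U (Ici 0) t = 0 := by
      change derivWithin (fun _ => (0 : Vσ O.Om)) (Ici 0) t = 0
      simp
    have e0 : ∫ x in O.Om, inner ℝ (velocity (0 : Vσ O.Om) x) (ψ x) = 0 :=
      integral_eq_zero_of_ae (by filter_upwards [hv] with x hx; simp [hx])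
    have e1 : ∀ j, ∫ x in O.Om, inner ℝ (grad (0 : Vσ O.Om) j x) (partialD j ψ x) = 0 := fun j =>
      integral_eq_zero_of_ae (by filter_upwards [hg j] with x hx; simp [hx])
    have e2 : ∫ x in O.Om, inner ℝ (ezWedge (velocity (0 : Vσ O.Om) x)) (ψ x) = 0 :=
      integral_eq_zero_of_ae (by
        filter_upwards [hv] with x hx
        rw [hx, ← ezL_apply]; simp)
    have e3 : ∫ x in O.Om, ((0 : Lp ℝ 2 (volume.restrict O.Om)) : E3 → ℝ) x
        * ∑ j : Fin 3, partialD j ψ x j = 0 :=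
      integral_eq_zero_of_ae (by
        filter_upwards [Lp.coeFn_zero ℝ 2 (volume.restrict O.Om)] with x hx
        simp only [Pi.zero_apply] at hx ⊢
        rw [hx, zero_mul])
    have e4 : ∫ x in O.Om, inner ℝ (((0 : L2 O.Om) : E3 → E3) x) (ψ x) = 0 :=
      integral_eq_zero_of_ae (by
        filter_upwards [Lp.coeFn_zero E3 2 (volume.restrict O.Om)] with x hx
        simp only [Pi.zero_apply] at hx ⊢
        rw [hx, inner_zero_left])
    rw [hd, e0]
    change 0 + ε * O.β * (∑ j : Fin 3, ∫ x in O.Om, inner ℝ (grad (0 : Vσ O.Om) j x)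
      (partialD j ψ x)) + 1 / ε * (∫ x in O.Om, inner ℝ (ezWedge (velocity (0 : Vσ O.Om) x)) (ψ x))
      = 1 / ε * (∫ x in O.Om, ((0 : Lp ℝ 2 (volume.restrict O.Om)) : E3 → ℝ) x
        * ∑ j : Fin 3, partialD j ψ x j) + ∫ x in O.Om, inner ℝ (((0 : L2 O.Om) : E3 → E3) x) (ψ x)
    rw [Finset.sum_eq_zero fun j _ => e1 j, e2, e3, e4]
    ring
  · exact eLpNorm_zero.trans_le zero_le
  · refine (eLpNorm_congr_norm_ae ?_).trans_le (h t ht)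
    filter_upwards [hv] with x hx
    change ‖velocity (0 : Vσ O.Om) x - _‖ = _
    rw [hx, Pi.zero_apply, zero_sub, norm_neg]
  · refine hasWeakPartial_of_smooth (F := fun _ => 0) j contDiff_const ?_ ?_
    · filter_upwards [hv] with x hx
      change velocity (0 : Vσ O.Om) x - 0 = 0
      rw [hx, Pi.zero_apply, sub_zero]
    · filter_upwards [Lp.coeFn_zero E3 ⊤ (volume.restrict O.Om)] with x hx
      rw [partialD_const]
      exact hx
  · exact eLpNorm_zero.trans_le zero_le
  · simp [hvNorm, zeroCandidate]

theorem exists_good {P Q M₂ : ℝ} (hP : ∀ r ∈ Ioi O.ρ₀, |O.u r| ≤ P * O.φ r)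
    (hQ : ∀ r ∈ Ioi O.ρ₀, |deriv O.u r| ≤ Q)
    (hM₂ : ∀ r ∈ Ioi O.ρ₀, |deriv (deriv O.φ) r| ≤ M₂)
    (hlin : ∀ r ∈ Ioi O.ρ₀, O.φ r ≤ O.M * (r - O.ρ₀))
    (hL2 : ∫⁻ y in surface O.Γ O.ρ₀, ‖O.u (rho O.Γ y)‖ₑ ^ 2 ≠ ⊤) :
    ∃ m : ℝ≥0, ∀ η : ℝ≥0∞, 0 < η → ∀ᶠ ε in 𝓝[>] (0 : ℝ), ∃ X, O.Good ε m η X := by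
  rcases O.N_nonneg.eq_or_lt with hN | hN
  · refine ⟨0, fun η _ => Eventually.of_forall fun ε => ⟨_, O.good_zero ε 0 fun t _ => ?_⟩⟩
    have h0 : limitField O.Γ O.β O.φ O.u t =ᵐ[volume.restrict O.Om] 0 := by
      filter_upwards [ae_restrict_mem O.isOpen_Om.measurableSet] with x hx
      have h1 := O.abs_u_le _ (O.rho_hor_gt hx)
      rw [← hN] at h1
      refine norm_eq_zero.1 ?_
      rw [limitField, O.norm_azimuthal _ hx, abs_eq_zero.1 (le_antisymm h1 (abs_nonneg _)),
        zero_mul, abs_zero]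
    rw [eLpNorm_congr_ae h0, eLpNorm_zero]
    exact zero_le
  obtain ⟨M', hM'0, hM'⟩ := O.exists_bound_gradient hP hQ hM₂ hlin
  refine ⟨((M' + 1) / (√(2 * O.β) / (2 * O.H))).toNNReal, fun η hη => ?_⟩
  have hη2 : 0 < η / 2 := ENNReal.half_pos hη.ne'
  obtain ⟨n, hn⟩ := ((O.tendsto_gap hL2).eventually_lt_const hη2).exists
  have hδ : (0 : ℝ) < 1 / (n + 1) := by positivity
  have hδ1 : (1 : ℝ) / (n + 1) ≤ 1 := by
    rw [div_le_one (by positivity)]; linarith [Nat.cast_nonneg (α := ℝ) n]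
  set B := O.basin hδ with hB
  obtain ⟨CE, -, hCE⟩ := Basin.Eapp_bound (O.fits hδ)
  obtain ⟨CV, -, hCV⟩ := O.velocity_gap hδ
  obtain ⟨CG, -, hCG⟩ := Basin.Gapp_bound (B := B) (Ω := O.Om) hM'0 (hM' _ hδ hδ1)
  obtain ⟨CH, -, hCH⟩ := O.hvNorm_UBL_le hδ
  have hsmall := Basin.tendsto_small (O.fits hδ)
  have ts : ∀ C : ℝ, Tendsto (fun ε => ENNReal.ofReal C * B.small O.Om ε) (𝓝[>] 0) (𝓝 0) :=
    fun C => by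
      have := ENNReal.Tendsto.const_mul (a := ENNReal.ofReal C) hsmall
        (Or.inr ENNReal.ofReal_ne_top)
      rwa [mul_zero] at this
  have tr : ∀ C : ℝ, Tendsto (fun ε : ℝ => C * ε) (𝓝[>] 0) (𝓝 0) := fun C => by
    have : Tendsto (fun ε : ℝ => C * ε) (𝓝 0) (𝓝 (C * 0)) := tendsto_id.const_mul C
    rw [mul_zero] at this
    exact this.mono_left nhdsWithin_le_nhds
  filter_upwards [Ioo_mem_nhdsGT (zero_lt_one' ℝ), (ts CE).eventually_lt_const hη,
    (ts CV).eventually_lt_const hη2, (tr CG).eventually_lt_const zero_lt_one,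
    (tr CH).eventually_lt_const hN] with ε hε h1 h2 h3 h4
  refine ⟨⟨Basin.Uapp (O.fits hδ) hε.1.ne', Basin.papp (O.fits hδ) ε, Basin.Eapp B O.Om ε,
    B.UBL ε, Basin.Gapp B O.Om ε⟩, Basin.contDiffOn_Uapp (O.fits hδ) hε.1.ne', Basin.memLp_papp (O.fits hδ) ε,
    (hCE ε hε.1 hε.2.le).1, Basin.solves (O.fits hδ) hε.1.ne', (hCE ε hε.1 hε.2.le).2.trans h1.le, fun t ht => ?_,
    (B.smooth_UBL ε).continuous.continuousOn, fun t _ j => Basin.Gapp_weak (O.fits hδ) hε.1.ne' t j,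
    (hCG ε hε.1).1, (hCG ε hε.1).2.trans ?_, fun t ht => (hCH ε hε.1 t ht).trans ?_⟩
  · refine (hCV ε hε.1 hε.2.le t ht).trans ?_
    exact (add_le_add h2.le hn.le).trans_eq (ENNReal.add_halves η)
  · refine ENNReal.ofReal_le_ofReal ?_
    have hc : 0 < √(2 * O.β) / (2 * O.H) := B.c_pos
    change (M' + CG * ε) / (√(2 * O.β) / (2 * O.H)) ≤ _
    gcongr
  · refine ENNReal.ofReal_le_ofReal ?_
    have hε0 := hε.1
    exact mul_le_mul_of_nonneg_right (by linarith) (by positivity)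

theorem exists_family {P Q M₂ : ℝ} (hP : ∀ r ∈ Ioi O.ρ₀, |O.u r| ≤ P * O.φ r)
    (hQ : ∀ r ∈ Ioi O.ρ₀, |deriv O.u r| ≤ Q)
    (hM₂ : ∀ r ∈ Ioi O.ρ₀, |deriv (deriv O.φ) r| ≤ M₂)
    (hlin : ∀ r ∈ Ioi O.ρ₀, O.φ r ≤ O.M * (r - O.ρ₀))
    (hL2 : ∫⁻ y in surface O.Γ O.ρ₀, ‖O.u (rho O.Γ y)‖ₑ ^ 2 ≠ ⊤) :
    ∃ (m : ℝ≥0) (η : ℝ → ℝ≥0∞) (X : ℝ → Candidate O.Om), Tendsto η (𝓝[>] 0) (𝓝 0) ∧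
      ∀ ε, O.Good ε m (η ε) (X ε) := by
  obtain ⟨m, hm⟩ := O.exists_good hP hQ hM₂ hlin hL2
  obtain ⟨n, hn, hlim⟩ := exists_diagonal (P := fun n ε => ∃ X, O.Good ε m ((n : ℝ≥0∞)⁻¹) X)
    (fun ε => ⟨_, O.good_zero ε m fun t _ => by simp⟩)
    fun n => hm _ (ENNReal.inv_pos.2 (ENNReal.natCast_ne_top n))
  choose X hX using hn
  exact ⟨m, fun ε => ((n ε : ℕ) : ℝ≥0∞)⁻¹, X, ENNReal.tendsto_inv_nat_nhds_zero.comp hlim, hX⟩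

/-! ### The supremum of the initial datum -/

theorem exists_mem_Om {r : ℝ} (hr : O.ρ₀ < r) : ∃ x ∈ O.Om, rho O.Γ (hor x) = r := by
  obtain ⟨y, hy⟩ : ∃ y, y ∉ O.Γ := by
    by_contra! h
    exact noncompact_univ E2 ((eq_univ_of_forall h) ▸ O.island.compact)
  have hy0 : 0 < rho O.Γ y :=
    (O.island.compact.isClosed.notMem_iff_infDist_pos O.island.nonempty).1 hy
  obtain ⟨p, v, -, -, hray⟩ := exists_ray O.island hy0
  have h1 := (hray r (O.ρ₀_pos.trans hr)).1
  have hφ := O.φ_pos r hr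
  refine ⟨pt (p + r • v) (-(O.φ r / 2)), ⟨?_, ?_, ?_⟩, ?_⟩
  · rw [hor_pt]; exact mem_surface_iff.2 (by rw [h1]; exact hr)
  · rw [hor_pt, h1, pt_two]; linarith
  · rw [pt_two]; linarith
  · rw [hor_pt, h1]

theorem supNorm_ne_top : supNorm O.Om (azimuthal O.Γ O.u) ≠ ⊤ := by
  have h : eLpNorm (azimuthal O.Γ O.u) ⊤ (volume.restrict O.Om) ≤ ENNReal.ofReal O.N := by
    refine eLpNormEssSup_le_of_ae_bound ?_
    filter_upwards [ae_restrict_mem O.isOpen_Om.measurableSet] with x hx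
    rw [O.norm_azimuthal _ hx]
    exact O.abs_u_le _ (O.rho_hor_gt hx)
  exact (h.trans_lt ENNReal.ofReal_lt_top).ne

theorem abs_u_le_supNorm {r : ℝ} (hr : r ∈ Ioi O.ρ₀) :
    |O.u r| ≤ (supNorm O.Om (azimuthal O.Γ O.u)).toReal := by
  obtain ⟨x, hx, hxr⟩ := O.exists_mem_Om hr
  by_contra! hlt
  have hc := O.continuousOn_comp_rho O.smooth_u.continuousOn.abs
  set S := (supNorm O.Om (azimuthal O.Γ O.u)).toReal
  have hopen := hc.isOpen_inter_preimage O.isOpen_Om (isOpen_Ioi (a := S))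
  have hne : (O.Om ∩ (fun x : E3 => |O.u (rho O.Γ (hor x))|) ⁻¹' Ioi S).Nonempty :=
    ⟨x, hx, by rw [mem_preimage, hxr]; exact hlt⟩
  have hpos := hopen.measure_pos volume hne
  refine hpos.ne' ?_
  have hae : ∀ᵐ x ∂volume.restrict O.Om, ‖azimuthal O.Γ O.u x‖ₑ
      ≤ supNorm O.Om (azimuthal O.Γ O.u) := by
    have := ae_le_eLpNormEssSup (f := azimuthal O.Γ O.u) (μ := volume.restrict O.Om)
    simpa [supNorm] using this
  rw [ae_restrict_iff' O.isOpen_Om.measurableSet] at hae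
  refine measure_mono_null ?_ hae
  rintro x' ⟨h1, h2⟩
  simp only [mem_compl_iff, mem_ofPred_eq, not_forall, exists_prop]
  refine ⟨h1, fun h => ?_⟩
  have h3 := ENNReal.toReal_mono O.supNorm_ne_top h
  rw [toReal_enorm, O.norm_azimuthal _ h1] at h3
  exact absurd h2 (not_lt.2 h3)

end OceanData

/-! ### Consequences of the assumptions on the depth -/

section Depth

variable {Γ : Set E2} {ρ₀ H : ℝ} {φ : ℝ → ℝ}

theorem IsDepth.derivWithin_eq {r : ℝ} (hr : r ∈ Ioi ρ₀) (g : ℝ → ℝ) :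
    derivWithin g (Ici ρ₀) r = deriv g r := derivWithin_of_mem_nhds (Ici_mem_nhds hr)

theorem IsDepth.exists_bound_deriv (hφ : IsDepth Γ ρ₀ H φ) : ∃ M : ℝ,
    (∀ r ∈ Ioi ρ₀, |deriv φ r| ≤ M) ∧ ∀ r ∈ Ioi ρ₀, φ r ≤ M * (r - ρ₀) := by
  obtain ⟨M, hM⟩ := hφ.bounded 1
  simp only [iteratedDerivWithin_one] at hM
  refine ⟨M, fun r hr => ?_, fun r hr => ?_⟩
  · rw [← IsDepth.derivWithin_eq hr]
    exact hM r (Ioi_subset_Ici_self hr)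
  · have h1 := (convex_Ici ρ₀).norm_image_sub_le_of_norm_derivWithin_le
      (hφ.smooth.differentiableOn (by simp)) hM self_mem_Ici (Ioi_subset_Ici_self hr)
    rw [(hφ.zero ρ₀ self_mem_Ici).2 rfl, sub_zero, Real.norm_eq_abs, Real.norm_eq_abs,
      abs_of_pos (sub_pos.2 hr)] at h1
    exact (le_abs_self _).trans h1

theorem IsDepth.exists_bound_deriv_deriv (hφ : IsDepth Γ ρ₀ H φ) :
    ∃ M : ℝ, ∀ r ∈ Ioi ρ₀, |deriv (deriv φ) r| ≤ M := by
  obtain ⟨M, hM⟩ := hφ.bounded 2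
  refine ⟨M, fun r hr => ?_⟩
  have h := hM r (Ioi_subset_Ici_self hr)
  rw [iteratedDerivWithin_succ, IsDepth.derivWithin_eq hr] at h
  have e : iteratedDerivWithin 1 φ (Ici ρ₀) =ᶠ[𝓝 r] deriv φ := by
    filter_upwards [Ioi_mem_nhds hr] with s hs
    rw [iteratedDerivWithin_one, IsDepth.derivWithin_eq hs]
  rwa [e.deriv_eq] at h

theorem IsDepth.pos (hφ : IsDepth Γ ρ₀ H φ) {r : ℝ} (hr : r ∈ Ioi ρ₀) : 0 < φ r :=
  lt_of_le_of_ne (hφ.range r (Ioi_subset_Ici_self hr)).1 fun h =>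
    (ne_of_gt hr) ((hφ.zero r (Ioi_subset_Ici_self hr)).1 h.symm)

theorem IsWellPrepared.exists_bound (hφ : IsDepth Γ ρ₀ H φ) {u : ℝ → ℝ}
    (hu : IsWellPrepared Γ ρ₀ φ u) : ∃ P, ∀ r ∈ Ioi ρ₀, |u r| ≤ P * φ r := by
  obtain ⟨P, hP⟩ := hu.bounded
  refine ⟨P, fun r hr => ?_⟩
  have := hP r hr
  rwa [abs_div, abs_of_pos (hφ.pos hr), div_le_iff₀ (hφ.pos hr)] at this

theorem IsWellPrepared.lintegral_ne_top (hΓ : IsIsland Γ) (hρ₀ : 0 < ρ₀) {u : ℝ → ℝ}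
    (hu : IsWellPrepared Γ ρ₀ φ u) : ∫⁻ y in surface Γ ρ₀, ‖u (rho Γ y)‖ₑ ^ 2 ≠ ⊤ := by
  have h := (hu.sobolev 0).2
  rw [eLpNorm_lt_top_iff_lintegral_rpow_enorm_lt_top (by simp) (by simp)] at h
  refine (lt_of_le_of_lt (le_of_eq ?_) h).ne
  refine setLIntegral_congr_fun isOpen_surface.measurableSet fun y hy => ?_
  have e : ‖iteratedFDeriv ℝ 0 (azimuthalH Γ u) y‖ = ‖u (rho Γ y)‖ := by
    rw [norm_iteratedFDeriv_zero, azimuthalH, norm_smul, norm_perp,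
      norm_gradient_rho hΓ (hρ₀.trans (mem_surface_iff.1 hy)), mul_one]
  simp only [ENNReal.toReal_ofNat, ENNReal.rpow_ofNat]
  rw [← ofReal_norm, ← ofReal_norm, e]

end Depth

end Ekman

end

theorem proposition2p2 (Γ : Set E2) (hΓ : IsIsland Γ)
    (ρ₀ H β ε₀ : ℝ) (hρ₀ : 0 < ρ₀) (hH : 0 < H) (hβ : 0 < β) (hε₀ : 0 < ε₀)
    (φ : ℝ → ℝ) (hφ : IsDepth Γ ρ₀ H φ) :
    -- the constant depends on the domain and on `β`, `ε₀`, but neither on `u₀` nor on `ε`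
    ∃ C : ℝ≥0, ∀ u₀θ : ℝ → ℝ, IsWellPrepared Γ ρ₀ φ u₀θ →
      ∃ (U : ℝ → ℝ → Vσ (ocean Γ ρ₀ φ))
        (p : ℝ → ℝ → Lp ℝ 2 (volume.restrict (ocean Γ ρ₀ φ)))
        (E : ℝ → ℝ → L2 (ocean Γ ρ₀ φ))
        (UBL : ℝ → ℝ → E3 → E3)
        (G : ℝ → ℝ → Fin 3 → Lp E3 ∞ (volume.restrict (ocean Γ ρ₀ φ))),
        -- regularity, and the approximate linear system
        (∀ ε ∈ Ioc 0 ε₀,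
          ContDiffOn ℝ 1 (U ε) (Ici 0) ∧
          (∀ T : ℝ, MemLp (p ε) 2 (volume.restrict (Icc 0 T))) ∧
          MemLp (E ε) 1 timeMeasure ∧
          SolvesStokesCoriolis (ocean Γ ρ₀ φ) β ε (U ε) (p ε) (E ε)) ∧
        Tendsto (fun ε => eLpNorm (E ε) 1 timeMeasure) (𝓝[>] 0) (𝓝 0) ∧
        Tendsto (fun ε => eLpNorm (fun x => velocity (U ε 0) x - azimuthal Γ u₀θ x) 2
          (volume.restrict (ocean Γ ρ₀ φ))) (𝓝[>] 0) (𝓝 0) ∧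
        -- convergence to the limit profile
        Tendsto (fun ε => ⨆ t ∈ Ici (0 : ℝ),
          eLpNorm (fun x => velocity (U ε t) x - limitField Γ β φ u₀θ t x) 2
            (volume.restrict (ocean Γ ρ₀ φ))) (𝓝[>] 0) (𝓝 0) ∧
        -- the gradient of `U - UBL` is bounded in `L¹(ℝ⁺; L^∞)`
        (∀ ε ∈ Ioc 0 ε₀,
          ContinuousOn (fun q : ℝ × E3 => UBL ε q.1 q.2) (Ici 0 ×ˢ ocean Γ ρ₀ φ) ∧
          (∀ t ∈ Ici (0 : ℝ), ∀ j : Fin 3, HasWeakPartial (ocean Γ ρ₀ φ) j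
            (fun x => velocity (U ε t) x - UBL ε t x) (G ε t j)) ∧
          MemLp (G ε) 1 timeMeasure) ∧
        (∃ M : ℝ≥0, ∀ ε ∈ Ioc 0 ε₀, eLpNorm (G ε) 1 timeMeasure ≤ M) ∧
        -- smallness of the boundary layer
        (∀ ε ∈ Ioc 0 ε₀,
          ⨆ t ∈ Ici (0 : ℝ), hvNorm Γ ρ₀ φ (fun x => √(dφ Γ φ x) • UBL ε t x) ≤
            C * ENNReal.ofReal ε * supNorm (ocean Γ ρ₀ φ) (azimuthal Γ u₀θ) +
            C * ENNReal.ofReal (ε ^ 2) * W1Norm (ocean Γ ρ₀ φ) (azimuthal Γ u₀θ)) := by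
  obtain ⟨M, hM, hlin⟩ := hφ.exists_bound_deriv
  obtain ⟨M₂, hM₂⟩ := hφ.exists_bound_deriv_deriv
  refine ⟨(16 * (√(2 * β) * (1 + M ^ 2))).toNNReal, fun u₀θ hu => ?_⟩
  obtain ⟨P, hP⟩ := hu.exists_bound hφ
  obtain ⟨Q, hQ⟩ := exists_bound_deriv_profile hΓ hρ₀ hu
  have hφH : ∀ r ∈ Ioi ρ₀, φ r ≤ H := fun r hr => (hφ.range r (Ioi_subset_Ici_self hr)).2
  let O₀ : OceanData :=
    { Γ := Γ, ρ₀ := ρ₀, H := H, β := β, N := |P| * H, M := M, φ := φ, u := u₀θ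
      island := hΓ
      ρ₀_pos := hρ₀
      H_pos := hH
      β_pos := hβ
      smooth_φ := hφ.smooth.mono Ioi_subset_Ici_self
      smooth_u := hu.smooth.mono Ioi_subset_Ici_self
      φ_pos := fun r hr => hφ.pos hr
      φ_le := hφH
      abs_deriv_φ_le := hM
      abs_u_le := fun r hr => (hP r hr).trans (mul_le_mul (le_abs_self P) (hφH r hr)
        (hφ.pos hr).le (abs_nonneg P)) }
  have hS : supNorm (ocean Γ ρ₀ φ) (azimuthal Γ u₀θ) ≠ ⊤ := O₀.supNorm_ne_top
  let O : OceanData :=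
    { O₀ with
      N := (supNorm (ocean Γ ρ₀ φ) (azimuthal Γ u₀θ)).toReal
      abs_u_le := fun r hr => O₀.abs_u_le_supNorm hr }
  obtain ⟨m, η, X, hη, hX⟩ := O.exists_family hP hQ hM₂ hlin (hu.lintegral_ne_top hΓ hρ₀)
  have hlim0 : limitField Γ β φ u₀θ 0 = azimuthal Γ u₀θ := by
    simp [limitField]
  refine ⟨fun ε => (X ε).U, fun ε => (X ε).p, fun ε => (X ε).E, fun ε => (X ε).UBL,
    fun ε => (X ε).G, fun ε _ => ⟨(hX ε).contDiffOn_U, (hX ε).memLp_p, (hX ε).memLp_E,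
      (hX ε).solves⟩, ?_, ?_, ?_, fun ε _ => ⟨(hX ε).continuousOn_UBL, (hX ε).weak,
      (hX ε).memLp_G⟩, ⟨m, fun ε _ => (hX ε).norm_G_le⟩, fun ε hε => ?_⟩
  · exact tendsto_of_tendsto_of_tendsto_of_le_of_le tendsto_const_nhds hη (fun _ => zero_le)
      fun ε => (hX ε).norm_E_le
  · refine tendsto_of_tendsto_of_tendsto_of_le_of_le tendsto_const_nhds hη (fun _ => zero_le)
      fun ε => ?_
    have h := (hX ε).norm_sub_le 0 self_mem_Ici
    change eLpNorm (fun x => velocity ((X ε).U 0) x - limitField Γ β φ u₀θ 0 x) 2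
      (volume.restrict (ocean Γ ρ₀ φ)) ≤ η ε at h
    rwa [hlim0] at h
  · exact tendsto_of_tendsto_of_tendsto_of_le_of_le tendsto_const_nhds hη (fun _ => zero_le)
      fun ε => iSup₂_le fun t ht => (hX ε).norm_sub_le t ht
  · refine iSup₂_le fun t ht => ((hX ε).hvNorm_le t ht).trans (le_trans (le_of_eq ?_) le_self_add)
    change ENNReal.ofReal (16 * (supNorm (ocean Γ ρ₀ φ) (azimuthal Γ u₀θ)).toReal
      * (ε * (√(2 * β) * (1 + M ^ 2)))) = ENNReal.ofReal (16 * (√(2 * β) * (1 + M ^ 2)))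
        * ENNReal.ofReal ε * supNorm (ocean Γ ρ₀ φ) (azimuthal Γ u₀θ)
    have hε0 := hε.1.le
    rw [← ENNReal.ofReal_mul (by positivity)]
    nth_rw 2 [← ENNReal.ofReal_toReal hS]
    rw [← ENNReal.ofReal_mul (by positivity)]
    congr 1
    ring
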